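/- Let $P$ and $Q$ be polygonal curves in $\mathbb{R}^d$ with vertices $p_0,\dots,p_m$ and $q_0,\dots,q_n$. The grid $G$ has the nodes $(i,j)$, $0\le i\le m$, $0\le j\le n$, with values $G[i,j]=|p_i-q_j|$. A path is a sequence of grid nodes in which each node is the right, upper, or upper-right diagonal neighbour of its predecessor; its maximum is the maximum of $G$ on it. A discrete Fréchet matching of $P$ and $Q$ is a path from $(0,0)$ to $(m,n)$ whose maximum is the least possible one. A path is locally correct if each contiguous part of it has the least maximum among all paths with the same two endpoints as that part. It is strongly locally correct if its maximum without its first node is at most the maximum without the first node of any path with the same endpoints. The algorithm grows a tree $T$ with root $(0,0)$. First the nodes $(i,0)$ with parent $(i-1,0)$ for $1\le i\le m$ and the nodes $(0,j)$ with parent $(0,j-1)$ for $1\le j\le n$ are added; then, for $i=1,\dots,m$ and, for each $i$, for $j=1,\dots,n$, the node $(i,j)$ is added. The parent of $(i,j)$ is the one of the candidates $(i-1,j)$, $(i-1,j-1)$, $(i,j-1)$ that wins against each other candidate: $c$ wins against $c'$ if the maximum of $G$ on the tree path from $c$ to the nearest common ancestor of $c$ and $c'$ is smaller than the one on the tree path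 from $c'$ (in both cases without the common ancestor; an empty maximum is $0$), or if the two are equal and $c$ comes before $c'$ in the order $(i-1,j)\succ(i-1,j-1)\succ(i,j-1)$. A node of $T$ is a growth node if it has a grid neighbour that is not yet in $T$, and dead if neither it nor any of its descendants is a growth node. To find the maxima in constant time, each node keeps up to two shortcuts, one for each face next to the segment to its parent. A face is the area enclosed by the segment between two horizontally or vertically neighbouring growth nodes, neither of them the parent of the other, and their tree paths to their nearest common ancestor, the sink of the face. A shortcut points to the sink and stores the maximum on the tree path to it, without the sink. If, after $(i,j)$ has been attached, $(i-1,j-1)$ is dead and leads to no node of $T$ in the highest row or the rightmost column, then the dead path ending at $(i-1,j-1)$ is removed: its nodes, except the first, are dead and lead to no node of $T$ in the highest row or the rightmost column, while its first node does not have this property and stays in $T$. Two faces merge, and if their sinks differ, the shortcuts to the sink of the merged face that have become outdated are extended to the other sink. Finally, the path of $T$ from $(0,0)$ to $(m,n)$ is returned. **Theorem.** This algorithm, written as one fixed program for a random access machine with real arithmetic, is correct and runs in $O(mn)$ time: 1. For each $d$ there is a constant $C$ such that for all $m,n$ and all $P,Q$ in $\mathbb{R}^d$ the program stops after at most $C\cdot\max(m,1)\cdot\max(n,1)$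 steps, and its output is a discrete Fréchet matching of $P$ and $Q$ that is locally correct. 2. The output is the path from $(0,0)$ to $(m,n)$ in $T$. Every path in $T$ (nodes that were removed at some time included) is strongly locally correct. The parents are those that the rule above prescribes. 3. When a node $(i,j)$ with $1\le i\le m$, $1\le j\le n$ is added, a removed dead path with $k$ nodes (the first one included) causes at most $2k-1$ extensions of shortcuts, and if no dead path is removed, then no shortcut is extended. -/

import Mathlib

namespace DiscreteFrechet

/-! ### Grids, paths and local correctness -/

/-- A node `(i, j)` of the grid: column `i` belongs to the vertex `p_i`, row `j` to `q_j`. -/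
abbrev Node := ℕ × ℕ

/-- `v` is the right, above, or above-right diagonal neighbour of `u`. -/
def Step (u v : Node) : Prop :=
  v = (u.1 + 1, u.2) ∨ v = (u.1, u.2 + 1) ∨ v = (u.1 + 1, u.2 + 1)

/-- `l` is a (nonempty) sequence of nodes from `u` to `v` whose consecutive members are related
by `R`. -/
def IsPathIn (R : Node → Node → Prop) (l : List Node) (u v : Node) : Prop :=
  l.IsChain R ∧ l.head? = some u ∧ l.getLast? = some v

/-- Monotonous paths of the grid. -/
abbrev IsPath (l : List Node) (u v : Node) : Prop := IsPathIn Step l u v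

/-- The maximum of the (non-negative) grid values on a list of nodes; `0` for the empty list. -/
noncomputable def pathMax (G : Node → ℝ) (l : List Node) : ℝ := (l.map G).foldr max 0

/-- `l` attains the minimum, over all monotonous paths from `u` to `v`, of the maximum value. -/
def IsOptimal (G : Node → ℝ) (l : List Node) (u v : Node) : Prop :=
  IsLeast {r : ℝ | ∃ l', IsPath l' u v ∧ r = pathMax G l'} (pathMax G l)

/-- A discrete Fréchet matching of curves with `m` and `n` edges: a monotonous discrete matching
(a path from `(0, 0)` to `(m, n)`) that realizes the discrete Fréchet distance. -/
def IsFrechetMatching (G : Node → ℝ) (m n : ℕ) (l : List Node) : Prop :=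
  IsPath l (0, 0) (m, n) ∧ IsOptimal G l (0, 0) (m, n)

/-- A path is locally correct if each contiguous part of it attains the least possible maximum
between its own two endpoints. -/
def LocallyCorrect (G : Node → ℝ) (l : List Node) : Prop :=
  ∀ s u v, s <:+: l → IsPath s u v → IsOptimal G s u v

/-- Strong local correctness of a path: its maximum without the first node is at most that of any
path with the same endpoints. -/
def StronglyLocallyCorrect (G : Node → ℝ) (l : List Node) : Prop :=
  ∀ u v l', IsPath l u v → IsPath l' u v → pathMax G l.tail ≤ pathMax G l'.tail

/-! ### Trees on the grid: ancestors, choice of parents, dead paths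

A tree is given by its relation `T u v`: "`u` is the parent of `v`". -/

/-- The tree on the nodes of the grid `{0, …, m} × {0, …, n}` with root `(0, 0)` that is given by
parent pointers. -/
def treeOf (m n : ℕ) (parent : Node → Node) (u v : Node) : Prop :=
  v.1 ≤ m ∧ v.2 ≤ n ∧ v ≠ (0, 0) ∧ parent v = u

/-- `u` is an ancestor of `v` (or `v` itself). -/
def Anc (T : Node → Node → Prop) (u v : Node) : Prop := Relation.ReflTransGen T u v

/-- `w` is the nearest common ancestor of `u` and `v`. -/
def IsNCA (T : Node → Node → Prop) (w u v : Node) : Prop :=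
  Anc T w u ∧ Anc T w v ∧ ∀ z, Anc T z u → Anc T z v → Anc T z w

/-- The candidate parents of `(i + 1, j + 1)`. -/
def IsCandidate (i j : ℕ) (c : Node) : Prop :=
  c = (i, j + 1) ∨ c = (i, j) ∨ c = (i + 1, j)

/-- The preference order `(i, j + 1) ≻ (i, j) ≻ (i + 1, j)` of the candidate parents of
`(i + 1, j + 1)`. -/
def Preferred (i j : ℕ) (c c' : Node) : Prop :=
  (c = (i, j + 1) ∧ (c' = (i, j) ∨ c' = (i + 1, j))) ∨ (c = (i, j) ∧ c' = (i + 1, j))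

/-- Candidate `c` wins against `c'`: the maximum from `c` to their nearest common ancestor `w` is
smaller than the one from `c'`, or equal and `c` is preferred; the value of `w` is excluded. -/
def Beats (T : Node → Node → Prop) (G : Node → ℝ) (i j : ℕ) (c c' : Node) : Prop :=
  ∃ w l l', IsNCA T w c c' ∧ IsPathIn T (w :: l) w c ∧ IsPathIn T (w :: l') w c' ∧
    (pathMax G l < pathMax G l' ∨ (pathMax G l = pathMax G l' ∧ Preferred i j c c'))

/-- `p` is the candidate parent of `(i + 1, j + 1)` with the lowest maximum to the nearest common
ancestor, ties being broken by the preference order. -/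
def IsParentChoice (T : Node → Node → Prop) (G : Node → ℝ) (i j : ℕ) (p : Node) : Prop :=
  IsCandidate i j p ∧ ∀ c, IsCandidate i j c → c ≠ p → Beats T G i j p c

/-- `v` has been put into the tree when node `(i, j)` has just been added: row `0` and
column `0` come first, then columns `1, 2, …`, each from bottom to top. -/
def Present (m n i j : ℕ) (v : Node) : Prop :=
  v.1 ≤ m ∧ v.2 ≤ n ∧ (v.1 = 0 ∨ v.2 = 0 ∨ v.1 < i ∨ (v.1 = i ∧ v.2 ≤ j))

/-- Growth nodes: nodes of the tree with a grid neighbour that is not yet part of the tree. -/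
def Growth (m n i j : ℕ) (v : Node) : Prop :=
  Present m n i j v ∧ ∃ w, Step v w ∧ w.1 ≤ m ∧ w.2 ≤ n ∧ ¬ Present m n i j w

/-- A node that is dead (no growth node is among its descendants, itself included) and that does
not lead to the highest row or the rightmost column either; dead paths that end there are left
in the tree. -/
def Removable (m n : ℕ) (T : Node → Node → Prop) (i j : ℕ) (v : Node) : Prop :=
  Present m n i j v ∧ ∀ w, Present m n i j w → Anc T v w →
    ¬ Growth m n i j w ∧ w.1 ≠ m ∧ w.2 ≠ n

/-- `l` is the dead path that ends at `b`, after `(i, j)` has been added: its first node remains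
in the tree, the other ones have to be removed. -/
def IsDeadPath (m n : ℕ) (T : Node → Node → Prop) (i j : ℕ) (l : List Node) (b : Node) : Prop :=
  ∃ u, IsPathIn T l u b ∧ ¬ Removable m n T i j u ∧ ∀ v ∈ l.tail, Removable m n T i j v

/-! ### A random access machine with a step count

The memory has finitely many registers that hold a natural number, a grid node or a real number,
and a record with a fixed number of fields for each grid node. -/

/-- The input: two polygonal curves in `ℝ^d`, given by their vertices. -/
structure Input (d : ℕ) where
  m : ℕ
  n : ℕ
  P : Fin (m + 1) → EuclideanSpace ℝ (Fin d)
  Q : Fin (n + 1) → EuclideanSpace ℝ (Fin d)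

/-- The grid of distances, `|p_i - q_j|` at `(i, j)` for `i ≤ m` and `j ≤ n`. (Indices out of
range, which never matter, are reduced modulo `m + 1` and `n + 1`.) -/
noncomputable def Input.grid {d : ℕ} (I : Input d) (v : Node) : ℝ :=
  dist (I.P (Fin.ofNat (I.m + 1) v.1)) (I.Q (Fin.ofNat (I.n + 1) v.2))

inductive NatReg | i | j | dead | ext
  deriving DecidableEq

inductive NodeReg | g | a | b | c | p | x | y | sab | sbc
  deriving DecidableEq

inductive RealReg | a | ba | bc | c | aFull | cFull
  deriving DecidableEq

/-- Natural-number fields of a node: number of children in the tree; whether the node is in the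
tree (`1` or `0`); and a record of the number of nodes of the dead path that was removed, and of
the number of shortcuts that were extended, when the node was added. -/
inductive NatField | children | inTree | deadNodes | extensions
  deriving DecidableEq

/-- Node-valued fields: the parent, and the targets of the shortcuts that belong to the face on
the left (above) and on the right (below) of the segment from the node to its parent. -/
inductive NodeField | parent | leftSink | rightSink
  deriving DecidableEq

/-- Real-valued fields: the value of the node in the grid, and the maxima that belong to its two
shortcuts (excluding the value of the target). -/
inductive RealField | value | leftMax | rightMax
  deriving DecidableEq

/-- The memory, with the output (a list of nodes). -/
structure Mem where
  natReg : NatReg → ℕ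
  nodeReg : NodeReg → Node
  realReg : RealReg → ℝ
  natField : NatField → Node → ℕ
  nodeField : NodeField → Node → Node
  realField : RealField → Node → ℝ
  out : List Node

def Mem.setNat (s : Mem) (r : NatReg) (k : ℕ) : Mem :=
  { s with natReg := Function.update s.natReg r k }

def Mem.storeNat (s : Mem) (f : NatField) (v : Node) (k : ℕ) : Mem :=
  { s with natField := Function.update s.natField f (Function.update (s.natField f) v k) }

def Mem.setNode (s : Mem) (r : NodeReg) (k : Node) : Mem :=
  { s with nodeReg := Function.update s.nodeReg r k }

def Mem.storeNode (s : Mem) (f : NodeField) (v : Node) (k : Node) : Mem :=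
  { s with nodeField := Function.update s.nodeField f (Function.update (s.nodeField f) v k) }

def Mem.setReal (s : Mem) (r : RealReg) (k : ℝ) : Mem :=
  { s with realReg := Function.update s.realReg r k }

def Mem.storeReal (s : Mem) (f : RealField) (v : Node) (k : ℝ) : Mem :=
  { s with realField := Function.update s.realField f (Function.update (s.realField f) v k) }

/-- Expressions for natural numbers: a literal, the numbers of edges, a register, a coordinate of
a node, a field of a node, sums, (truncated) differences. -/
inductive NatExp
  | lit (k : ℕ)
  | m
  | n
  | reg (r : NatReg)
  | col (r : NodeReg)
  | row (r : NodeReg)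
  | field (f : NatField) (r : NodeReg)
  | add (e e' : NatExp)
  | sub (e e' : NatExp)

/-- Expressions for nodes. -/
inductive NodeExp
  | reg (r : NodeReg)
  | pair (e e' : NatExp)
  | field (f : NodeField) (r : NodeReg)

/-- Expressions for reals; `dist e e'` is the distance of the vertices with indices `e`, `e'`. -/
inductive RealExp
  | zero
  | reg (r : RealReg)
  | field (f : RealField) (r : NodeReg)
  | max (e e' : RealExp)
  | dist (e e' : NatExp)

inductive BoolExp
  | natLe (e e' : NatExp)
  | natEq (e e' : NatExp)
  | nodeEq (e e' : NodeExp)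
  | realLe (e e' : RealExp)
  | not (b : BoolExp)
  | and (b b' : BoolExp)
  | or (b b' : BoolExp)

/-- Commands; `emit e` puts a node in front of the output list. -/
inductive Cmd
  | skip
  | setNat (r : NatReg) (e : NatExp)
  | setNode (r : NodeReg) (e : NodeExp)
  | setReal (r : RealReg) (e : RealExp)
  | storeNat (f : NatField) (r : NodeReg) (e : NatExp)
  | storeNode (f : NodeField) (r : NodeReg) (e : NodeExp)
  | storeReal (f : RealField) (r : NodeReg) (e : RealExp)
  | emit (e : NodeExp)
  | seq (c c' : Cmd)
  | ite (b : BoolExp) (c c' : Cmd)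
  | while (b : BoolExp) (c : Cmd)

section Semantics

variable {d : ℕ} (I : Input d)

def NatExp.eval (s : Mem) : NatExp → ℕ
  | .lit k => k
  | .m => I.m
  | .n => I.n
  | .reg r => s.natReg r
  | .col r => (s.nodeReg r).1
  | .row r => (s.nodeReg r).2
  | .field f r => s.natField f (s.nodeReg r)
  | .add e e' => e.eval s + e'.eval s
  | .sub e e' => e.eval s - e'.eval s

def NodeExp.eval (s : Mem) : NodeExp → Node
  | .reg r => s.nodeReg r
  | .pair e e' => (e.eval I s, e'.eval I s)
  | .field f r => s.nodeField f (s.nodeReg r)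

noncomputable def RealExp.eval (s : Mem) : RealExp → ℝ
  | .zero => 0
  | .reg r => s.realReg r
  | .field f r => s.realField f (s.nodeReg r)
  | .max e e' => Max.max (e.eval s) (e'.eval s)
  | .dist e e' => I.grid (e.eval I s, e'.eval I s)

def BoolExp.eval (s : Mem) : BoolExp → Prop
  | .natLe e e' => e.eval I s ≤ e'.eval I s
  | .natEq e e' => e.eval I s = e'.eval I s
  | .nodeEq e e' => e.eval I s = e'.eval I s
  | .realLe e e' => e.eval I s ≤ e'.eval I s
  | .not b => ¬ b.eval s
  | .and b b' => b.eval s ∧ b'.eval s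
  | .or b b' => b.eval s ∨ b'.eval s

/-! The cost of an expression is the number of its operations: each access to a register or to a
field, each arithmetic operation and each comparison takes one step, and the distance of two
points of `ℝ^d` takes `d + 1` steps. -/

def NatExp.cost : NatExp → ℕ
  | .lit _ | .m | .n | .reg _ | .col _ | .row _ | .field _ _ => 1
  | .add e e' => e.cost + e'.cost + 1
  | .sub e e' => e.cost + e'.cost + 1

def NodeExp.cost : NodeExp → ℕ
  | .reg _ | .field _ _ => 1
  | .pair e e' => e.cost + e'.cost + 1

/-- The parameter is the dimension of the ambient space. -/
def RealExp.cost (d : ℕ) : RealExp → ℕ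
  | .zero | .reg _ | .field _ _ => 1
  | .max e e' => e.cost d + e'.cost d + 1
  | .dist e e' => e.cost + e'.cost + (d + 1)

def BoolExp.cost (d : ℕ) : BoolExp → ℕ
  | .natLe e e' => e.cost + e'.cost + 1
  | .natEq e e' => e.cost + e'.cost + 1
  | .nodeEq e e' => e.cost + e'.cost + 1
  | .realLe e e' => e.cost d + e'.cost d + 1
  | .not b => b.cost d + 1
  | .and b b' => b.cost d + b'.cost d + 1
  | .or b b' => b.cost d + b'.cost d + 1

/-- `Exec I c s t s'`: on input `I`, command `c` started in memory `s` terminates after exactly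
`t` steps in memory `s'`. -/
inductive Exec : Cmd → Mem → ℕ → Mem → Prop
  | skip (s : Mem) : Exec .skip s 1 s
  | setNat (s : Mem) (r : NatReg) (e : NatExp) :
      Exec (.setNat r e) s (e.cost + 1)
        (s.setNat r (e.eval I s))
  | setNode (s : Mem) (r : NodeReg) (e : NodeExp) :
      Exec (.setNode r e) s (e.cost + 1)
        (s.setNode r (e.eval I s))
  | setReal (s : Mem) (r : RealReg) (e : RealExp) :
      Exec (.setReal r e) s (e.cost d + 1)
        (s.setReal r (e.eval I s))
  | storeNat (s : Mem) (f : NatField) (r : NodeReg) (e : NatExp) :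
      Exec (.storeNat f r e) s (e.cost + 1)
        (s.storeNat f (s.nodeReg r) (e.eval I s))
  | storeNode (s : Mem) (f : NodeField) (r : NodeReg) (e : NodeExp) :
      Exec (.storeNode f r e) s (e.cost + 1)
        (s.storeNode f (s.nodeReg r) (e.eval I s))
  | storeReal (s : Mem) (f : RealField) (r : NodeReg) (e : RealExp) :
      Exec (.storeReal f r e) s (e.cost d + 1)
        (s.storeReal f (s.nodeReg r) (e.eval I s))
  | emit (s : Mem) (e : NodeExp) :
      Exec (.emit e) s (e.cost + 1) { s with out := e.eval I s :: s.out }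
  | seq {c c' : Cmd} {s s' s'' : Mem} {t t' : ℕ} :
      Exec c s t s' → Exec c' s' t' s'' → Exec (.seq c c') s (t + t') s''
  | iteTrue {b : BoolExp} {c c' : Cmd} {s s' : Mem} {t : ℕ} :
      b.eval I s → Exec c s t s' → Exec (.ite b c c') s (b.cost d + 1 + t) s'
  | iteFalse {b : BoolExp} {c c' : Cmd} {s s' : Mem} {t : ℕ} :
      ¬ b.eval I s → Exec c' s t s' → Exec (.ite b c c') s (b.cost d + 1 + t) s'
  | whileTrue {b : BoolExp} {c : Cmd} {s s' s'' : Mem} {t t' : ℕ} :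
      b.eval I s → Exec c s t s' → Exec (.while b c) s' t' s'' →
        Exec (.while b c) s (b.cost d + 1 + t + t') s''
  | whileFalse {b : BoolExp} {c : Cmd} {s : Mem} :
      ¬ b.eval I s → Exec (.while b c) s (b.cost d + 1) s

end Semantics

/-- The machine is deterministic. -/
theorem Exec.deterministic {d : ℕ} {I : Input d} {c : Cmd} {s : Mem} {t₁ : ℕ} {s₁ : Mem}
    (h₁ : Exec I c s t₁ s₁) : ∀ {t₂ : ℕ} {s₂ : Mem}, Exec I c s t₂ s₂ → t₁ = t₂ ∧ s₁ = s₂ := by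
  induction h₁ with
  | skip | setNat | setNode | setReal | storeNat | storeNode | storeReal | emit =>
    intro t₂ s₂ h₂; cases h₂; exact ⟨rfl, rfl⟩
  | seq _ _ ih ih' =>
    intro t₂ s₂ h₂
    cases h₂ with
    | seq h h' =>
      obtain ⟨rfl, rfl⟩ := ih h
      obtain ⟨rfl, rfl⟩ := ih' h'
      exact ⟨rfl, rfl⟩
  | iteTrue hb _ ih =>
    intro t₂ s₂ h₂
    cases h₂ with
    | iteTrue _ h => obtain ⟨rfl, rfl⟩ := ih h; exact ⟨rfl, rfl⟩
    | iteFalse hb' _ => exact absurd hb hb'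
  | iteFalse hb _ ih =>
    intro t₂ s₂ h₂
    cases h₂ with
    | iteTrue hb' _ => exact absurd hb' hb
    | iteFalse _ h => obtain ⟨rfl, rfl⟩ := ih h; exact ⟨rfl, rfl⟩
  | whileTrue hb _ _ ih ih' =>
    intro t₂ s₂ h₂
    cases h₂ with
    | whileTrue _ h h' =>
      obtain ⟨rfl, rfl⟩ := ih h
      obtain ⟨rfl, rfl⟩ := ih' h'
      exact ⟨rfl, rfl⟩
    | whileFalse hb' => exact absurd hb hb'
  | whileFalse hb =>
    intro t₂ s₂ h₂
    cases h₂ with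
    | whileTrue hb' _ _ => exact absurd hb' hb
    | whileFalse _ => exact ⟨rfl, rfl⟩

/-! ### The algorithm -/

def block : List Cmd → Cmd
  | [] => .skip
  | c :: cs => .seq c (block cs)

/-- `for r = lo, …, hi do body`. -/
def forLoop (r : NatReg) (lo hi : NatExp) (body : Cmd) : Cmd :=
  block [.setNat r lo,
    .while (.natLe (.reg r) hi) (block [body, .setNat r (.add (.reg r) (.lit 1))])]

/-- Add the node `g` to the tree, as a child of the node `p`. -/
def link : Cmd := block [
  .storeNode .parent .g (.reg .p),
  .storeNat .children .g (.lit 0),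
  .storeNat .children .p (.add (.field .children .p) (.lit 1)),
  .storeNat .inTree .g (.lit 1)]

/-- Compute the grid of distances. -/
def constructGrid : Cmd :=
  forLoop .i (.lit 0) .m (forLoop .j (.lit 0) .n (block [
    .setNode .g (.pair (.reg .i) (.reg .j)),
    .storeReal .value .g (.dist (.reg .i) (.reg .j))]))

/-- The tests `parent(a) = b` and `parent(c) = b`. -/
def aBelowB : BoolExp := .nodeEq (.field .parent .a) (.reg .b)

def cBelowB : BoolExp := .nodeEq (.field .parent .c) (.reg .b)

/-- For the candidate parents `a = (i-1, j)`, `b = (i-1, j-1)`, `c = (i, j-1)` of `(i, j)`, put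
into node registers the nearest common ancestors `sab` of `a, b` and `sbc` of `b, c`, and into
real registers the maxima `a` and `ba` from `a` and `b` to `sab`, the maxima `c` and `bc` from
`c` and `b` to `sbc`, and the maxima `aFull` and `cFull` from `a` and `c` to the nearest common
ancestor of `a` and `c`, which is the upper one of `sab` and `sbc`. -/
def maximaToNCA : Cmd := block [
  .ite aBelowB
    (block [.setNode .sab (.reg .b), .setReal .a (.field .value .a), .setReal .ba .zero])
    (block [.setNode .sab (.field .rightSink .a), .setReal .a (.field .rightMax .a),
      .setReal .ba (.field .leftMax .b)]),
  .ite cBelowB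
    (block [.setNode .sbc (.reg .b), .setReal .c (.field .value .c), .setReal .bc .zero])
    (block [.setNode .sbc (.field .leftSink .c), .setReal .c (.field .leftMax .c),
      .setReal .bc (.field .rightMax .b)]),
  .setReal .aFull (.reg .a),
  .setReal .cFull (.reg .c),
  .ite (.nodeEq (.reg .sab) (.reg .sbc)) .skip
    (.ite (.natLe (.add (.col .sbc) (.row .sbc)) (.add (.col .sab) (.row .sab)))
      (.setReal .aFull (.max (.reg .a) (.field .rightMax .sab)))
      (.setReal .cFull (.max (.reg .c) (.field .leftMax .sbc))))]

/-- Choose the candidate with the lowest maximum, ties being broken by `a ≻ b ≻ c`. -/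
def chooseParent : Cmd := block [
  maximaToNCA,
  .ite (.and (.realLe (.reg .a) (.reg .ba)) (.realLe (.reg .aFull) (.reg .cFull)))
    (.setNode .p (.reg .a))
    (.ite (.and (.not (.realLe (.reg .a) (.reg .ba))) (.realLe (.reg .bc) (.reg .c)))
      (.setNode .p (.reg .b))
      (.setNode .p (.reg .c)))]

/-- Remove the dead path that ends at `b`, and count its nodes; register `x` ends at the first
node of the path, which remains in the tree. -/
def removeDeadPath : Cmd := block [
  .setNode .x (.reg .b),
  .setNat .dead (.lit 1),
  .while (.natEq (.field .children .x) (.lit 0)) (block [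
    .storeNat .inTree .x (.lit 0),
    .setNode .x (.field .parent .x),
    .storeNat .children .x (.sub (.field .children .x) (.lit 1)),
    .setNat .dead (.add (.reg .dead) (.lit 1))])]

/-- Walk up from node `start` to `x`, and let the shortcuts (of one side) that point to `x` point
to the shortcut target of `x` instead; count them. -/
def extendAlong (start : NodeReg) (sink : NodeField) (mx : RealField) : Cmd := block [
  .setNode .y (.reg start),
  .while (.not (.nodeEq (.reg .y) (.reg .x))) (block [
    .storeReal mx .y (.max (.field mx .y) (.field mx .x)),
    .storeNode sink .y (.field sink .x),
    .setNat .ext (.add (.reg .ext) (.lit 1)),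
    .setNode .y (.field .parent .y)])]

/-- The faces between `a, b` and between `b, c` merge; the one whose sink is the first node `x` of
the dead path gets the sink of the other one, if that is different. -/
def extendShortcuts : Cmd :=
  .ite (.nodeEq (.reg .sab) (.reg .sbc)) .skip
    (.ite (.nodeEq (.reg .sab) (.reg .x))
      (extendAlong .a .rightSink .rightMax)
      (extendAlong .c .leftSink .leftMax))

/-- Give node `r` a shortcut to its parent `b`. -/
def shortcutToB (r : NodeReg) (sink : NodeField) (mx : RealField) : Cmd := block [
  .storeNode sink r (.reg .b), .storeReal mx r (.field .value r)]

/-- Give node `r` the shortcut of its parent `q`, with the maximum updated. -/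
def shortcutVia (r q : NodeReg) (sink : NodeField) (mx : RealField) : Cmd := block [
  .storeNode sink r (.field sink q), .storeReal mx r (.max (.field .value r) (.field mx q))]

/-- Make the shortcuts for `a`, `c` and the new node `g` with parent `p`. -/
def makeShortcuts : Cmd := block [
  .ite aBelowB
    (.ite (.or (.nodeEq (.reg .p) (.reg .b)) cBelowB)
      (shortcutToB .a .rightSink .rightMax)
      (shortcutVia .a .b .rightSink .rightMax))
    .skip,
  .ite cBelowB
    (.ite (.or (.nodeEq (.reg .p) (.reg .b)) aBelowB)
      (shortcutToB .c .leftSink .leftMax)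
      (shortcutVia .c .b .leftSink .leftMax))
    .skip,
  .ite (.nodeEq (.reg .p) (.reg .a)) (shortcutVia .g .a .rightSink .rightMax)
    (.ite (.nodeEq (.reg .p) (.reg .c)) (shortcutVia .g .c .leftSink .leftMax)
      (block [
        .ite aBelowB (shortcutToB .g .leftSink .leftMax) (shortcutVia .g .b .leftSink .leftMax),
        .ite cBelowB (shortcutToB .g .rightSink .rightMax)
          (shortcutVia .g .b .rightSink .rightMax)]))]

/-- Add the node `(i, j)` to the tree. -/
def addToTree : Cmd := block [
  .setNode .g (.pair (.reg .i) (.reg .j)),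
  .setNode .a (.pair (.sub (.reg .i) (.lit 1)) (.reg .j)),
  .setNode .b (.pair (.sub (.reg .i) (.lit 1)) (.sub (.reg .j) (.lit 1))),
  .setNode .c (.pair (.reg .i) (.sub (.reg .j) (.lit 1))),
  chooseParent,
  link,
  .setNat .dead (.lit 0),
  .setNat .ext (.lit 0),
  .ite (.natEq (.field .children .b) (.lit 0)) (block [removeDeadPath, extendShortcuts]) .skip,
  .storeNat .deadNodes .g (.reg .dead),
  .storeNat .extensions .g (.reg .ext),
  makeShortcuts]

/-- Start with the root, the bottom row and the leftmost column. -/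
def initTree : Cmd := block [
  .setNode .g (.pair (.lit 0) (.lit 0)),
  .storeNat .children .g (.lit 0),
  .storeNat .inTree .g (.lit 1),
  forLoop .i (.lit 1) .m (block [
    .setNode .g (.pair (.reg .i) (.lit 0)),
    .setNode .p (.pair (.sub (.reg .i) (.lit 1)) (.lit 0)),
    link]),
  forLoop .j (.lit 1) .n (block [
    .setNode .g (.pair (.lit 0) (.reg .j)),
    .setNode .p (.pair (.lit 0) (.sub (.reg .j) (.lit 1))),
    link])]

/-- Output the path in the tree from `(0, 0)` to `(m, n)`, last node first. -/
def outputPath : Cmd := block [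
  .setNode .x (.pair .m .n),
  .emit (.reg .x),
  .while (.not (.nodeEq (.reg .x) (.pair (.lit 0) (.lit 0)))) (block [
    .setNode .x (.field .parent .x),
    .emit (.reg .x)])]

/-- The whole algorithm: one program for all inputs, in all dimensions. -/
def computeDiscreteLCFM : Cmd := block [
  constructGrid,
  initTree,
  forLoop .i (.lit 1) .m (forLoop .j (.lit 1) .n addToTree),
  outputPath]

end DiscreteFrechet

open DiscreteFrechet

/-! The tree does not depend on the box, so it is grown once on the infinite grid, each node being
represented by its finite set of ancestors `anc g v`. The path from `v` up to its nearest common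
ancestor with `u`, that ancestor excluded, is the difference `anc g v \ anc g u`; its maximum
`branchMax g v u` is a supremum in `ℝ≥0`, where the empty supremum is `0`.

Optimality. Two nodes are compared by the maxima of their branches, ties being decided by planar
position, and the comparison is relaxed by a threshold `α` (`AsGood`): a branch with maximum at most
`α` is good enough. This relation is transitive (`AsGood.trans`), the parent of a node is as good as
every other predecessor (`par_asGood`), and passing from the parent to `v` costs no more than
raising the threshold to `max α (g v)` (`AsGood.extend`). Along an arbitrary path from `u` to `v` it
follows that `v` is as good as `u`, up to the maximum of the path without its first node. If `u` is
an ancestor of `v`, the branch of `u` is empty, and the relation bounds the maximum of the tree path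
by that threshold. This is strong local correctness, and the other optimality claims follow from it.
Transitivity for ties rests on planarity: branches of the tree do not cross (`planar_aux`), so
common ancestors of two nodes are ancestors of everything between them (`mem_anc_of_between`).

The program. `WP` is total correctness with a step count. The loop invariant `Inv` says that parents
are right, that the counters count the children among the live nodes, and that each pair of
neighbours on the boundary of the tree has correct shortcuts on both sides of its face (`HalfFace`).
Of the candidates `a`, `b`, `c` the middle one is `b`, so all nearest common ancestors involved lie
on the path of `b`, and all maxima can be read off shortcuts. Adding a node removes only `b` from
the boundary; by planarity, the nodes that die are the ancestors of `b` that are ancestors of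
neither `a` nor `c` (`live_succ_of_childless`), and these are the nodes whose child counters drop to
zero.

Cost. A tree edge raises the coordinate sum by 1 or 2 (`card_anc_sdiff`). A dead path with `k` nodes
has `k - 1` edges, and the coordinate sums of `a` and `c` exceed that of `b` by one, so the walk
that extends shortcuts has at most `2 * (k - 1) + 1` edges. Each node is removed at most once; with
the number of removed nodes as potential (`removed`), every addition has constant amortized cost
(`WP_addToTree`). -/

namespace DiscreteFrechet

open scoped NNReal

/-! ### The tree of ancestors -/

section Tree

/-- The maximum of `g` on the nodes of `A` that do not belong to `B`. -/
noncomputable def gap (g : Node → ℝ≥0) (A B : Finset Node) : ℝ≥0 := (A \ B).sup g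

/-- The choice between three candidates with ancestor sets `A`, `B`, `C`. -/
noncomputable def pick (g : Node → ℝ≥0) (A B C : Finset Node) {α : Type} (x y z : α) : α :=
  if gap g A B ≤ gap g B A ∧ gap g A C ≤ gap g C A then x
  else if gap g B A < gap g A B ∧ gap g B C ≤ gap g C B then y
  else z

/-- The set of ancestors of a node (itself included) in the tree grown on the infinite grid. -/
noncomputable def anc (g : Node → ℝ≥0) : Node → Finset Node
  | (0, 0) => {(0, 0)}
  | (i + 1, 0) => insert (i + 1, 0) (anc g (i, 0))
  | (0, j + 1) => insert (0, j + 1) (anc g (0, j))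
  | (i + 1, j + 1) => insert (i + 1, j + 1)
      (pick g (anc g (i, j + 1)) (anc g (i, j)) (anc g (i + 1, j))
        (anc g (i, j + 1)) (anc g (i, j)) (anc g (i + 1, j)))
termination_by v => v.1 + v.2

/-- The parent of a node in the tree grown on the infinite grid. -/
noncomputable def par (g : Node → ℝ≥0) : Node → Node
  | (0, 0) => (0, 0)
  | (i + 1, 0) => (i, 0)
  | (0, j + 1) => (0, j)
  | (i + 1, j + 1) => pick g (anc g (i, j + 1)) (anc g (i, j)) (anc g (i + 1, j))
      (i, j + 1) (i, j) (i + 1, j)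

variable {g : Node → ℝ≥0}

theorem anc_zero : anc g (0, 0) = {(0, 0)} := by rw [anc]

/-- `anc` and `par` make the same tests, one selecting a set and the other a node, so the selections
agree. The definition of `anc` is not unfolded again after this. -/
theorem anc_eq {v : Node} (hv : v ≠ (0, 0)) : anc g v = insert v (anc g (par g v)) := by
  match v, hv with
  | (0, 0), h => exact absurd rfl h
  | (i + 1, 0), _ => rw [anc, par]
  | (0, j + 1), _ => rw [anc, par]
  | (i + 1, j + 1), _ =>
    rw [anc, par]
    congr 1
    unfold pick
    split_ifs <;> rfl

theorem par_candidate (i j : ℕ) : IsCandidate i j (par g (i + 1, j + 1)) := by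
  rw [par]
  unfold pick IsCandidate
  split_ifs <;> simp

theorem step_par {v : Node} (hv : v ≠ (0, 0)) : Step (par g v) v := by
  match v, hv with
  | (0, 0), h => exact absurd rfl h
  | (i + 1, 0), _ => rw [par]; exact Or.inl rfl
  | (0, j + 1), _ => rw [par]; exact Or.inr (Or.inl rfl)
  | (i + 1, j + 1), _ =>
    rcases par_candidate (g := g) i j with h | h | h <;> rw [h] <;> simp [Step]

theorem Step.cases' {u v : Node} (h : Step u v) :
    (v.1 = u.1 + 1 ∧ v.2 = u.2) ∨ (v.1 = u.1 ∧ v.2 = u.2 + 1) ∨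
      (v.1 = u.1 + 1 ∧ v.2 = u.2 + 1) := by
  rcases h with h | h | h <;> simp [h]

theorem par_cases {v : Node} (hv : v ≠ (0, 0)) :
    (v.1 = (par g v).1 + 1 ∧ v.2 = (par g v).2) ∨ (v.1 = (par g v).1 ∧ v.2 = (par g v).2 + 1) ∨
      (v.1 = (par g v).1 + 1 ∧ v.2 = (par g v).2 + 1) :=
  (step_par hv).cases'

theorem par_le (v : Node) : (par g v).1 ≤ v.1 ∧ (par g v).2 ≤ v.2 := by
  by_cases hv : v = (0, 0)
  · subst hv; rw [par]; simp
  · have := par_cases (g := g) hv; omega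

/-- The coordinate sum drops at each passage to the parent. This is the induction along tree paths
on which the facts about ancestors rest. -/
theorem par_induction {p : Node → Prop} (h0 : p (0, 0))
    (h : ∀ v, v ≠ (0, 0) → p (par g v) → p v) : ∀ v, p v := by
  intro v
  induction hn : v.1 + v.2 using Nat.strong_induction_on generalizing v with
  | _ k ih =>
    by_cases hv : v = (0, 0)
    · exact hv ▸ h0
    · have := par_cases (g := g) hv
      exact h v hv (ih _ (by omega) _ rfl)

theorem self_mem_anc (v : Node) : v ∈ anc g v := by
  by_cases hv : v = (0, 0)
  · rw [hv, anc_zero]; simp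
  · rw [anc_eq hv]; simp

theorem mem_anc_iff {u v : Node} (hv : v ≠ (0, 0)) :
    u ∈ anc g v ↔ u = v ∨ u ∈ anc g (par g v) := by rw [anc_eq hv, Finset.mem_insert]

theorem zero_mem_anc : ∀ v, (0, 0) ∈ anc g v :=
  par_induction (g := g) (self_mem_anc _) fun _ hv h => (mem_anc_iff hv).2 (Or.inr h)

theorem le_of_mem_anc {u : Node} : ∀ {v}, u ∈ anc g v → u.1 ≤ v.1 ∧ u.2 ≤ v.2 := by
  intro v
  refine par_induction (g := g) (p := fun v => u ∈ anc g v → u.1 ≤ v.1 ∧ u.2 ≤ v.2) ?_ ?_ v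
  · intro h; rw [anc_zero, Finset.mem_singleton] at h; simp [h]
  · intro v hv ih h
    rcases (mem_anc_iff hv).1 h with h | h
    · simp [h]
    · have := ih h; have := par_le (g := g) v; omega

theorem ne_zero_of_mem {u v : Node} (h : u ∈ anc g v) (huv : u ≠ v) : v ≠ (0, 0) := by
  rintro rfl
  rw [anc_zero, Finset.mem_singleton] at h
  exact huv h

theorem mem_par_of_ne {u v : Node} (h : u ∈ anc g v) (huv : u ≠ v) : u ∈ anc g (par g v) :=
  ((mem_anc_iff (ne_zero_of_mem h huv)).1 h).resolve_left huv

theorem not_mem_anc_par {v : Node} (hv : v ≠ (0, 0)) : v ∉ anc g (par g v) := fun h => by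
  have := le_of_mem_anc h; have := par_cases (g := g) hv; omega

theorem par_mem_anc {v : Node} (hv : v ≠ (0, 0)) : par g v ∈ anc g v :=
  (mem_anc_iff hv).2 (Or.inr (self_mem_anc _))

theorem anc_subset {u : Node} : ∀ {v}, u ∈ anc g v → anc g u ⊆ anc g v := by
  intro v
  refine par_induction (g := g) (p := fun v => u ∈ anc g v → anc g u ⊆ anc g v) ?_ ?_ v
  · intro h; rw [anc_zero, Finset.mem_singleton] at h; rw [h]
  · intro v hv ih h
    rcases (mem_anc_iff hv).1 h with h | h
    · rw [h]
    · rw [anc_eq hv]; exact (ih h).trans (Finset.subset_insert _ _)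

theorem eq_of_mem_mem {u v : Node} (h : u ∈ anc g v) (h' : v ∈ anc g u) : u = v := by
  have := le_of_mem_anc h; have := le_of_mem_anc h'
  exact Prod.ext (by omega) (by omega)

theorem mem_anc_total {u u' : Node} :
    ∀ {v}, u ∈ anc g v → u' ∈ anc g v → u ∈ anc g u' ∨ u' ∈ anc g u := by
  intro v
  refine par_induction (g := g)
    (p := fun v => u ∈ anc g v → u' ∈ anc g v → u ∈ anc g u' ∨ u' ∈ anc g u) ?_ ?_ v
  · intro h h'
    rw [anc_zero, Finset.mem_singleton] at h h'
    subst h; subst h'; exact Or.inl (self_mem_anc _)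
  · intro v hv ih h h'
    by_cases e : u = v
    · exact Or.inr (e ▸ h')
    by_cases e' : u' = v
    · exact Or.inl (e' ▸ h)
    exact ih (mem_par_of_ne h e) (mem_par_of_ne h' e')

theorem exists_child {u : Node} :
    ∀ {v}, u ∈ anc g v → u ≠ v → ∃ c, c ≠ (0, 0) ∧ par g c = u ∧ c ∈ anc g v := by
  intro v
  refine par_induction (g := g) (p := fun v => u ∈ anc g v → u ≠ v →
    ∃ c, c ≠ (0, 0) ∧ par g c = u ∧ c ∈ anc g v) ?_ ?_ v
  · intro h hne; rw [anc_zero, Finset.mem_singleton] at h; exact absurd h hne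
  · intro v hv ih h hne
    have h' := mem_par_of_ne h hne
    by_cases e : u = par g v
    · exact ⟨v, hv, e.symm, self_mem_anc v⟩
    · obtain ⟨c, h1, h2, h3⟩ := ih h' e
      exact ⟨c, h1, h2, (mem_anc_iff hv).2 (Or.inr h3)⟩

/-- Supplies nearest common ancestors: such a `w` is one. On the way down to `y`, the intersection
grows only while the path stays inside `anc g u`. -/
theorem exists_inter_anc (u y : Node) : ∃ w, anc g w = anc g y ∩ anc g u := by
  refine par_induction (g := g) (p := fun y => ∃ w, anc g w = anc g y ∩ anc g u) ?_ ?_ y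
  · refine ⟨(0, 0), ?_⟩
    rw [anc_zero]
    ext z
    simp only [Finset.mem_singleton, Finset.mem_inter]
    exact ⟨fun h => ⟨h, h ▸ zero_mem_anc u⟩, fun h => h.1⟩
  · rintro v hv ⟨w, hw⟩
    by_cases h : v ∈ anc g u
    · exact ⟨v, (Finset.inter_eq_left.2 (anc_subset h)).symm⟩
    · exact ⟨w, by rw [hw, anc_eq hv, Finset.insert_inter_of_notMem h]⟩

theorem par_mem_of_mem {c v : Node} (h : c ∈ anc g v) (hc : c ≠ (0, 0)) : par g c ∈ anc g v :=
  anc_subset h (par_mem_anc hc)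

/-! ### Planarity -/

/-- `y` and `u` are in different branches, and the one of `y` leaves to the upper left. -/
def LeftOf (g : Node → ℝ≥0) (y u : Node) : Prop :=
  ∃ c c', c ≠ (0, 0) ∧ c' ≠ (0, 0) ∧ par g c = par g c' ∧ c ≠ c' ∧ c.1 ≤ c'.1 ∧ c'.2 ≤ c.2 ∧
    c ∈ anc g y ∧ c' ∈ anc g u

/-- Two ancestors of `v` are comparable; one sibling above the other would be an ancestor of the
common parent, hence of its own parent. -/
theorem disjoint_of_siblings {c c' v : Node} (hc : c ≠ (0, 0)) (hc' : c' ≠ (0, 0))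
    (hp : par g c = par g c') (hne : c ≠ c') (h : c ∈ anc g v) (h' : c' ∈ anc g v) : False := by
  rcases mem_anc_total h h' with h | h
  · exact not_mem_anc_par hc (hp ▸ mem_par_of_ne h hne)
  · exact not_mem_anc_par hc' (hp ▸ mem_par_of_ne h hne.symm)

/-- Tree edges go right, up or diagonally, so two branches cannot cross without meeting in a node.
In a minimal bad configuration, one of `y`, `u` can be replaced by its parent and the configuration
stays bad; at the siblings themselves it is impossible. -/
theorem planar_aux {c c' : Node} (hc : c ≠ (0, 0)) (hc' : c' ≠ (0, 0))
    (hp : par g c = par g c') (hne : c ≠ c') (h1 : c.1 ≤ c'.1) (h2 : c'.2 ≤ c.2) (k : ℕ) :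
    ∀ y u : Node, y.1 + y.2 + u.1 + u.2 = k → c ∈ anc g y → c' ∈ anc g u →
      ¬ (u.1 ≤ y.1 ∧ y.2 ≤ u.2) := by
  induction k using Nat.strong_induction_on with
  | _ k ih =>
    rintro y u hk hy hu ⟨h3, h4⟩
    have ly := le_of_mem_anc hy
    have lu := le_of_mem_anc hu
    have hyu : ¬ (y.1 = u.1 ∧ y.2 = u.2) := fun e =>
      disjoint_of_siblings hc hc' hp hne hy ((Prod.ext e.1 e.2 : y = u) ▸ hu)
    have hcc : ¬ (c.1 = c'.1 ∧ c.2 = c'.2) := fun e => hne (Prod.ext e.1 e.2)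
    by_cases ey : c = y
    · by_cases eu : c' = u
      · subst ey eu; omega
      · have hu' := mem_par_of_ne hu eu
        have := par_cases (g := g) (ne_zero_of_mem hu eu)
        have lu' := le_of_mem_anc hu'
        subst ey
        refine ih _ ?_ c (par g u) rfl hy hu' ⟨?_, ?_⟩ <;> omega
    · have hy' := mem_par_of_ne hy ey
      have := par_cases (g := g) (ne_zero_of_mem hy ey)
      have ly' := le_of_mem_anc hy'
      -- If the parent of `y` lies too far left, then `y` and `u` are in one column with `y`
      -- strictly below, and `u` can retreat instead.
      by_cases h5 : u.1 ≤ (par g y).1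
      · refine ih _ ?_ (par g y) u rfl hy' hu ⟨?_, ?_⟩ <;> omega
      · by_cases eu : c' = u
        · subst eu; omega
        · have hu' := mem_par_of_ne hu eu
          have := par_cases (g := g) (ne_zero_of_mem hu eu)
          refine ih _ ?_ y (par g u) rfl hy hu' ⟨?_, ?_⟩ <;> omega

theorem LeftOf.not_le {y u : Node} (h : LeftOf g y u) : ¬ (u.1 ≤ y.1 ∧ y.2 ≤ u.2) := by
  obtain ⟨c, c', hc, hc', hp, hne, h1, h2, hy, hu⟩ := h
  exact planar_aux hc hc' hp hne h1 h2 _ y u rfl hy hu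

/-- The children of the nearest common ancestor towards `y` and `u` are distinct, and any two of the
three possible children of a node are ordered from upper left to lower right. -/
theorem leftOf_total {y u : Node} (h : y ∉ anc g u) (h' : u ∉ anc g y) :
    LeftOf g y u ∨ LeftOf g u y := by
  obtain ⟨w, hw⟩ := exists_inter_anc (g := g) u y
  have hwm : w ∈ anc g y ∩ anc g u := hw ▸ self_mem_anc w
  rw [Finset.mem_inter] at hwm
  obtain ⟨c, hc, hpc, hcy⟩ := exists_child hwm.1 (fun e => h (e ▸ hwm.2))
  obtain ⟨c', hc', hpc', hcu⟩ := exists_child hwm.2 (fun e => h' (e ▸ hwm.1))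
  have hne : c ≠ c' := by
    rintro rfl
    have : c ∈ anc g w := by rw [hw]; exact Finset.mem_inter.2 ⟨hcy, hcu⟩
    exact not_mem_anc_par hc (hpc ▸ this)
  have k1 := par_cases (g := g) hc
  have k2 := par_cases (g := g) hc'
  rw [hpc] at k1
  rw [hpc'] at k2
  have hcc : ¬ (c.1 = c'.1 ∧ c.2 = c'.2) := fun e => hne (Prod.ext e.1 e.2)
  by_cases k : c.1 ≤ c'.1 ∧ c'.2 ≤ c.2
  · exact Or.inl ⟨c, c', hc, hc', hpc.trans hpc'.symm, hne, k.1, k.2, hcy, hcu⟩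
  · exact Or.inr ⟨c', c, hc', hc, hpc'.trans hpc.symm, hne.symm, by omega, by omega, hcu, hcy⟩

theorem leftOf_of_le {y u : Node} (h : y ∉ anc g u) (h' : u ∉ anc g y) (h1 : y.1 ≤ u.1)
    (h2 : u.2 ≤ y.2) : LeftOf g y u :=
  (leftOf_total h h').resolve_right fun k => k.not_le ⟨h1, h2⟩

/-- The pair of siblings that separates `y` from `u` is unique, so both orders would concern the
same pair. -/
theorem LeftOf.asymm {y u : Node} (h : LeftOf g y u) (h' : LeftOf g u y) : False := by
  obtain ⟨c, c', hc, hc', hp, hne, h1, h2, hy, hu⟩ := h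
  obtain ⟨e, e', he, he', hpe, hnee, k1, k2, hu', hy'⟩ := h'
  have hpar : par g c = par g e := by
    rcases mem_anc_total hy hy' with h | h
    · by_cases q : c = e'
      · rw [q, ← hpe]
      · have hx := mem_par_of_ne h q
        have : c ∈ anc g u := by
          rw [← hpe] at hx
          exact anc_subset (par_mem_of_mem hu' he) hx
        exact (disjoint_of_siblings hc hc' hp hne this hu).elim
    · by_cases q : e' = c
      · rw [← q, ← hpe]
      · have hx := mem_par_of_ne h q
        have : e' ∈ anc g u := by
          rw [hp] at hx
          exact anc_subset (par_mem_of_mem hu hc') hx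
        exact (disjoint_of_siblings he he' hpe hnee hu' this).elim
  have e1 : c = e' := by
    by_contra q
    exact disjoint_of_siblings hc he' (hpar.trans hpe) q hy hy'
  have e2 : c' = e := by
    by_contra q
    exact disjoint_of_siblings hc' he (hp.symm.trans hpar) q hu hu'
  subst e1; subst e2
  exact hne (Prod.ext (by omega) (by omega))

/-- The common ancestors of two nodes are ancestors of all nodes between them. -/
theorem mem_anc_of_between {f a b z : Node} (h1 : f.1 ≤ a.1) (h2 : a.2 ≤ f.2) (h3 : a.1 ≤ b.1)
    (h4 : b.2 ≤ a.2) (hf : z ∈ anc g f) (hb : z ∈ anc g b) : z ∈ anc g a := by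
  by_contra hz
  have lf := le_of_mem_anc hf
  have lb := le_of_mem_anc hb
  by_cases ha : a ∈ anc g z
  · have la := le_of_mem_anc ha
    exact hz ((Prod.ext (by omega) (by omega) : a = z) ▸ self_mem_anc (g := g) a)
  rcases leftOf_total hz ha with h | h
  · obtain ⟨c, c', hc, hc', hp, hne, k1, k2, hy, hu⟩ := h
    exact LeftOf.not_le ⟨c, c', hc, hc', hp, hne, k1, k2, anc_subset hb hy, hu⟩ ⟨h3, h4⟩
  · obtain ⟨c, c', hc, hc', hp, hne, k1, k2, hy, hu⟩ := h
    exact LeftOf.not_le ⟨c, c', hc, hc', hp, hne, k1, k2, hy, anc_subset hf hu⟩ ⟨h1, h2⟩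

end Tree

/-! ### Comparison of branches up to a threshold -/

section Comparison

variable {g : Node → ℝ≥0}

/-- Both branchings lie on the path of `y`. The higher one separates `p` from `u`; if both occur at
the same child, three siblings are in order. -/
theorem LeftOf.trans {p y u : Node} (h : LeftOf g p y) (h' : LeftOf g y u) : LeftOf g p u := by
  obtain ⟨c, c', hc, hc', hp, hne, h1, h2, hcp, hcy⟩ := h
  obtain ⟨e, e', he, he', hpe, hnee, k1, k2, hey, heu⟩ := h'
  by_cases q : c' = e
  · subst q
    refine ⟨c, e', hc, he', hp.trans hpe, ?_, h1.trans k1, k2.trans h2, hcp, heu⟩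
    rintro rfl
    exact hne (Prod.ext (by omega) (by omega))
  · rcases mem_anc_total hcy hey with h | h
    · have hx := mem_par_of_ne h q
      rw [hpe] at hx
      exact ⟨c, c', hc, hc', hp, hne, h1, h2, hcp, anc_subset (par_mem_of_mem heu he') hx⟩
    · have hx := mem_par_of_ne h (Ne.symm q)
      rw [← hp] at hx
      exact ⟨e, e', he, he', hpe, hnee, k1, k2, anc_subset (par_mem_of_mem hcp hc) hx, heu⟩

/-- If `z` were below the branching of `p` and `y`, then `u` would leave with `p` and be on the left
of `y`. -/
theorem mem_anc_of_leftOf {p y u z : Node} (h : LeftOf g p y) (h' : LeftOf g y u)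
    (hp : z ∈ anc g p) (hu : z ∈ anc g u) : z ∈ anc g y := by
  obtain ⟨c, c', hc, hc', hpc, hne, h1, h2, hcp, hcy⟩ := h
  by_cases q : z = c
  · subst q
    exact (h'.asymm ⟨z, c', hc, hc', hpc, hne, h1, h2, hu, hcy⟩).elim
  rcases mem_anc_total hp hcp with h | h
  · have hx := mem_par_of_ne h q
    rw [hpc] at hx
    exact anc_subset (par_mem_of_mem hcy hc') hx
  · exact (h'.asymm ⟨c, c', hc, hc', hpc, hne, h1, h2, anc_subset hu h, hcy⟩).elim

theorem LeftOf.mono_left {y y' u : Node} (h : LeftOf g y u) (hy : y ∈ anc g y') :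
    LeftOf g y' u := by
  obtain ⟨c, c', hc, hc', hpc, hne, h1, h2, hcp, hcy⟩ := h
  exact ⟨c, c', hc, hc', hpc, hne, h1, h2, anc_subset hy hcp, hcy⟩

/-- The maximum on the tree path from `y` to the nearest common ancestor of `y` and `u`, without
that ancestor. -/
noncomputable def branchMax (g : Node → ℝ≥0) (y u : Node) : ℝ≥0 := gap g (anc g y) (anc g u)

theorem branchMax_of_mem {y u : Node} (h : y ∈ anc g u) : branchMax g y u = 0 := by
  unfold branchMax gap
  rw [Finset.sdiff_eq_empty_iff_subset.2 (anc_subset h)]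
  rfl

theorem branchMax_insert {y u : Node} (hy : y ≠ (0, 0)) (h : y ∉ anc g u) :
    branchMax g y u = max (g y) (branchMax g (par g y) u) := by
  unfold branchMax gap
  rw [anc_eq hy, Finset.insert_sdiff_of_notMem _ h, Finset.sup_insert]

theorem branchMax_insert_right {y u : Node} (hy : y ≠ (0, 0)) (h : y ∉ anc g u) :
    branchMax g u y = branchMax g u (par g y) := by
  unfold branchMax gap
  rw [anc_eq hy, Finset.sdiff_insert, Finset.erase_eq_of_notMem]
  exact fun k => h (Finset.mem_sdiff.1 k).1

/-- If `y` leaves the common part of the paths to `p` and `y` last, the maxima of the three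
pairs are related. -/
theorem branchMax_triple {p y u : Node} (h : anc g y ∩ anc g u ⊆ anc g p)
    (h' : anc g p ∩ anc g u ⊆ anc g y) :
    branchMax g p u = max (gap g (anc g p ∩ anc g y) (anc g u)) (branchMax g p y) ∧
    branchMax g y u = max (gap g (anc g p ∩ anc g y) (anc g u)) (branchMax g y p) ∧
    branchMax g u p = branchMax g u y := by
  unfold branchMax gap
  refine ⟨?_, ?_, ?_⟩
  · rw [← Finset.sup_union]
    congr 1; ext z
    have := @h z; have := @h' z
    simp only [Finset.mem_sdiff, Finset.mem_union, Finset.mem_inter] at *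
    tauto
  · rw [← Finset.sup_union]
    congr 1; ext z
    have := @h z; have := @h' z
    simp only [Finset.mem_sdiff, Finset.mem_union, Finset.mem_inter] at *
    tauto
  · congr 1; ext z
    have := @h z; have := @h' z
    simp only [Finset.mem_sdiff, Finset.mem_inter] at *
    tauto

/-- The witness `t` shows that `p` and `y` part below the place where `u` leaves `y`. This provides
the hypotheses of `branchMax_triple`. -/
theorem inter_subset_of_not {p y u t : Node} (ht : t ∈ anc g p) (hty : t ∈ anc g y)
    (htu : t ∉ anc g u) : anc g y ∩ anc g u ⊆ anc g p := by
  intro z hz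
  rw [Finset.mem_inter] at hz
  rcases mem_anc_total hz.1 hty with h | h
  · exact anc_subset ht h
  · exact absurd (anc_subset hz.2 h) htu

/-- Up to the threshold `α`, the branch of `y` is at least as good as the one of `u`. -/
def AsGood (g : Node → ℝ≥0) (α : ℝ≥0) (y u : Node) : Prop :=
  branchMax g y u ≤ α ∨ branchMax g y u < branchMax g u y ∨
    (branchMax g y u = branchMax g u y ∧ LeftOf g y u)

/-- Of the three pairwise nearest common ancestors two coincide, and the third is at least as low;
the cases tell which pair it belongs to. `branchMax_triple` then leaves a statement about a linear
order. -/
theorem AsGood.trans {α : ℝ≥0} {p y u : Node} (h : AsGood g α p y) (h' : AsGood g α y u) :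
    AsGood g α p u := by
  unfold AsGood at *
  by_cases c1 : anc g p ∩ anc g y ⊆ anc g u
  · by_cases c3 : anc g y ∩ anc g u ⊆ anc g p
    · obtain ⟨e1, e2, e3⟩ := branchMax_triple (p := p) (y := u) (u := y)
        (by rwa [Finset.inter_comm]) c1
      -- Here `p` and `u` part last, and with two ties the maximum on their shared stretch could
      -- hide the comparison of `p` with `u`. But then `y` lies between them and has all their
      -- common ancestors, so the stretch is empty.
      by_cases hl : LeftOf g p y ∧ LeftOf g y u
      · have : gap g (anc g p ∩ anc g u) (anc g y) = 0 := by
          unfold gap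
          rw [Finset.sdiff_eq_empty_iff_subset.2]
          · rfl
          intro z hz
          rw [Finset.mem_inter] at hz
          exact mem_anc_of_leftOf hl.1 hl.2 hz.1 hz.2
        rw [this] at e1 e2
        have hl' := hl.1.trans hl.2
        simp only [zero_le, sup_of_le_right] at e1 e2
        grind
      · generalize gap g (anc g p ∩ anc g u) (anc g y) = S at *
        generalize branchMax g p u = a at *
        generalize branchMax g u p = b at *
        generalize branchMax g p y = c at *
        generalize branchMax g u y = d at *
        grind
    -- Now `y` and `u` part last, so `p` leaves both at the same place and has the same position
    -- relative to both.
    · obtain ⟨t, ht, htp⟩ := Finset.not_subset.1 c3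
      rw [Finset.mem_inter] at ht
      have i1 := inter_subset_of_not ht.2 ht.1 htp
      have i2 := inter_subset_of_not ht.1 ht.2 htp
      obtain ⟨e1, e2, e3⟩ := branchMax_triple (p := u) (y := y) (u := p) i1 i2
      have hl : LeftOf g p y → LeftOf g p u := by
        rintro ⟨c, c', hc, hc', hpc, hne, h1, h2, hcp, hcy⟩
        refine ⟨c, c', hc, hc', hpc, hne, h1, h2, hcp, ?_⟩
        by_cases q : t = c'
        · exact q ▸ ht.2
        rcases mem_anc_total ht.1 hcy with h | h
        · have hx := mem_par_of_ne h q
          rw [← hpc] at hx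
          exact absurd (anc_subset (par_mem_of_mem hcp hc) hx) htp
        · exact anc_subset ht.2 h
      have hl' : LeftOf g p y → LeftOf g y u → LeftOf g p u := fun h h' => h.trans h'
      grind
  · obtain ⟨t, ht, htp⟩ := Finset.not_subset.1 c1
    rw [Finset.mem_inter] at ht
    have i1 := inter_subset_of_not ht.1 ht.2 htp
    have i2 := inter_subset_of_not ht.2 ht.1 htp
    obtain ⟨e1, e2, e3⟩ := branchMax_triple (p := p) (y := y) (u := u) i1 i2
    have hl : LeftOf g y u → LeftOf g p u := by
      rintro ⟨c, c', hc, hc', hpc, hne, h1, h2, hcp, hcy⟩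
      refine ⟨c, c', hc, hc', hpc, hne, h1, h2, ?_, hcy⟩
      by_cases q : t = c
      · exact q ▸ ht.1
      rcases mem_anc_total ht.2 hcp with h | h
      · have hx := mem_par_of_ne h q
        rw [hpc] at hx
        exact absurd (anc_subset (par_mem_of_mem hcy hc') hx) htp
      · exact anc_subset ht.1 h
    grind

/-! ### The choice of parents -/

/-- The winner among the candidate parents, decided by the maxima and the preference order. -/
theorem par_beats (i j : ℕ) (c : Node) (hc : IsCandidate i j c) (hne : c ≠ par g (i + 1, j + 1)) :
    branchMax g (par g (i + 1, j + 1)) c < branchMax g c (par g (i + 1, j + 1)) ∨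
    (branchMax g (par g (i + 1, j + 1)) c = branchMax g c (par g (i + 1, j + 1)) ∧
      Preferred i j (par g (i + 1, j + 1)) c) := by
  have hb : anc g (i, j + 1) ∩ anc g (i + 1, j) ⊆ anc g (i, j) := by
    intro z hz
    rw [Finset.mem_inter] at hz
    exact mem_anc_of_between (f := (i, j + 1)) (b := (i + 1, j)) le_rfl (by simp) (by simp)
      le_rfl hz.1 hz.2
  -- The nearest common ancestors of the middle candidate with the outer ones are comparable. `S` is
  -- the maximum on the stretch between them, and the alternatives tell which one is lower.
  have key : ∃ S, (branchMax g (i, j + 1) (i + 1, j) = max S (branchMax g (i, j + 1) (i, j)) ∧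
      branchMax g (i, j) (i + 1, j) = max S (branchMax g (i, j) (i, j + 1)) ∧
      branchMax g (i + 1, j) (i, j + 1) = branchMax g (i + 1, j) (i, j)) ∨
      (branchMax g (i + 1, j) (i, j + 1) = max S (branchMax g (i + 1, j) (i, j)) ∧
      branchMax g (i, j) (i, j + 1) = max S (branchMax g (i, j) (i + 1, j)) ∧
      branchMax g (i, j + 1) (i + 1, j) = branchMax g (i, j + 1) (i, j)) := by
    by_cases h : anc g (i, j) ∩ anc g (i + 1, j) ⊆ anc g (i, j + 1)
    · exact ⟨_, Or.inl (branchMax_triple h hb)⟩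
    · obtain ⟨t, ht, htp⟩ := Finset.not_subset.1 h
      rw [Finset.mem_inter] at ht
      exact ⟨_, Or.inr (branchMax_triple (inter_subset_of_not ht.2 ht.1 htp)
        (by rwa [Finset.inter_comm]))⟩
  have hpar : par g (i + 1, j + 1) =
      if branchMax g (i, j + 1) (i, j) ≤ branchMax g (i, j) (i, j + 1)
      ∧ branchMax g (i, j + 1) (i + 1, j) ≤ branchMax g (i + 1, j) (i, j + 1) then (i, j + 1)
      else if branchMax g (i, j) (i, j + 1) < branchMax g (i, j + 1) (i, j) ∧
        branchMax g (i, j) (i + 1, j) ≤ branchMax g (i + 1, j) (i, j) then (i, j)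
      else (i + 1, j) := by rw [par]; rfl
  have pab : Preferred i j (i, j + 1) (i, j) := Or.inl ⟨rfl, Or.inl rfl⟩
  have pac : Preferred i j (i, j + 1) (i + 1, j) := Or.inl ⟨rfl, Or.inr rfl⟩
  have pbc : Preferred i j (i, j) (i + 1, j) := Or.inr ⟨rfl, rfl⟩
  obtain ⟨S, hS⟩ := key
  generalize par g (i + 1, j + 1) = p at *
  split_ifs at hpar with h1 h2
  · subst hpar
    rcases hc with rfl | rfl | rfl
    · exact absurd rfl hne
    · exact h1.1.lt_or_eq.imp_right fun h => ⟨h, pab⟩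
    · exact h1.2.lt_or_eq.imp_right fun h => ⟨h, pac⟩
  · subst hpar
    rcases hc with rfl | rfl | rfl
    · exact Or.inl h2.1
    · exact absurd rfl hne
    · exact h2.2.lt_or_eq.imp_right fun h => ⟨h, pbc⟩
  -- Both tests have failed. The relations `hS` exclude a cyclic outcome, so the last candidate wins
  -- strictly against both others.
  · subst hpar
    left
    rcases hc with rfl | rfl | rfl
    · clear pab pac pbc hne hb; grind
    · clear pab pac pbc hne hb; grind
    · exact absurd rfl hne

/-- On the border the predecessor is unique. Elsewhere this is `par_beats`: for candidates in
different branches the preference order is the planar order, and if one is an ancestor of the other,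
the relevant maximum vanishes. -/
theorem par_asGood (α : ℝ≥0) {y v : Node} (h : Step y v) : AsGood g α (par g v) y := by
  by_cases e : y = par g v
  · left; rw [← e, branchMax_of_mem (self_mem_anc y)]; exact zero_le
  by_cases h1 : par g v ∈ anc g y
  · left; rw [branchMax_of_mem h1]; exact zero_le
  match v, h, e, h1 with
  | (0, 0), h, _, _ => have := h.cases'; simp at this
  | (i + 1, 0), h, e, _ =>
    refine absurd ?_ e
    rw [par]; have := h.cases'; simp at this; exact Prod.ext (by simp; omega) (by simp; omega)
  | (0, j + 1), h, e, _ =>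
    refine absurd ?_ e
    rw [par]; have := h.cases'; simp at this; exact Prod.ext (by simp; omega) (by simp; omega)
  | (i + 1, j + 1), h, e, h1 =>
    have hy : IsCandidate i j y := by
      have := h.cases'
      unfold IsCandidate
      simp only [Prod.ext_iff]
      simp only at this ⊢
      omega
    rcases par_beats i j y hy e with h2 | ⟨h2, h3⟩
    · exact Or.inr (Or.inl h2)
    by_cases h4 : y ∈ anc g (par g (i + 1, j + 1))
    · left; rw [h2, branchMax_of_mem h4]; exact zero_le
    refine Or.inr (Or.inr ⟨h2, leftOf_of_le h1 h4 ?_ ?_⟩) <;>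
    · rcases h3 with ⟨h5, h6 | h6⟩ | ⟨h5, h6⟩ <;> rw [h5, h6] <;> simp

/-- The branch of `v` gains only the value `g v`, which the raised threshold absorbs; the opposite
branch of `u` is unchanged. -/
theorem AsGood.extend {α : ℝ≥0} {u v : Node} (hv : v ≠ (0, 0)) (h : AsGood g α (par g v) u) :
    AsGood g (max α (g v)) v u := by
  unfold AsGood at *
  by_cases hm : v ∈ anc g u
  · left; rw [branchMax_of_mem hm]; exact zero_le
  rw [branchMax_insert hv hm, branchMax_insert_right hv hm]
  have : LeftOf g (par g v) u → LeftOf g v u := fun h => h.mono_left (par_mem_anc hv)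
  grind

/-- At a step from `x` to `y`, the parent of `y` is as good as `x`, hence as good as `u`, and `y`
inherits this with a raised threshold. The path need not follow the tree. -/
theorem asGood_of_path (l : List Node) :
    ∀ (α : ℝ≥0) (u x v : Node), (x :: l).IsChain Step → (x :: l).getLast? = some v →
      AsGood g α x u → AsGood g (max α (l.toFinset.sup g)) v u := by
  induction l with
  | nil =>
    intro α u x v _ hl h
    simp only [List.getLast?_singleton, Option.some.injEq] at hl
    subst hl
    simpa using h
  | cons y l ih =>
    intro α u x v hc hl h
    rw [List.isChain_cons_cons] at hc
    have hy : y ≠ (0, 0) := by rintro rfl; have := hc.1.cases'; simp at this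
    have := ih (max α (g y)) u y v hc.2 (by simpa using hl)
      (((par_asGood α hc.1).trans h).extend hy)
    rw [List.toFinset_cons, Finset.sup_insert]
    rwa [← max_assoc]

/-- The path starts at `u` itself, with threshold `0`. As `u` is an ancestor of `v`, the opposite
branch has maximum `0`, so every alternative of `AsGood` gives the bound. -/
theorem branchMax_le_of_path {u v : Node} {l : List Node} (hm : u ∈ anc g v) (h : IsPath l u v) :
    branchMax g v u ≤ l.tail.toFinset.sup g := by
  obtain ⟨h1, h2, h3⟩ := h
  cases l with
  | nil => simp at h2
  | cons x l =>
    simp only [List.head?_cons, Option.some.injEq] at h2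
    subst h2
    have := asGood_of_path (g := g) l 0 x x v h1 h3
      (Or.inl (by rw [branchMax_of_mem (self_mem_anc x)]))
    have h0 : branchMax g x v = 0 := branchMax_of_mem hm
    simp only [zero_le, sup_of_le_right] at this
    rcases this with h | h | h
    · exact h
    · rw [h0] at h; exact absurd h not_lt_zero
    · rw [h.1, h0]; exact zero_le

end Comparison

/-! ### Tree paths and their optimality -/

section Paths

variable {g : Node → ℝ≥0} {m n : ℕ}

theorem pathMax_eq_sup (l : List Node) :
    pathMax (fun v => (g v : ℝ)) l = ((l.toFinset.sup g : ℝ≥0) : ℝ) := by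
  induction l with
  | nil => simp [pathMax]
  | cons x l ih =>
    rw [List.toFinset_cons, Finset.sup_insert, NNReal.coe_max, ← ih]
    rfl

theorem treeOf_step {u v : Node} (h : treeOf m n (par g) u v) : Step u v := by
  obtain ⟨_, _, h, rfl⟩ := h
  exact step_par h

theorem isPath_of_treePath {l : List Node} {u v : Node}
    (h : IsPathIn (treeOf m n (par g)) l u v) : IsPath l u v :=
  ⟨h.1.imp fun _ _ h => treeOf_step h, h.2⟩

/-- The bridge from lists to ancestor sets: omitting the first node of a tree path corresponds to
omitting `u` in the difference of the sets. -/
theorem toFinset_tail_of_treePath {v : Node} (l : List Node) : ∀ {u : Node},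
    IsPathIn (treeOf m n (par g)) l u v →
      u ∈ anc g v ∧ l.tail.toFinset = anc g v \ anc g u := by
  induction l with
  | nil => rintro u ⟨_, h, _⟩; simp at h
  | cons x l ih =>
    rintro u ⟨h1, h2, h3⟩
    simp only [List.head?_cons, Option.some.injEq] at h2
    subst h2
    cases l with
    | nil =>
      simp only [List.getLast?_singleton, Option.some.injEq] at h3
      subst h3
      exact ⟨self_mem_anc _, by simp⟩
    | cons y l =>
      rw [List.isChain_cons_cons] at h1
      obtain ⟨i1, i2⟩ := ih (u := y) ⟨h1.2, rfl, by simpa using h3⟩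
      obtain ⟨_, _, hy, rfl⟩ := h1.1
      refine ⟨par_mem_of_mem i1 hy, ?_⟩
      rw [List.tail_cons, List.toFinset_cons]
      rw [List.tail_cons] at i2
      rw [i2]
      ext z
      rw [Finset.mem_insert, Finset.mem_sdiff, Finset.mem_sdiff, mem_anc_iff hy]
      by_cases hz : z = y
      · subst hz; simp [i1, not_mem_anc_par hy]
      · simp [hz]

theorem length_of_treePath {v : Node} (l : List Node) : ∀ {u : Node},
    IsPathIn (treeOf m n (par g)) l u v → l.length = (anc g v \ anc g u).card + 1 := by
  induction l with
  | nil => rintro u ⟨_, h, _⟩; simp at h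
  | cons x l ih =>
    rintro u ⟨h1, h2, h3⟩
    simp only [List.head?_cons, Option.some.injEq] at h2
    subst h2
    cases l with
    | nil =>
      simp only [List.getLast?_singleton, Option.some.injEq] at h3
      subst h3
      simp
    | cons y l =>
      rw [List.isChain_cons_cons] at h1
      have h4 : IsPathIn (treeOf m n (par g)) (y :: l) y v := ⟨h1.2, rfl, by simpa using h3⟩
      have i1 := (toFinset_tail_of_treePath _ h4).1
      rw [List.length_cons, ih h4]
      obtain ⟨_, _, hy, rfl⟩ := h1.1
      have : anc g v \ anc g (par g y) = insert y (anc g v \ anc g y) := by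
        ext z
        rw [Finset.mem_insert, Finset.mem_sdiff, Finset.mem_sdiff, mem_anc_iff hy]
        by_cases hz : z = y
        · subst hz; simp [i1, not_mem_anc_par hy]
        · simp [hz]
      rw [this, Finset.card_insert_of_notMem]
      simp [self_mem_anc]

theorem exists_treePath {u : Node} : ∀ {v : Node}, v.1 ≤ m → v.2 ≤ n → u ∈ anc g v →
    ∃ l, IsPathIn (treeOf m n (par g)) (u :: l) u v := by
  intro v
  refine par_induction (g := g) (p := fun v => v.1 ≤ m → v.2 ≤ n → u ∈ anc g v →
    ∃ l, IsPathIn (treeOf m n (par g)) (u :: l) u v) ?_ ?_ v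
  · intro _ _ h
    rw [anc_zero, Finset.mem_singleton] at h
    exact ⟨[], by simp, rfl, by simp [h]⟩
  · intro v hv ih h1 h2 h
    by_cases e : u = v
    · exact ⟨[], by simp, rfl, by simp [e]⟩
    · have := par_le (g := g) v
      obtain ⟨l, k1, _, k3⟩ := ih (by omega) (by omega) (mem_par_of_ne h e)
      refine ⟨l ++ [v], ?_, rfl, ?_⟩
      · rw [← List.cons_append, List.isChain_append]
        refine ⟨k1, by simp, ?_⟩
        intro x hx y hy
        rw [k3, Option.mem_some_iff] at hx
        rw [List.head?_cons, Option.mem_some_iff] at hy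
        subst hx; subst hy
        exact ⟨h1, h2, hv, rfl⟩
      · rw [← List.cons_append]; exact List.getLast?_concat

theorem mem_anc_of_Anc {u v : Node} (h : Anc (treeOf m n (par g)) u v) : u ∈ anc g v := by
  induction h with
  | refl => exact self_mem_anc u
  | tail _ h2 ih =>
    obtain ⟨_, _, h, rfl⟩ := h2
    exact (mem_anc_iff h).2 (Or.inr ih)

/-- Ancestors have smaller coordinates, so restricting the infinite tree to the box loses no
ancestor of a node of the box. -/
theorem Anc_iff {u : Node} : ∀ {v : Node}, v.1 ≤ m → v.2 ≤ n →
    (Anc (treeOf m n (par g)) u v ↔ u ∈ anc g v) := by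
  intro v h1 h2
  refine ⟨mem_anc_of_Anc, ?_⟩
  revert h1 h2
  refine par_induction (g := g) (p := fun v => v.1 ≤ m → v.2 ≤ n → u ∈ anc g v →
    Anc (treeOf m n (par g)) u v) ?_ ?_ v
  · intro _ _ h
    rw [anc_zero, Finset.mem_singleton] at h
    rw [h]; exact Relation.ReflTransGen.refl
  · intro v hv ih h1 h2 h
    by_cases e : u = v
    · rw [e]; exact Relation.ReflTransGen.refl
    · have := par_le (g := g) v
      exact (ih (by omega) (by omega) (mem_par_of_ne h e)).tail ⟨h1, h2, hv, rfl⟩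

theorem stronglyLocallyCorrect_of_treePath {l : List Node} {u v : Node}
    (h : IsPathIn (treeOf m n (par g)) l u v) :
    StronglyLocallyCorrect (fun v => (g v : ℝ)) l := by
  intro u' v' l' h1 h2
  obtain ⟨h3, h4⟩ := toFinset_tail_of_treePath l h
  have e1 : u' = u := Option.some.inj (h1.2.1.symm.trans h.2.1)
  have e2 : v' = v := Option.some.inj (h1.2.2.symm.trans h.2.2)
  subst e1; subst e2
  rw [pathMax_eq_sup, pathMax_eq_sup, NNReal.coe_le_coe, h4]
  exact branchMax_le_of_path h3 h2

/-- Both paths start at `u`, and putting its value back on both sides keeps the inequality. -/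
theorem isOptimal_of_stronglyLocallyCorrect {G : Node → ℝ} {l : List Node} {u v : Node}
    (hp : IsPath l u v) (h : StronglyLocallyCorrect G l) : IsOptimal G l u v := by
  refine ⟨⟨l, hp, rfl⟩, ?_⟩
  rintro r ⟨l', hl', rfl⟩
  have := h u v l' hp hl'
  obtain ⟨_, h2, _⟩ := hp
  obtain ⟨_, k2, _⟩ := hl'
  cases l with
  | nil => simp at h2
  | cons x l =>
    cases l' with
    | nil => simp at k2
    | cons y l' =>
      simp only [List.head?_cons, Option.some.injEq] at h2 k2
      subst h2; subst k2
      exact max_le_max le_rfl this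

theorem isOptimal_of_treePath {l : List Node} {u v : Node}
    (h : IsPathIn (treeOf m n (par g)) l u v) : IsOptimal (fun v => (g v : ℝ)) l u v :=
  isOptimal_of_stronglyLocallyCorrect (isPath_of_treePath h)
    (stronglyLocallyCorrect_of_treePath h)

theorem locallyCorrect_of_treePath {l : List Node} {u v : Node}
    (h : IsPathIn (treeOf m n (par g)) l u v) : LocallyCorrect (fun v => (g v : ℝ)) l := by
  intro s u' v' hs hp
  exact isOptimal_of_treePath ⟨h.1.infix hs, hp.2⟩

theorem isParentChoice_par {i j : ℕ} (hi : i < m) (hj : j < n) :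
    IsParentChoice (treeOf m n (par g)) (fun v => (g v : ℝ)) i j (par g (i + 1, j + 1)) := by
  refine ⟨par_candidate i j, fun c hc hne => ?_⟩
  have box : ∀ c, IsCandidate i j c → c.1 ≤ m ∧ c.2 ≤ n := by
    rintro c (rfl | rfl | rfl) <;> constructor <;> simp <;> omega
  have hb := par_beats (g := g) i j c hc hne
  have bp := box _ (par_candidate (g := g) i j)
  have bc := box _ hc
  generalize par g (i + 1, j + 1) = p at *
  obtain ⟨w, hw⟩ := exists_inter_anc (g := g) c p
  have hwm : w ∈ anc g p ∩ anc g c := hw ▸ self_mem_anc w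
  rw [Finset.mem_inter] at hwm
  obtain ⟨l, hl⟩ := exists_treePath bp.1 bp.2 hwm.1
  obtain ⟨l', hl'⟩ := exists_treePath bc.1 bc.2 hwm.2
  refine ⟨w, l, l', ⟨(Anc_iff bp.1 bp.2).2 hwm.1, (Anc_iff bc.1 bc.2).2 hwm.2, ?_⟩, hl, hl', ?_⟩
  · intro z h1 h2
    have lw := le_of_mem_anc hwm.1
    rw [Anc_iff bp.1 bp.2] at h1
    rw [Anc_iff bc.1 bc.2] at h2
    rw [Anc_iff (by omega) (by omega), hw]
    exact Finset.mem_inter.2 ⟨h1, h2⟩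
  · have e := (toFinset_tail_of_treePath _ hl).2
    have e' := (toFinset_tail_of_treePath _ hl').2
    rw [List.tail_cons, hw, Finset.sdiff_inter_self_left] at e
    rw [List.tail_cons, hw, Finset.sdiff_inter_self_right] at e'
    rw [pathMax_eq_sup, pathMax_eq_sup, e, e', NNReal.coe_lt_coe, NNReal.coe_inj]
    exact hb

end Paths

/-! ### Weakest preconditions -/

@[simp]
theorem Mem.setNat_proj (s : Mem) (r : NatReg) (k : ℕ) :
    (s.setNat r k).natReg = Function.update s.natReg r k ∧ (s.setNat r k).nodeReg = s.nodeReg ∧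
    (s.setNat r k).realReg = s.realReg ∧ (s.setNat r k).natField = s.natField ∧
    (s.setNat r k).nodeField = s.nodeField ∧ (s.setNat r k).realField = s.realField ∧
    (s.setNat r k).out = s.out :=
  ⟨rfl, rfl, rfl, rfl, rfl, rfl, rfl⟩

@[simp]
theorem Mem.storeNat_proj (s : Mem) (f : NatField) (v : Node) (k : ℕ) :
    (s.storeNat f v k).natReg = s.natReg ∧ (s.storeNat f v k).nodeReg = s.nodeReg ∧
    (s.storeNat f v k).realReg = s.realReg ∧
    (s.storeNat f v k).natField =
      Function.update s.natField f (Function.update (s.natField f) v k) ∧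
    (s.storeNat f v k).nodeField = s.nodeField ∧ (s.storeNat f v k).realField = s.realField ∧
    (s.storeNat f v k).out = s.out :=
  ⟨rfl, rfl, rfl, rfl, rfl, rfl, rfl⟩

@[simp]
theorem Mem.setNode_proj (s : Mem) (r : NodeReg) (k : Node) :
    (s.setNode r k).natReg = s.natReg ∧ (s.setNode r k).nodeReg = Function.update s.nodeReg r k ∧
    (s.setNode r k).realReg = s.realReg ∧ (s.setNode r k).natField = s.natField ∧
    (s.setNode r k).nodeField = s.nodeField ∧ (s.setNode r k).realField = s.realField ∧
    (s.setNode r k).out = s.out :=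
  ⟨rfl, rfl, rfl, rfl, rfl, rfl, rfl⟩

@[simp]
theorem Mem.storeNode_proj (s : Mem) (f : NodeField) (v k : Node) :
    (s.storeNode f v k).natReg = s.natReg ∧ (s.storeNode f v k).nodeReg = s.nodeReg ∧
    (s.storeNode f v k).realReg = s.realReg ∧ (s.storeNode f v k).natField = s.natField ∧
    (s.storeNode f v k).nodeField =
      Function.update s.nodeField f (Function.update (s.nodeField f) v k) ∧
    (s.storeNode f v k).realField = s.realField ∧
    (s.storeNode f v k).out = s.out :=
  ⟨rfl, rfl, rfl, rfl, rfl, rfl, rfl⟩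

@[simp]
theorem Mem.setReal_proj (s : Mem) (r : RealReg) (k : ℝ) :
    (s.setReal r k).natReg = s.natReg ∧ (s.setReal r k).nodeReg = s.nodeReg ∧
    (s.setReal r k).realReg = Function.update s.realReg r k ∧
    (s.setReal r k).natField = s.natField ∧
    (s.setReal r k).nodeField = s.nodeField ∧ (s.setReal r k).realField = s.realField ∧
    (s.setReal r k).out = s.out :=
  ⟨rfl, rfl, rfl, rfl, rfl, rfl, rfl⟩

@[simp]
theorem Mem.storeReal_proj (s : Mem) (f : RealField) (v : Node) (k : ℝ) :
    (s.storeReal f v k).natReg = s.natReg ∧ (s.storeReal f v k).nodeReg = s.nodeReg ∧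
    (s.storeReal f v k).realReg = s.realReg ∧ (s.storeReal f v k).natField = s.natField ∧
    (s.storeReal f v k).nodeField = s.nodeField ∧
    (s.storeReal f v k).realField =
      Function.update s.realField f (Function.update (s.realField f) v k) ∧
    (s.storeReal f v k).out = s.out :=
  ⟨rfl, rfl, rfl, rfl, rfl, rfl, rfl⟩

section WP

variable {d : ℕ} {I : Input d}

/-- Command `c` started in `s` terminates, and its step count and final memory satisfy `Q`. -/
def WP (I : Input d) (c : Cmd) (Q : ℕ → Mem → Prop) (s : Mem) : Prop :=
  ∃ t s', Exec I c s t s' ∧ Q t s'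

theorem WP.mono {c : Cmd} {Q Q' : ℕ → Mem → Prop} {s : Mem} (h : WP I c Q s)
    (hQ : ∀ t s', Q t s' → Q' t s') : WP I c Q' s := by
  obtain ⟨t, s', h1, h2⟩ := h
  exact ⟨t, s', h1, hQ _ _ h2⟩

theorem WP_skip {Q : ℕ → Mem → Prop} {s : Mem} : WP I .skip Q s ↔ Q 1 s := by
  refine ⟨?_, fun h => ⟨_, _, .skip s, h⟩⟩
  rintro ⟨t, s', h, hQ⟩
  cases h
  exact hQ

theorem WP_setNat {Q : ℕ → Mem → Prop} {s : Mem} {r : NatReg} {e : NatExp} :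
    WP I (.setNat r e) Q s ↔ Q (e.cost + 1) (s.setNat r (e.eval I s)) := by
  refine ⟨?_, fun h => ⟨_, _, .setNat s r e, h⟩⟩
  rintro ⟨t, s', h, hQ⟩
  cases h
  exact hQ

theorem WP_setNode {Q : ℕ → Mem → Prop} {s : Mem} {r : NodeReg} {e : NodeExp} :
    WP I (.setNode r e) Q s ↔ Q (e.cost + 1) (s.setNode r (e.eval I s)) := by
  refine ⟨?_, fun h => ⟨_, _, .setNode s r e, h⟩⟩
  rintro ⟨t, s', h, hQ⟩
  cases h
  exact hQ

theorem WP_setReal {Q : ℕ → Mem → Prop} {s : Mem} {r : RealReg} {e : RealExp} :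
    WP I (.setReal r e) Q s ↔ Q (e.cost d + 1) (s.setReal r (e.eval I s)) := by
  refine ⟨?_, fun h => ⟨_, _, .setReal s r e, h⟩⟩
  rintro ⟨t, s', h, hQ⟩
  cases h
  exact hQ

theorem WP_storeNat {Q : ℕ → Mem → Prop} {s : Mem} {f : NatField} {r : NodeReg} {e : NatExp} :
    WP I (.storeNat f r e) Q s ↔ Q (e.cost + 1) (s.storeNat f (s.nodeReg r) (e.eval I s)) := by
  refine ⟨?_, fun h => ⟨_, _, .storeNat s f r e, h⟩⟩
  rintro ⟨t, s', h, hQ⟩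
  cases h
  exact hQ

theorem WP_storeNode {Q : ℕ → Mem → Prop} {s : Mem} {f : NodeField} {r : NodeReg} {e : NodeExp} :
    WP I (.storeNode f r e) Q s ↔ Q (e.cost + 1) (s.storeNode f (s.nodeReg r) (e.eval I s)) := by
  refine ⟨?_, fun h => ⟨_, _, .storeNode s f r e, h⟩⟩
  rintro ⟨t, s', h, hQ⟩
  cases h
  exact hQ

theorem WP_storeReal {Q : ℕ → Mem → Prop} {s : Mem} {f : RealField} {r : NodeReg} {e : RealExp} :
    WP I (.storeReal f r e) Q s ↔
      Q (e.cost d + 1) (s.storeReal f (s.nodeReg r) (e.eval I s)) := by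
  refine ⟨?_, fun h => ⟨_, _, .storeReal s f r e, h⟩⟩
  rintro ⟨t, s', h, hQ⟩
  cases h
  exact hQ

theorem WP_emit {Q : ℕ → Mem → Prop} {s : Mem} {e : NodeExp} :
    WP I (.emit e) Q s ↔ Q (e.cost + 1) { s with out := e.eval I s :: s.out } := by
  refine ⟨?_, fun h => ⟨_, _, .emit s e, h⟩⟩
  rintro ⟨t, s', h, hQ⟩
  cases h
  exact hQ

theorem WP_seq {Q : ℕ → Mem → Prop} {s : Mem} {c c' : Cmd} :
    WP I (.seq c c') Q s ↔ WP I c (fun t s' => WP I c' (fun t' s'' => Q (t + t') s'') s') s := by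
  constructor
  · rintro ⟨t, s', h, hQ⟩
    cases h with
    | seq h h' => exact ⟨_, _, h, _, _, h', hQ⟩
  · rintro ⟨t, s', h, t', s'', h', hQ⟩
    exact ⟨_, _, .seq h h', hQ⟩

theorem WP_ite {Q : ℕ → Mem → Prop} {s : Mem} {b : BoolExp} {c c' : Cmd} :
    WP I (.ite b c c') Q s ↔
      (b.eval I s → WP I c (fun t s' => Q (b.cost d + 1 + t) s') s) ∧
      (¬ b.eval I s → WP I c' (fun t s' => Q (b.cost d + 1 + t) s') s) := by
  constructor
  · rintro ⟨t, s', h, hQ⟩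
    cases h with
    | iteTrue hb h => exact ⟨fun _ => ⟨_, _, h, hQ⟩, fun hb' => absurd hb hb'⟩
    | iteFalse hb h => exact ⟨fun hb' => absurd hb' hb, fun _ => ⟨_, _, h, hQ⟩⟩
  · rintro ⟨h, h'⟩
    by_cases hb : b.eval I s
    · obtain ⟨t, s', k, hQ⟩ := h hb
      exact ⟨_, _, .iteTrue hb k, hQ⟩
    · obtain ⟨t, s', k, hQ⟩ := h' hb
      exact ⟨_, _, .iteFalse hb k, hQ⟩

theorem WP_block_nil {Q : ℕ → Mem → Prop} {s : Mem} : WP I (block []) Q s ↔ Q 1 s := WP_skip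

theorem WP_block_cons {Q : ℕ → Mem → Prop} {s : Mem} {c : Cmd} {cs : List Cmd} :
    WP I (block (c :: cs)) Q s ↔
      WP I c (fun t s' => WP I (block cs) (fun t' s'' => Q (t + t') s'') s') s := WP_seq

/-- A loop whose body decreases `μ` and takes at most `K` steps. -/
theorem WP_while {b : BoolExp} {c : Cmd} (Iv : Mem → Prop) (μ : Mem → ℕ) (K : ℕ)
    (hstep : ∀ s, Iv s → b.eval I s → WP I c (fun t s' => Iv s' ∧ μ s' < μ s ∧ t ≤ K) s) (s : Mem)
    (hs : Iv s) :
    WP I (.while b c) (fun t s' => Iv s' ∧ ¬ b.eval I s' ∧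
      t + (K + b.cost d + 1) * μ s' ≤ (K + b.cost d + 1) * μ s + b.cost d + 1) s := by
  induction hn : μ s using Nat.strong_induction_on generalizing s with
  | _ k ih =>
    by_cases hb : b.eval I s
    · obtain ⟨t, s', h1, h2, h3, h4⟩ := hstep s hs hb
      obtain ⟨t', s'', k1, k2, k3, k4⟩ := ih _ (hn ▸ h3) s' h2 rfl
      refine ⟨_, _, .whileTrue hb h1 k1, k2, k3, ?_⟩
      -- The drop of `μ` by at least one pays for one test and one run of the body.
      have : (K + b.cost d + 1) * (μ s' + 1) ≤ (K + b.cost d + 1) * k :=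
        Nat.mul_le_mul_left _ (by omega)
      rw [mul_add, mul_one] at this
      omega
    · exact ⟨_, _, .whileFalse hb, hs, hb, by rw [hn]; omega⟩

/-- A `for` loop whose body takes time `Ψ (k + 1) - Ψ k` for the value `k` of the register. -/
theorem WP_forLoop {r : NatReg} {lo hi : NatExp} {body : Cmd} (l h : ℕ)
    (hlo : ∀ s, lo.eval I s = l) (hhi : ∀ s, hi.eval I s = h) (hlo' : lo.cost = 1)
    (hhi' : hi.cost = 1) (hle : l ≤ h + 1) (Iv : ℕ → Mem → Prop) (Ψ : ℕ → ℕ)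
    (hset : ∀ k s x, Iv k s → Iv k (s.setNat r x))
    (hbody : ∀ k s, l ≤ k → k ≤ h → Iv k s → s.natReg r = k →
      WP I body (fun t s' => Iv (k + 1) s' ∧ s'.natReg r = k ∧ t + Ψ k ≤ Ψ (k + 1)) s)
    (s : Mem) (hs : Iv l s) :
    WP I (forLoop r lo hi body)
      (fun t s' => Iv (h + 1) s' ∧ t + Ψ l ≤ Ψ (h + 1) + 9 * (h + 1 - l) + 7) s := by
  -- Overhead of a round: 4 for the test, 4 for the increment, 1 for the end of the block. The
  -- failing test adds 4; the initial assignment and the end of the outer block turn this into 7.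
  have loop : ∀ j k s, k + j = h + 1 → l ≤ k → Iv k s → s.natReg r = k →
      WP I (.while (.natLe (.reg r) hi) (block [body, .setNat r (.add (.reg r) (.lit 1))]))
        (fun t s' => Iv (h + 1) s' ∧ t + Ψ k ≤ Ψ (h + 1) + 9 * j + 4) s := by
    intro j
    induction j with
    | zero =>
      intro k s hk _ hI hr
      refine ⟨_, _, .whileFalse ?_, ?_, ?_⟩
      · simp only [BoolExp.eval, NatExp.eval, hr, hhi]; omega
      · rw [← hk]; exact hI
      · simp only [BoolExp.cost, NatExp.cost, hhi']
        have : k = h + 1 := by omega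
        subst this; omega
    | succ j ih =>
      intro k s hk hlk hI hr
      obtain ⟨t, s', h1, h2, h3, h4⟩ := hbody k s hlk (by omega) hI hr
      obtain ⟨t', s'', k1, k2, k3⟩ := ih (k + 1) (s'.setNat r (k + 1)) (by omega) (by omega)
        (hset _ _ _ h2) (by simp)
      refine ⟨_, _, .whileTrue (t' := t') ?_ (.seq h1 (.seq (.setNat _ _ _) (.skip _))) ?_, k2, ?_⟩
      · simp only [BoolExp.eval, NatExp.eval, hr, hhi]; omega
      · simp only [NatExp.eval, h3]; exact k1
      · simp only [BoolExp.cost, NatExp.cost, hhi']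
        omega
  obtain ⟨t, s', h1, h2, h3⟩ := loop (h + 1 - l) l (s.setNat r l) (by omega) le_rfl
    (hset _ _ _ hs) (by simp)
  refine ⟨_, _, .seq (.setNat _ _ _) (.seq (t := t) ?_ (.skip _)), h2, ?_⟩
  · rw [hlo]; exact h1
  · simp only [hlo']; omega

end WP

/-! ### Faces -/

section Faces

variable {g : Node → ℝ≥0}

/-- The shortcuts on the side of `f` of the face between `f` and `f'` point to its sink. -/
def HalfFace (g : Node → ℝ≥0) (sk : Node → Node) (mx : Node → ℝ) (f f' : Node) : Prop :=
  ∀ z ∈ anc g f, z ∉ anc g f' →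
    anc g (sk z) = anc g f ∩ anc g f' ∧ mx z = (branchMax g z f' : ℝ)

variable {sk sk' : Node → Node} {mx mx' : Node → ℝ}

theorem HalfFace.congr {f f' : Node} (h : HalfFace g sk mx f f')
    (hs : ∀ z ∈ anc g f, z ∉ anc g f' → sk' z = sk z)
    (hm : ∀ z ∈ anc g f, z ∉ anc g f' → mx' z = mx z) : HalfFace g sk' mx' f f' := by
  intro z h1 h2
  rw [hs z h1 h2, hm z h1 h2]
  exact h z h1 h2

/-- When the opposite side of a face grows by a node that is no ancestor of `f`, the sink and the
maxima on the side of `f` stay. -/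
theorem HalfFace.right_child {f v : Node} (hv : v ≠ (0, 0)) (hvf : v ∉ anc g f)
    (h : HalfFace g sk mx f (par g v)) : HalfFace g sk mx f v := by
  intro z h1 h2
  have h3 : z ∉ anc g (par g v) := fun k => h2 ((mem_anc_iff hv).2 (Or.inr k))
  have h4 : v ∉ anc g z := fun k => hvf (anc_subset h1 k)
  obtain ⟨k1, k2⟩ := h z h1 h3
  rw [k1, k2, branchMax_insert_right hv h4, anc_eq hv, Finset.inter_insert_of_notMem hvf]
  exact ⟨rfl, rfl⟩

/-- The side of the face grows by `y`, which is not shared with `f'`: the sink is that of the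
parent, and only the entry of `y` is new. -/
theorem HalfFace.via {y f' : Node} (hy : y ≠ (0, 0)) (hyf : y ∉ anc g f')
    (hq : par g y ∉ anc g f') (h : HalfFace g sk mx (par g y) f')
    (hs : ∀ z, z ≠ y → sk' z = sk z) (hm : ∀ z, z ≠ y → mx' z = mx z)
    (hs' : sk' y = sk (par g y)) (hm' : mx' y = max (g y : ℝ) (mx (par g y))) :
    HalfFace g sk' mx' y f' := by
  intro z h1 h2
  have e : anc g y ∩ anc g f' = anc g (par g y) ∩ anc g f' := by
    rw [anc_eq hy, Finset.insert_inter_of_notMem hyf]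
  rw [e]
  by_cases hz : z = y
  · subst hz
    obtain ⟨k1, k2⟩ := h _ (self_mem_anc _) hq
    refine ⟨by rw [hs', k1], ?_⟩
    rw [hm', k2, branchMax_insert hy hyf, NNReal.coe_max]
  · rw [hs z hz, hm z hz]
    exact h z (mem_par_of_ne h1 hz) h2

/-- The parent is already shared, so this side of the face consists of `y` alone. -/
theorem HalfFace.to_parent {y f' : Node} (hy : y ≠ (0, 0)) (hyf : y ∉ anc g f')
    (hq : par g y ∈ anc g f') (hs : sk y = par g y) (hm : mx y = (g y : ℝ)) :
    HalfFace g sk mx y f' := by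
  intro z h1 h2
  by_cases hz : z = y
  · subst hz
    refine ⟨?_, ?_⟩
    · rw [hs, anc_eq (v := z) hy, Finset.insert_inter_of_notMem hyf]
      exact (Finset.inter_eq_left.2 (anc_subset hq)).symm
    · rw [hm, branchMax_insert hy hyf, branchMax_of_mem hq]
      simp
  · exact absurd (anc_subset hq (mem_par_of_ne h1 hz)) h2

/-- Two faces merge, and the sink of the first one is the outdated one. -/
theorem HalfFace.merge {a b c x : Node} (hb : anc g a ∩ anc g c ⊆ anc g b)
    (h : HalfFace g sk mx a b) (h' : HalfFace g sk mx b c) (hx : anc g x = anc g a ∩ anc g b)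
    (hbc : anc g b ∩ anc g c ⊆ anc g a) (hxc : x ∉ anc g c)
    (hs : ∀ z, sk' z = if z ∈ anc g a \ anc g x then sk x else sk z)
    (hm : ∀ z, mx' z = if z ∈ anc g a \ anc g x then max (mx z) (mx x) else mx z) :
    HalfFace g sk' mx' a c := by
  have hxm : x ∈ anc g a ∩ anc g b := hx ▸ self_mem_anc x
  rw [Finset.mem_inter] at hxm
  have e : anc g a ∩ anc g c = anc g b ∩ anc g c := by
    ext z
    have := @hb z; have := @hbc z
    simp only [Finset.mem_inter] at *
    tauto
  intro z h1 h2
  rw [e, hs, hm]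
  obtain ⟨k1, k2⟩ := h' x hxm.2 hxc
  split_ifs with hz
  · refine ⟨k1, ?_⟩
    have hzb : z ∉ anc g b := fun k =>
      (Finset.mem_sdiff.1 hz).2 (hx ▸ Finset.mem_inter.2 ⟨h1, k⟩)
    rw [(h z h1 hzb).2, k2, ← NNReal.coe_max]
    congr 1
    -- The branch of `z` towards `c` is its branch towards `b` followed by the branch of `x` towards
    -- `c`.
    unfold branchMax gap
    rw [← Finset.sup_union]
    congr 1
    have hxz : x ∈ anc g z := (mem_anc_total hxm.1 h1).resolve_right fun k =>
      hzb (anc_subset hxm.2 k)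
    ext t
    have i1 : t ∈ anc g z → t ∈ anc g a := fun k => anc_subset h1 k
    have i2 : t ∈ anc g x → t ∈ anc g z := fun k => anc_subset hxz k
    have i3 : t ∈ anc g x ↔ t ∈ anc g a ∧ t ∈ anc g b := by rw [hx, Finset.mem_inter]
    have i4 := @hb t; have i5 := @hbc t
    simp only [Finset.mem_inter, Finset.mem_union, Finset.mem_sdiff] at *
    tauto
  -- From `x` upwards nothing is outdated: these nodes lie on the path of `b` and already carry the
  -- shortcut of the second face.
  · have hzx : z ∈ anc g x := by
      by_contra k; exact hz (Finset.mem_sdiff.2 ⟨h1, k⟩)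
    rw [hx, Finset.mem_inter] at hzx
    exact h' z hzx.2 h2

/-- Two faces merge, and the sink of the merged face is the one of the first face. -/
theorem HalfFace.of_merge {a b c : Node} (hb : anc g a ∩ anc g c ⊆ anc g b)
    (h : HalfFace g sk mx c b) (hbc : anc g b ∩ anc g c ⊆ anc g a) : HalfFace g sk mx c a := by
  intro z h1 h2
  have h3 : z ∉ anc g b := fun k => h2 (hbc (Finset.mem_inter.2 ⟨k, h1⟩))
  obtain ⟨k1, k2⟩ := h z h1 h3
  rw [k1, k2]
  have key : ∀ t ∈ anc g c, (t ∈ anc g b ↔ t ∈ anc g a) := fun t ht =>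
    ⟨fun k => hbc (Finset.mem_inter.2 ⟨k, ht⟩), fun k => hb (Finset.mem_inter.2 ⟨k, ht⟩)⟩
  constructor
  · ext t
    have := key t
    simp only [Finset.mem_inter]
    tauto
  · congr 1
    unfold branchMax gap
    congr 1
    ext t
    have := key t
    have : t ∈ anc g z → t ∈ anc g c := fun k => anc_subset h1 k
    simp only [Finset.mem_sdiff]
    tauto

end Faces

/-! ### The choice of the parent by the program -/

section Choose

variable {d : ℕ} {I : Input d} {g : Node → ℝ≥0}

/-- Only registers for intermediate results differ. -/
structure SameButTemp (s s' : Mem) : Prop where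
  natReg : s'.natReg = s.natReg
  natField : s'.natField = s.natField
  nodeField : s'.nodeField = s.nodeField
  realField : s'.realField = s.realField
  out : s'.out = s.out
  nodeReg : ∀ r, r ≠ .sab → r ≠ .sbc → r ≠ .p → s'.nodeReg r = s.nodeReg r

/-- Both sinks are ancestors of `b`, hence comparable, and the higher one is the nearest common
ancestor of `a` and `c`. There is no face next to a candidate whose parent is `b`; then its branch
is a single node and that of `b` is empty. -/
theorem WP_maximaToNCA {a b c : Node} {s : Mem} (hra : s.nodeReg .a = a) (hrb : s.nodeReg .b = b)
    (hrc : s.nodeReg .c = c) (hpa : s.nodeField .parent a = par g a)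
    (hpc : s.nodeField .parent c = par g c) (hva : s.realField .value a = g a)
    (hvc : s.realField .value c = g c) (ha : a ≠ (0, 0)) (hc : c ≠ (0, 0))
    (hab : a ∉ anc g b) (hcb : c ∉ anc g b) (hba : b ∈ anc g a → par g a = b)
    (hbc : b ∈ anc g c → par g c = b) (hbw : anc g a ∩ anc g c ⊆ anc g b)
    (har : par g a ≠ b → HalfFace g (s.nodeField .rightSink) (s.realField .rightMax) a b)
    (hbl : par g a ≠ b → HalfFace g (s.nodeField .leftSink) (s.realField .leftMax) b a)
    (hcl : par g c ≠ b → HalfFace g (s.nodeField .leftSink) (s.realField .leftMax) c b)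
    (hbr : par g c ≠ b → HalfFace g (s.nodeField .rightSink) (s.realField .rightMax) b c) :
    WP I maximaToNCA (fun t s' => t ≤ 100 ∧ SameButTemp s s' ∧
      anc g (s'.nodeReg .sab) = anc g a ∩ anc g b ∧
      anc g (s'.nodeReg .sbc) = anc g b ∩ anc g c ∧
      s'.realReg .a = branchMax g a b ∧ s'.realReg .ba = branchMax g b a ∧
      s'.realReg .c = branchMax g c b ∧ s'.realReg .bc = branchMax g b c ∧
      s'.realReg .aFull = branchMax g a c ∧ s'.realReg .cFull = branchMax g c a) s := by
  -- Both outcomes of the test lead to the same memory up to the sink `x`; stating this for an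
  -- arbitrary `Q` keeps the cases from multiplying.
  have first : ∀ Q : ℕ → Mem → Prop, (∀ t x, t ≤ 20 → anc g x = anc g a ∩ anc g b →
      Q t (((s.setNode .sab x).setReal .a (branchMax g a b)).setReal .ba (branchMax g b a))) →
      WP I (.ite aBelowB
        (block [.setNode .sab (.reg .b), .setReal .a (.field .value .a), .setReal .ba .zero])
        (block [.setNode .sab (.field .rightSink .a), .setReal .a (.field .rightMax .a),
          .setReal .ba (.field .leftMax .b)])) Q s := by
    intro Q hQ
    simp only [WP_ite, WP_block_cons, WP_block_nil, WP_setNode, WP_setReal, aBelowB, BoolExp.eval,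
      NodeExp.eval, RealExp.eval, BoolExp.cost, NodeExp.cost, RealExp.cost, Mem.setNode_proj,
      Mem.setReal_proj, hra, hrb, hpa]
    constructor
    · intro e
      have e1 : branchMax g b a = 0 := branchMax_of_mem (e ▸ par_mem_anc ha)
      have e2 : branchMax g a b = g a := by
        rw [branchMax_insert ha hab, branchMax_of_mem (e ▸ self_mem_anc _)]; simp
      have e3 : anc g b = anc g a ∩ anc g b :=
        (Finset.inter_eq_right.2 (anc_subset (e ▸ par_mem_anc ha))).symm
      have := hQ 11 b (by decide) e3
      rw [e1, e2] at this
      simpa [Function.update_of_ne, hra, hva] using this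
    · intro e
      obtain ⟨k1, k2⟩ := har e a (self_mem_anc a) hab
      obtain ⟨-, k3⟩ := hbl e b (self_mem_anc b) (fun k => e (hba k))
      have := hQ 11 (s.nodeField .rightSink a) (by decide) k1
      rw [← k2, ← k3] at this
      simpa [Function.update_of_ne, hra, hrb] using this
  unfold maximaToNCA
  rw [WP_block_cons]
  refine first _ fun t₁ x ht₁ hx => ?_
  set s₁ := ((s.setNode .sab x).setReal .a (branchMax g a b)).setReal .ba (branchMax g b a)
    with hs₁
  have second : ∀ Q : ℕ → Mem → Prop, (∀ t y, t ≤ 20 → anc g y = anc g b ∩ anc g c →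
      Q t (((s₁.setNode .sbc y).setReal .c (branchMax g c b)).setReal .bc (branchMax g b c))) →
      WP I (.ite cBelowB
        (block [.setNode .sbc (.reg .b), .setReal .c (.field .value .c), .setReal .bc .zero])
        (block [.setNode .sbc (.field .leftSink .c), .setReal .c (.field .leftMax .c),
          .setReal .bc (.field .rightMax .b)])) Q s₁ := by
    intro Q hQ
    have hrb' : s₁.nodeReg .b = b := by simp [hs₁, hrb]
    have hrc' : s₁.nodeReg .c = c := by simp [hs₁, hrc]
    have f1 : s₁.nodeField = s.nodeField := rfl
    have f2 : s₁.realField = s.realField := rfl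
    simp only [WP_ite, WP_block_cons, WP_block_nil, WP_setNode, WP_setReal, cBelowB, BoolExp.eval,
      NodeExp.eval, RealExp.eval, BoolExp.cost, NodeExp.cost, RealExp.cost, Mem.setNode_proj,
      Mem.setReal_proj, hrc', hrb', f1, f2, hpc]
    constructor
    · intro e
      have e1 : branchMax g b c = 0 := branchMax_of_mem (e ▸ par_mem_anc hc)
      have e2 : branchMax g c b = g c := by
        rw [branchMax_insert hc hcb, branchMax_of_mem (e ▸ self_mem_anc _)]; simp
      have e3 : anc g b = anc g b ∩ anc g c :=
        (Finset.inter_eq_left.2 (anc_subset (e ▸ par_mem_anc hc))).symm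
      have := hQ 11 b (by decide) e3
      rw [e1, e2] at this
      simpa [Function.update_of_ne, hrc', hvc] using this
    · intro e
      obtain ⟨k1, k2⟩ := hcl e c (self_mem_anc c) hcb
      obtain ⟨-, k3⟩ := hbr e b (self_mem_anc b) (fun k => e (hbc k))
      have := hQ 11 (s.nodeField .leftSink c) (by decide) (by rw [k1, Finset.inter_comm])
      rw [← k2, ← k3] at this
      simpa [Function.update_of_ne, hrc', hrb'] using this
  rw [WP_block_cons]
  refine second _ fun t₂ y ht₂ hy => ?_
  have hxm : x ∈ anc g a ∩ anc g b := hx ▸ self_mem_anc x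
  have hym : y ∈ anc g b ∩ anc g c := hy ▸ self_mem_anc y
  rw [Finset.mem_inter] at hxm hym
  simp only [WP_ite, WP_block_cons, WP_block_nil, WP_setReal, WP_skip, BoolExp.eval, NatExp.eval,
      NodeExp.eval, RealExp.eval, BoolExp.cost, NodeExp.cost, RealExp.cost, NatExp.cost, hs₁,
      Mem.setNode_proj, Mem.setReal_proj, ne_eq, reduceCtorEq, not_false_eq_true,
      Function.update_of_ne, Function.update_self]
  have hcb' : anc g c ∩ anc g a ⊆ anc g b := by rwa [Finset.inter_comm]
  have k1 : anc g b ∩ anc g c ⊆ anc g a → (branchMax g a c : ℝ) = max (branchMax g a b : ℝ)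
      (branchMax g x c) ∧ branchMax g c a = branchMax g c b := by
    intro h
    obtain ⟨e1, -, e3⟩ := branchMax_triple h hbw
    refine ⟨?_, e3⟩
    rw [e1, NNReal.coe_max, max_comm, ← hx]
    rfl
  have k2 : anc g a ∩ anc g b ⊆ anc g c → (branchMax g c a : ℝ) = max (branchMax g c b : ℝ)
      (branchMax g y a) ∧ branchMax g a c = branchMax g a b := by
    intro h
    obtain ⟨e1, -, e3⟩ := branchMax_triple (p := c) (y := b) (u := a)
      (by rwa [Finset.inter_comm]) hcb'
    refine ⟨?_, e3⟩
    rw [e1, NNReal.coe_max, max_comm, Finset.inter_comm, ← hy]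
    rfl
  have tmp : ∀ q q', (∀ r, r ≠ NodeReg.sab → r ≠ .sbc → r ≠ .p → (Function.update
      (Function.update s.nodeReg .sab q) .sbc q') r = s.nodeReg r) := fun q q' r h1 h2 _ => by
    rw [Function.update_of_ne h2, Function.update_of_ne h1]
  refine ⟨fun e => ?_, fun e => ⟨fun h => ?_, fun h => ?_⟩⟩
  · have i1 : anc g a ∩ anc g b = anc g b ∩ anc g c := by rw [← hx, ← hy, e]
    obtain ⟨-, e1⟩ := k1 (i1 ▸ Finset.inter_subset_left)
    obtain ⟨-, e2⟩ := k2 (i1 ▸ Finset.inter_subset_right)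
    exact ⟨by omega, ⟨rfl, rfl, rfl, rfl, rfl, tmp _ _⟩, hx, hy, trivial, trivial, trivial,
      trivial, by rw [e2], by rw [e1]⟩
  -- The coordinate sums put the sink `x` of `a, b` below the sink `y` of `b, c`. So `x` is on the
  -- side of `b` of the face `b, c`, and its right shortcut stores the missing part of the maximum.
  · have hyx : y ∈ anc g x := (mem_anc_total hym.1 hxm.2).resolve_right fun k => by
      have := le_of_mem_anc k
      exact e (Prod.ext (by omega) (by omega))
    have hxc : x ∉ anc g c := fun k =>
      e (eq_of_mem_mem (hy ▸ Finset.mem_inter.2 ⟨hxm.2, k⟩) hyx)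
    have hcb'' : par g c ≠ b := fun k => hxc (anc_subset (k ▸ par_mem_anc hc) hxm.2)
    obtain ⟨e1, e2⟩ := k1 (by rw [← hy]; exact (anc_subset hyx).trans (anc_subset hxm.1))
    exact ⟨by omega, ⟨rfl, rfl, rfl, rfl, rfl, tmp _ _⟩, hx, hy, trivial, trivial, trivial,
      trivial, by rw [e1, (hbr hcb'' x hxm.2 hxc).2], by rw [e2]⟩
  · have hyx : x ∈ anc g y := (mem_anc_total hym.1 hxm.2).resolve_left fun k => by
      have := le_of_mem_anc k
      omega
    have hya : y ∉ anc g a := fun k =>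
      e (eq_of_mem_mem hyx (hx ▸ Finset.mem_inter.2 ⟨k, hym.1⟩))
    have hab' : par g a ≠ b := fun k => hya (anc_subset (k ▸ par_mem_anc ha) hym.1)
    obtain ⟨e1, e2⟩ := k2 (by rw [← hx]; exact (anc_subset hyx).trans (anc_subset hym.2))
    exact ⟨by omega, ⟨rfl, rfl, rfl, rfl, rfl, tmp _ _⟩, hx, hy, trivial, trivial, trivial,
      trivial, by rw [e2], by rw [e1, (hbl hab' y hym.1 hya).2]⟩

end Choose

/-! ### Selecting the parent, removing a dead path, walking along outdated shortcuts -/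

section Removal

variable {d : ℕ} {I : Input d} {g : Node → ℝ≥0}

theorem WP_chooseParent {i j : ℕ} {s : Mem} (hra : s.nodeReg .a = (i, j + 1))
    (hrb : s.nodeReg .b = (i, j)) (hrc : s.nodeReg .c = (i + 1, j))
    (hpa : s.nodeField .parent (i, j + 1) = par g (i, j + 1))
    (hpc : s.nodeField .parent (i + 1, j) = par g (i + 1, j))
    (hva : s.realField .value (i, j + 1) = g (i, j + 1))
    (hvc : s.realField .value (i + 1, j) = g (i + 1, j))
    (hab : (i, j + 1) ∉ anc g (i, j)) (hcb : (i + 1, j) ∉ anc g (i, j))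
    (hba : (i, j) ∈ anc g (i, j + 1) → par g (i, j + 1) = (i, j))
    (hbc : (i, j) ∈ anc g (i + 1, j) → par g (i + 1, j) = (i, j))
    (hbw : anc g (i, j + 1) ∩ anc g (i + 1, j) ⊆ anc g (i, j))
    (har : par g (i, j + 1) ≠ (i, j) →
      HalfFace g (s.nodeField .rightSink) (s.realField .rightMax) (i, j + 1) (i, j))
    (hbl : par g (i, j + 1) ≠ (i, j) →
      HalfFace g (s.nodeField .leftSink) (s.realField .leftMax) (i, j) (i, j + 1))
    (hcl : par g (i + 1, j) ≠ (i, j) →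
      HalfFace g (s.nodeField .leftSink) (s.realField .leftMax) (i + 1, j) (i, j))
    (hbr : par g (i + 1, j) ≠ (i, j) →
      HalfFace g (s.nodeField .rightSink) (s.realField .rightMax) (i, j) (i + 1, j)) :
    WP I chooseParent (fun t s' => t ≤ 150 ∧ SameButTemp s s' ∧
      anc g (s'.nodeReg .sab) = anc g (i, j + 1) ∩ anc g (i, j) ∧
      anc g (s'.nodeReg .sbc) = anc g (i, j) ∩ anc g (i + 1, j) ∧
      s'.nodeReg .p = par g (i + 1, j + 1)) s := by
  unfold chooseParent
  rw [WP_block_cons]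
  refine (WP_maximaToNCA hra hrb hrc hpa hpc hva hvc (by simp) (by simp) hab hcb hba hbc hbw har
    hbl hcl hbr).mono ?_
  rintro t s' ⟨ht, hs, h1, h2, h3, h4, h5, h6, h7, h8⟩
  have hpar : par g (i + 1, j + 1) =
      if branchMax g (i, j + 1) (i, j) ≤ branchMax g (i, j) (i, j + 1)
      ∧ branchMax g (i, j + 1) (i + 1, j) ≤ branchMax g (i + 1, j) (i, j + 1) then (i, j + 1)
      else if branchMax g (i, j) (i, j + 1) < branchMax g (i, j + 1) (i, j) ∧
        branchMax g (i, j) (i + 1, j) ≤ branchMax g (i + 1, j) (i, j) then (i, j)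
      else (i + 1, j) := by rw [par]; rfl
  have same : ∀ q, SameButTemp s (s'.setNode .p q) := fun q =>
    ⟨hs.natReg, hs.natField, hs.nodeField, hs.realField, hs.out, fun r e1 e2 e3 => by
      rw [(Mem.setNode_proj _ _ _).2.1, Function.update_of_ne e3, hs.nodeReg r e1 e2 e3]⟩
  have e1 : s'.nodeReg .a = (i, j + 1) := by rw [hs.nodeReg, hra] <;> decide
  have e2 : s'.nodeReg .b = (i, j) := by rw [hs.nodeReg, hrb] <;> decide
  have e3 : s'.nodeReg .c = (i + 1, j) := by rw [hs.nodeReg, hrc] <;> decide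
  simp only [WP_ite, WP_block_cons, WP_block_nil, WP_setNode, BoolExp.eval,
      NodeExp.eval, RealExp.eval, BoolExp.cost, NodeExp.cost, RealExp.cost, h3, h4, h5, h6, h7, h8,
      NNReal.coe_le_coe, not_le, e1, e2, e3, Mem.setNode_proj, Function.update_self, ne_eq,
      reduceCtorEq, not_false_eq_true, Function.update_of_ne]
  refine ⟨fun h => ?_, fun h => ⟨fun h' => ?_, fun h' => ?_⟩⟩
  · exact ⟨by omega, same _, h1, h2, by rw [hpar, if_pos h]⟩
  · exact ⟨by omega, same _, h1, h2, by rw [hpar, if_neg h, if_pos h']⟩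
  · exact ⟨by omega, same _, h1, h2, by rw [hpar, if_neg h, if_neg h']⟩

/-- The fields that describe the current tree, with node set `S`, among the nodes `A` that have
been added so far. -/
structure TreeMem (g : Node → ℝ≥0) (A S : Finset Node) (s : Mem) : Prop where
  children : ∀ v ∈ S, s.natField .children v =
    (S.filter fun w => w ≠ (0, 0) ∧ par g w = v).card
  inTree : ∀ v ∈ A, s.natField .inTree v = if v ∈ S then 1 else 0

theorem TreeMem.insert {A S : Finset Node} {s s' : Mem} {v : Node} (h : TreeMem g A S s)
    (hv : v ≠ (0, 0)) (hvS : v ∉ S) (hp : par g v ∈ S) (hcl : ∀ w ∈ S, w ≠ (0, 0) → par g w ≠ v)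
    (h0 : s'.natField .children v = 0)
    (h1 : s'.natField .children (par g v) = s.natField .children (par g v) + 1)
    (h2 : ∀ w, w ≠ v → w ≠ par g v → s'.natField .children w = s.natField .children w)
    (h3 : s'.natField .inTree v = 1)
    (h4 : ∀ w, w ≠ v → s'.natField .inTree w = s.natField .inTree w) :
    TreeMem g (insert v A) (insert v S) s' := by
  have hpv : par g v ≠ v := fun e => hvS (e ▸ hp)
  constructor
  · intro w hw
    rw [Finset.filter_insert]
    by_cases e : w = v
    · subst e
      rw [h0, if_neg (fun k => hpv k.2), eq_comm, Finset.card_eq_zero,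
        Finset.filter_eq_empty_iff]
      exact fun u hu k => hcl u hu k.1 k.2
    · have hwS := (Finset.mem_insert.1 hw).resolve_left e
      by_cases e' : w = par g v
      · subst e'
        rw [if_pos ⟨hv, rfl⟩, Finset.card_insert_of_notMem (fun k => hvS (Finset.mem_filter.1 k).1),
          h1, h.children _ hp]
      · rw [if_neg (fun k => e' k.2.symm), h2 w e e', h.children w hwS]
  · intro w hw
    by_cases e : w = v
    · subst e; rw [h3, if_pos (Finset.mem_insert_self _ _)]
    · rw [h4 w e, h.inTree w ((Finset.mem_insert.1 hw).resolve_left e)]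
      simp [e]

theorem TreeMem.erase {A S : Finset Node} {s s' : Mem} {x : Node} (h : TreeMem g A S s)
    (hx : x ≠ (0, 0)) (hxS : x ∈ S) (hp : par g x ∈ S)
    (h1 : s'.natField .children (par g x) = s.natField .children (par g x) - 1)
    (h2 : ∀ w, w ≠ par g x → s'.natField .children w = s.natField .children w)
    (h3 : s'.natField .inTree x = 0)
    (h4 : ∀ w, w ≠ x → s'.natField .inTree w = s.natField .inTree w) :
    TreeMem g A (S.erase x) s' := by
  constructor
  · intro w hw
    have hwS := (Finset.mem_erase.1 hw).2
    rw [Finset.filter_erase]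
    by_cases e : w = par g x
    · subst e
      rw [Finset.card_erase_of_mem (Finset.mem_filter.2 ⟨hxS, hx, rfl⟩), h1, h.children _ hp]
    · rw [Finset.erase_eq_of_notMem (fun k => e (Finset.mem_filter.1 k).2.2.symm), h2 w e,
        h.children w hwS]
  · intro w hw
    by_cases e : w = x
    · subst e; rw [h3, if_neg (Finset.notMem_erase _ _)]
    · rw [h4 w e, h.inTree w hw]
      simp [e]

theorem anc_sdiff_par {b x : Node} (hx : x ∈ anc g b) (hx0 : x ≠ (0, 0)) :
    anc g b \ anc g (par g x) = insert x (anc g b \ anc g x) := by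
  ext z
  rw [Finset.mem_insert, Finset.mem_sdiff, Finset.mem_sdiff, mem_anc_iff hx0]
  by_cases hz : z = x
  · subst hz; simp [hx, not_mem_anc_par hx0]
  · simp [hz]

/-- Invariant: exactly the nodes on the path of `b` strictly below `x` have been unlinked. By
`hkids`, a node that only `b` needs has no children off this path, so its counter has become zero;
an ancestor of `a` or `c` keeps its child towards that node. The walk ends at the lowest ancestor of
`b` shared with `a` or `c`, which is counted although it stays. -/
theorem WP_removeDeadPath {a b c : Node} {A S : Finset Node} {s : Mem} (hb : s.nodeReg .b = b)
    (ha : anc g a ⊆ S) (hc : anc g c ⊆ S) (hbS : anc g b ⊆ S) (hab : a ∉ anc g b)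
    (hcb : c ∉ anc g b)
    (hkids : ∀ x ∈ anc g b, x ∉ anc g a → x ∉ anc g c → ∀ w ∈ S, w ≠ (0, 0) → par g w = x →
      w ∈ anc g b)
    (hpar : ∀ v ∈ anc g b, v ≠ (0, 0) → s.nodeField .parent v = par g v)
    (hT : TreeMem g A S s) :
    WP I removeDeadPath (fun t s' => ∃ x, s'.nodeReg = Function.update s.nodeReg .x x ∧
      x ∈ anc g b ∧ anc g b \ anc g x = (anc g b \ anc g a) \ anc g c ∧
      TreeMem g A (S \ ((anc g b \ anc g a) \ anc g c)) s' ∧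
      s'.natReg = Function.update s.natReg .dead (((anc g b \ anc g a) \ anc g c).card + 1) ∧
      s'.nodeField = s.nodeField ∧ s'.realField = s.realField ∧ s'.out = s.out ∧
      (∀ f, f ≠ .children → f ≠ .inTree → s'.natField f = s.natField f) ∧
      t ≤ 50 * (((anc g b \ anc g a) \ anc g c).card + 1)) s := by
  set R := (anc g b \ anc g a) \ anc g c with hR
  have memR : ∀ z, z ∈ R ↔ z ∈ anc g b ∧ z ∉ anc g a ∧ z ∉ anc g c := by
    intro z; simp only [hR, Finset.mem_sdiff, and_assoc]
  let Iv : Mem → Prop := fun s' => ∃ x, s'.nodeReg = Function.update s.nodeReg .x x ∧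
      x ∈ anc g b ∧ anc g b \ anc g x ⊆ R ∧ TreeMem g A (S \ (anc g b \ anc g x)) s' ∧
      s'.natReg = Function.update s.natReg .dead ((anc g b \ anc g x).card + 1) ∧
      s'.nodeField = s.nodeField ∧ s'.realField = s.realField ∧ s'.out = s.out ∧
      (∀ f, f ≠ .children → f ≠ .inTree → s'.natField f = s.natField f)
  -- The loop test decides whether `x` belongs to `R`.
  have test : ∀ s' x, x ∈ anc g b → anc g b \ anc g x ⊆ R →
      TreeMem g A (S \ (anc g b \ anc g x)) s' → (s'.natField .children x = 0 ↔ x ∈ R) := by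
    intro s' x hx hxR hT'
    rw [hT'.children x (Finset.mem_sdiff.2 ⟨hbS hx, fun k =>
      (Finset.mem_sdiff.1 k).2 (self_mem_anc x)⟩), Finset.card_eq_zero,
      Finset.filter_eq_empty_iff]
    constructor
    · intro h
      -- Otherwise the child of `x` towards `e` would still be in the tree and would be counted.
      have aux : ∀ e, anc g e ⊆ S → e ∉ anc g b → (∀ z ∈ R, z ∉ anc g e) → x ∉ anc g e := by
        intro e heS heb heR hxe
        obtain ⟨y, hy0, hyx, hye⟩ := exists_child hxe (fun k => heb (k ▸ hx))
        refine h (Finset.mem_sdiff.2 ⟨heS hye, fun k => heR y (hxR k) hye⟩) ⟨hy0, hyx⟩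
      exact (memR x).2 ⟨hx, aux a ha hab fun z hz => ((memR z).1 hz).2.1,
        aux c hc hcb fun z hz => ((memR z).1 hz).2.2⟩
    · rintro h w hw ⟨hw0, hwx⟩
      rw [memR] at h
      rw [Finset.mem_sdiff] at hw
      have hwb := hkids x hx h.2.1 h.2.2 w hw.1 hw0 hwx
      refine hw.2 (Finset.mem_sdiff.2 ⟨hwb, ?_⟩)
      rw [← hwx]
      exact not_mem_anc_par hw0
  unfold removeDeadPath
  simp only [WP_block_cons, WP_block_nil, WP_setNode, WP_setNat, NodeExp.eval, NatExp.eval,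
    NodeExp.cost, NatExp.cost]
  refine (WP_while Iv (fun s' => (anc g (s'.nodeReg .x)).card) 20 ?_ _ ?_).mono ?_
  · rintro s' ⟨x, e1, e2, e3, e4, e5, e6, e7, e8, e9⟩ hcond
    have hx : s'.nodeReg .x = x := by rw [e1, Function.update_self]
    simp only [BoolExp.eval, NatExp.eval, hx] at hcond
    have hxR := (test s' x e2 e3 e4).1 hcond
    have hx0 : x ≠ (0, 0) := fun k => ((memR x).1 hxR).2.1 (k ▸ zero_mem_anc a)
    have hpx : s'.nodeField .parent x = par g x := by rw [e6]; exact hpar x e2 hx0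
    simp only [WP_block_cons, WP_block_nil, WP_setNode, WP_setNat, WP_storeNat, NodeExp.eval,
      NatExp.eval, NodeExp.cost, NatExp.cost, Mem.storeNat_proj, Mem.setNode_proj,
      Function.update_self, hx, hpx]
    refine ⟨⟨par g x, ?_, par_mem_of_mem e2 hx0, ?_, ?_, ?_, e6, e7, e8, ?_⟩, ?_, by omega⟩
    · simp [e1]
    · rw [anc_sdiff_par e2 hx0]; exact Finset.insert_subset hxR e3
    · have hset : S \ (anc g b \ anc g (par g x)) = (S \ (anc g b \ anc g x)).erase x := by
        rw [anc_sdiff_par e2 hx0, Finset.sdiff_insert]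
      rw [hset]
      refine e4.erase hx0 (Finset.mem_sdiff.2 ⟨hbS e2, fun k =>
        (Finset.mem_sdiff.1 k).2 (self_mem_anc x)⟩) (Finset.mem_sdiff.2
          ⟨hbS (par_mem_of_mem e2 hx0), fun k => (Finset.mem_sdiff.1 k).2 (par_mem_anc hx0)⟩)
          ?_ ?_ ?_ ?_
      · simp
      · intro w hw; simp [hw]
      · simp
      · intro w hw; simp [hw]
    · simp only [Mem.setNat_proj, Mem.storeNat_proj, Mem.setNode_proj, e5, Function.update_self,
        Function.update_idem]
      rw [anc_sdiff_par e2 hx0, Finset.card_insert_of_notMem]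
      exact fun k => (Finset.mem_sdiff.1 k).2 (self_mem_anc x)
    · intro f h1 h2
      rw [← e9 f h1 h2]
      simp [h1, h2]
    · simp only [Mem.setNat_proj, Mem.storeNat_proj, Mem.setNode_proj, Function.update_self]
      rw [anc_eq hx0, Finset.card_insert_of_notMem (not_mem_anc_par hx0)]
      omega
  · refine ⟨b, by simp [hb], self_mem_anc b, by simp, ?_, by simp, rfl, rfl, rfl, fun _ _ _ => rfl⟩
    rw [Finset.sdiff_self, Finset.sdiff_empty]
    exact ⟨hT.children, hT.inTree⟩
  · rintro t s' ⟨⟨x, e1, e2, e3, e4, e5, e6, e7, e8, e9⟩, hcond, ht⟩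
    have hx : s'.nodeReg .x = x := by rw [e1, Function.update_self]
    simp only [BoolExp.eval, NatExp.eval, hx] at hcond
    have hxR := fun k => hcond ((test s' x e2 e3 e4).2 k)
    have hset : anc g b \ anc g x = R := by
      refine Finset.Subset.antisymm e3 fun z hz => ?_
      obtain ⟨z1, z2, z3⟩ := (memR z).1 hz
      refine Finset.mem_sdiff.2 ⟨z1, fun k => hxR ((memR x).2 ⟨e2, ?_, ?_⟩)⟩
      · exact fun k' => z2 (anc_subset k' k)
      · exact fun k' => z3 (anc_subset k' k)
    refine ⟨x, e1, e2, hset, hset ▸ e4, by rw [e5, hset], e6, e7, e8, e9, ?_⟩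
    -- The measure falls from the size of `anc g b` to that of `anc g x`, that is, by the number of
    -- removed nodes.
    have hcard := Finset.card_sdiff_add_card_eq_card (anc_subset e2)
    rw [hset] at hcard
    simp only [hx, BoolExp.cost, NatExp.cost, Mem.setNat_proj, Mem.setNode_proj,
      Function.update_self, hb] at ht
    omega

/-- The walk from `start` to `x` that extends the shortcuts of one side. -/
theorem WP_extendAlong {start : NodeReg} {sink : NodeField} {mx : RealField} {f x : Node} {s : Mem}
    (hsink : sink ≠ .parent) (hstart : s.nodeReg start = f)
    (hx : s.nodeReg .x = x) (hxf : x ∈ anc g f)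
    (hpar : ∀ v ∈ anc g f, v ≠ (0, 0) → s.nodeField .parent v = par g v) :
    WP I (extendAlong start sink mx) (fun t s' =>
      t ≤ 50 * ((anc g f \ anc g x).card + 1) ∧
      s'.natReg = Function.update s.natReg .ext (s.natReg .ext + (anc g f \ anc g x).card) ∧
      (∀ r, r ≠ .y → s'.nodeReg r = s.nodeReg r) ∧ s'.natField = s.natField ∧ s'.out = s.out ∧
      s'.nodeField = Function.update s.nodeField sink (fun z =>
        if z ∈ anc g f \ anc g x then s.nodeField sink x else s.nodeField sink z) ∧
      s'.realField = Function.update s.realField mx (fun z =>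
        if z ∈ anc g f \ anc g x then max (s.realField mx z) (s.realField mx x)
        else s.realField mx z)) s := by
  let Iv : Mem → Prop := fun s' => ∃ y, s'.nodeReg .y = y ∧ y ∈ anc g f ∧ x ∈ anc g y ∧
      s'.natReg = Function.update s.natReg .ext (s.natReg .ext + (anc g f \ anc g y).card) ∧
      (∀ r, r ≠ .y → s'.nodeReg r = s.nodeReg r) ∧ s'.natField = s.natField ∧ s'.out = s.out ∧
      s'.nodeField = Function.update s.nodeField sink (fun z =>
        if z ∈ anc g f \ anc g y then s.nodeField sink x else s.nodeField sink z) ∧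
      s'.realField = Function.update s.realField mx (fun z =>
        if z ∈ anc g f \ anc g y then max (s.realField mx z) (s.realField mx x)
        else s.realField mx z)
  unfold extendAlong
  simp only [WP_block_cons, WP_block_nil, WP_setNode, NodeExp.eval, NodeExp.cost]
  refine (WP_while Iv (fun s' => (anc g (s'.nodeReg .y)).card) 20 ?_ _ ?_).mono ?_
  · rintro s' ⟨y, e1, e2, e3, e4, e5, e6, e7, e8, e9⟩ hcond
    have hx' : s'.nodeReg .x = x := by rw [e5 _ (by decide), hx]
    simp only [BoolExp.eval, NodeExp.eval, e1, hx'] at hcond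
    have hy0 : y ≠ (0, 0) := ne_zero_of_mem e3 (Ne.symm hcond)
    have hpy : s'.nodeField .parent y = par g y := by
      rw [e8, Function.update_of_ne hsink.symm]; exact hpar y e2 hy0
    have hy1 : y ∉ anc g f \ anc g y := fun k => (Finset.mem_sdiff.1 k).2 (self_mem_anc y)
    -- The entry of `x` is never overwritten, so it can be read afresh in every round.
    have hx1 : x ∉ anc g f \ anc g y := fun k => (Finset.mem_sdiff.1 k).2 e3
    have m1 : s'.nodeField sink x = s.nodeField sink x := by
      rw [e8, Function.update_self, if_neg hx1]
    have m2 : s'.realField mx x = s.realField mx x := by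
      rw [e9, Function.update_self, if_neg hx1]
    have m3 : s'.realField mx y = s.realField mx y := by
      rw [e9, Function.update_self, if_neg hy1]
    simp only [WP_block_cons, WP_block_nil, WP_setNode, WP_setNat, WP_storeNode, WP_storeReal,
      NodeExp.eval, RealExp.eval, RealExp.cost,
      NatExp.eval, NodeExp.cost, NatExp.cost, Mem.storeNode_proj, Mem.storeReal_proj,
      Mem.setNat_proj, Mem.setNode_proj, Function.update_self, e1, hx', m1, m2, m3,
      Function.update_of_ne hsink.symm, hpy]
    refine ⟨⟨par g y, by simp, par_mem_of_mem e2 hy0, mem_par_of_ne e3 (Ne.symm hcond), ?_, ?_,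
      e6, e7, ?_, ?_⟩, ?_, by omega⟩
    · simp only [Mem.storeNode_proj, Mem.storeReal_proj, Mem.setNat_proj, Mem.setNode_proj, e4,
        Function.update_self, Function.update_idem]
      rw [anc_sdiff_par e2 hy0, Finset.card_insert_of_notMem hy1, add_assoc]
    · intro r hr
      rw [← e5 r hr]
      simp [hr]
    · simp only [Mem.storeNode_proj, Mem.storeReal_proj, Mem.setNat_proj, Mem.setNode_proj, e8,
        Function.update_self, Function.update_idem]
      congr 1
      ext1 z
      rw [anc_sdiff_par e2 hy0]
      by_cases hz : z = y
      · subst hz; simp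
      · simp [hz]
    · simp only [Mem.storeNode_proj, Mem.storeReal_proj, Mem.setNat_proj, Mem.setNode_proj, e9,
        Function.update_self, Function.update_idem]
      congr 1
      ext1 z
      rw [anc_sdiff_par e2 hy0]
      by_cases hz : z = y
      · subst hz; simp
      · simp [hz]
    · rw [anc_eq hy0, Finset.card_insert_of_notMem (not_mem_anc_par hy0)]
      omega
  · refine ⟨f, by simp [hstart], self_mem_anc f, hxf, by simp, ?_, rfl, rfl, by simp, by simp⟩
    intro r hr
    simp [hr]
  · rintro t s' ⟨⟨y, e1, e2, e3, e4, e5, e6, e7, e8, e9⟩, hcond, ht⟩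
    have hx' : s'.nodeReg .x = x := by rw [e5 _ (by decide), hx]
    simp only [BoolExp.eval, NodeExp.eval, e1, hx', not_not] at hcond
    subst hcond
    refine ⟨?_, e4, e5, e6, e7, e8, e9⟩
    have hcard := Finset.card_sdiff_add_card_eq_card (anc_subset e2)
    simp only [e1, BoolExp.cost, NodeExp.cost, Mem.setNode_proj,
      Function.update_self, hstart] at ht
    omega

end Removal

/-! ### Shortcuts around the new node -/

section Shortcuts

variable {d : ℕ} {I : Input d} {g : Node → ℝ≥0}

/-- Only shortcuts have been changed: to the right at nodes in `R`, to the left at nodes in `L`. -/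
structure ShortcutUpd (R L : Node → Prop) (s s' : Mem) : Prop where
  parent : s'.nodeField .parent = s.nodeField .parent
  value : s'.realField .value = s.realField .value
  natField : s'.natField = s.natField
  out : s'.out = s.out
  nodeReg : ∀ r, r ≠ .y → s'.nodeReg r = s.nodeReg r
  natReg : ∀ r, r ≠ .ext → s'.natReg r = s.natReg r
  rightSink : ∀ z, ¬ R z → s'.nodeField .rightSink z = s.nodeField .rightSink z
  rightMax : ∀ z, ¬ R z → s'.realField .rightMax z = s.realField .rightMax z
  leftSink : ∀ z, ¬ L z → s'.nodeField .leftSink z = s.nodeField .leftSink z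
  leftMax : ∀ z, ¬ L z → s'.realField .leftMax z = s.realField .leftMax z

theorem ShortcutUpd.refl (R L : Node → Prop) (s : Mem) : ShortcutUpd R L s s :=
  ⟨rfl, rfl, rfl, rfl, fun _ _ => rfl, fun _ _ => rfl, fun _ _ => rfl, fun _ _ => rfl,
    fun _ _ => rfl, fun _ _ => rfl⟩

theorem ShortcutUpd.trans {R L R' L' : Node → Prop} {s s' s'' : Mem} (h : ShortcutUpd R L s s')
    (h' : ShortcutUpd R' L' s' s'') :
    ShortcutUpd (fun z => R z ∨ R' z) (fun z => L z ∨ L' z) s s'' where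
  parent := h'.parent.trans h.parent
  value := h'.value.trans h.value
  natField := h'.natField.trans h.natField
  out := h'.out.trans h.out
  nodeReg r hr := (h'.nodeReg r hr).trans (h.nodeReg r hr)
  natReg r hr := (h'.natReg r hr).trans (h.natReg r hr)
  rightSink z hz := (h'.rightSink z fun k => hz (Or.inr k)).trans
    (h.rightSink z fun k => hz (Or.inl k))
  rightMax z hz := (h'.rightMax z fun k => hz (Or.inr k)).trans
    (h.rightMax z fun k => hz (Or.inl k))
  leftSink z hz := (h'.leftSink z fun k => hz (Or.inr k)).trans
    (h.leftSink z fun k => hz (Or.inl k))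
  leftMax z hz := (h'.leftMax z fun k => hz (Or.inr k)).trans
    (h.leftMax z fun k => hz (Or.inl k))

theorem ShortcutUpd.mono {R L R' L' : Node → Prop} {s s' : Mem} (h : ShortcutUpd R L s s')
    (hR : ∀ z, R z → R' z) (hL : ∀ z, L z → L' z) : ShortcutUpd R' L' s s' :=
  { h with
    rightSink := fun z hz => h.rightSink z fun k => hz (hR z k)
    rightMax := fun z hz => h.rightMax z fun k => hz (hR z k)
    leftSink := fun z hz => h.leftSink z fun k => hz (hL z k)
    leftMax := fun z hz => h.leftMax z fun k => hz (hL z k) }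

theorem ShortcutUpd.halfFace_right {R L : Node → Prop} {s s' : Mem} (h : ShortcutUpd R L s s')
    {f f' : Node} (hf : HalfFace g (s.nodeField .rightSink) (s.realField .rightMax) f f')
    (hR : ∀ z ∈ anc g f, z ∉ anc g f' → ¬ R z) :
    HalfFace g (s'.nodeField .rightSink) (s'.realField .rightMax) f f' :=
  hf.congr (fun z h1 h2 => h.rightSink z (hR z h1 h2)) fun z h1 h2 => h.rightMax z (hR z h1 h2)

theorem ShortcutUpd.halfFace_left {R L : Node → Prop} {s s' : Mem} (h : ShortcutUpd R L s s')
    {f f' : Node} (hf : HalfFace g (s.nodeField .leftSink) (s.realField .leftMax) f f')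
    (hL : ∀ z ∈ anc g f, z ∉ anc g f' → ¬ L z) :
    HalfFace g (s'.nodeField .leftSink) (s'.realField .leftMax) f f' :=
  hf.congr (fun z h1 h2 => h.leftSink z (hL z h1 h2)) fun z h1 h2 => h.leftMax z (hL z h1 h2)

/-- A tree edge raises the coordinate sum by 1 or 2. This compares the lengths of two tree paths
that start at the same sink and end at adjacent nodes; it is the source of the factor 2 in the bound
for extensions. -/
theorem card_anc_sdiff {w : Node} : ∀ {v : Node}, w ∈ anc g v →
    (anc g v \ anc g w).card + (w.1 + w.2) ≤ v.1 + v.2 ∧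
      v.1 + v.2 ≤ 2 * (anc g v \ anc g w).card + (w.1 + w.2) := by
  intro v
  refine par_induction (g := g) (p := fun v => w ∈ anc g v →
    (anc g v \ anc g w).card + (w.1 + w.2) ≤ v.1 + v.2 ∧
      v.1 + v.2 ≤ 2 * (anc g v \ anc g w).card + (w.1 + w.2)) ?_ ?_ v
  · intro h
    rw [anc_zero, Finset.mem_singleton] at h
    subst h; simp
  · intro v hv ih h
    by_cases e : w = v
    · subst e; simp
    · have h' := mem_par_of_ne h e
      have := ih h'
      have := par_cases (g := g) hv
      rw [anc_eq hv, Finset.insert_sdiff_of_notMem, Finset.card_insert_of_notMem]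
      · omega
      · exact fun k => not_mem_anc_par hv (Finset.mem_sdiff.1 k).1
      · exact fun k => not_mem_anc_par hv (anc_subset h' k)

/-- The node `v` that is being added, and its candidate parents, in a given memory. -/
structure Corner (g : Node → ℝ≥0) (v a b c : Node) (s : Mem) : Prop where
  regG : s.nodeReg .g = v
  regA : s.nodeReg .a = a
  regB : s.nodeReg .b = b
  regC : s.nodeReg .c = c
  regP : s.nodeReg .p = par g v
  parentA : s.nodeField .parent a = par g a
  parentC : s.nodeField .parent c = par g c
  valueA : s.realField .value a = g a
  valueC : s.realField .value c = g c
  valueV : s.realField .value v = g v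
  a0 : a ≠ (0, 0)
  c0 : c ≠ (0, 0)
  v0 : v ≠ (0, 0)
  ab : a ∉ anc g b
  cb : c ∉ anc g b
  ac : a ∉ anc g c
  ca : c ∉ anc g a
  va : v ∉ anc g a
  vb : v ∉ anc g b
  vc : v ∉ anc g c
  between : anc g a ∩ anc g c ⊆ anc g b
  ba : b ∈ anc g a → par g a = b
  bc : b ∈ anc g c → par g c = b
  candidate : par g v = a ∨ par g v = b ∨ par g v = c

theorem Corner.upd {R L : Node → Prop} {v a b c : Node} {s s' : Mem} (h : Corner g v a b c s)
    (hu : ShortcutUpd R L s s') : Corner g v a b c s' :=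
  { h with
    regG := by rw [hu.nodeReg _ (by decide)]; exact h.regG
    regA := by rw [hu.nodeReg _ (by decide)]; exact h.regA
    regB := by rw [hu.nodeReg _ (by decide)]; exact h.regB
    regC := by rw [hu.nodeReg _ (by decide)]; exact h.regC
    regP := by rw [hu.nodeReg _ (by decide)]; exact h.regP
    parentA := by rw [hu.parent]; exact h.parentA
    parentC := by rw [hu.parent]; exact h.parentC
    valueA := by rw [hu.value]; exact h.valueA
    valueC := by rw [hu.value]; exact h.valueC
    valueV := by rw [hu.value]; exact h.valueV }

theorem Corner.a_ne_b {v a b c : Node} {s : Mem} (h : Corner g v a b c s) : a ≠ b :=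
  fun e => h.ab (e ▸ self_mem_anc a)

theorem Corner.c_ne_b {v a b c : Node} {s : Mem} (h : Corner g v a b c s) : c ≠ b :=
  fun e => h.cb (e ▸ self_mem_anc c)

theorem Corner.a_ne_c {v a b c : Node} {s : Mem} (h : Corner g v a b c s) : a ≠ c :=
  fun e => h.ac (e ▸ self_mem_anc a)

/-- The lower sink is `x`, and the merged face gets the higher one. If they differ, only the
shortcuts to `x` on the surviving side are outdated. Their number is at most the coordinate sum of
`a` (or `c`) minus that of `x`, hence at most one more than the same difference for `b`, which is at
most twice the number of removed nodes. -/
theorem WP_extendShortcuts {v a b c x : Node} {s : Mem} (hs : Corner g v a b c s)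
    (hx : s.nodeReg .x = x) (hxb : x ∈ anc g b)
    (hR : anc g b \ anc g x = (anc g b \ anc g a) \ anc g c)
    (hsab : anc g (s.nodeReg .sab) = anc g a ∩ anc g b)
    (hsbc : anc g (s.nodeReg .sbc) = anc g b ∩ anc g c)
    (hda : a.1 + a.2 ≤ b.1 + b.2 + 1) (hdc : c.1 + c.2 ≤ b.1 + b.2 + 1)
    (hpa : ∀ z ∈ anc g a, z ≠ (0, 0) → s.nodeField .parent z = par g z)
    (hpc : ∀ z ∈ anc g c, z ≠ (0, 0) → s.nodeField .parent z = par g z)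
    (har : HalfFace g (s.nodeField .rightSink) (s.realField .rightMax) a b)
    (hbl : HalfFace g (s.nodeField .leftSink) (s.realField .leftMax) b a)
    (hcl : HalfFace g (s.nodeField .leftSink) (s.realField .leftMax) c b)
    (hbr : HalfFace g (s.nodeField .rightSink) (s.realField .rightMax) b c) :
    WP I extendShortcuts (fun t s' =>
      ShortcutUpd (fun z => z ∈ anc g a ∧ z ∉ anc g b) (fun z => z ∈ anc g c ∧ z ∉ anc g b) s s' ∧
      HalfFace g (s'.nodeField .rightSink) (s'.realField .rightMax) a c ∧
      HalfFace g (s'.nodeField .leftSink) (s'.realField .leftMax) c a ∧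
      s'.natReg .ext ≤ s.natReg .ext + (2 * (anc g b \ anc g x).card + 1) ∧
      t ≤ 100 * ((anc g b \ anc g x).card + 2)) s := by
  set u := s.nodeReg .sab with hu
  set w := s.nodeReg .sbc with hw
  have hum : u ∈ anc g a ∩ anc g b := hsab ▸ self_mem_anc u
  have hwm : w ∈ anc g b ∩ anc g c := hsbc ▸ self_mem_anc w
  rw [Finset.mem_inter] at hum hwm
  have hbw' : anc g c ∩ anc g a ⊆ anc g b := by rw [Finset.inter_comm]; exact hs.between
  have memx : ∀ z ∈ anc g b, (z ∈ anc g x ↔ z ∈ anc g a ∨ z ∈ anc g c) := by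
    intro z hz
    have : z ∈ anc g b \ anc g x ↔ z ∈ (anc g b \ anc g a) \ anc g c := by rw [hR]
    simp only [Finset.mem_sdiff] at this
    tauto
  have hux : u ∈ anc g x := (memx u hum.2).2 (Or.inl hum.1)
  have hwx : w ∈ anc g x := (memx w hwm.1).2 (Or.inr hwm.2)
  have hcard := card_anc_sdiff hxb
  unfold extendShortcuts
  simp only [WP_ite, WP_skip, BoolExp.eval, NodeExp.eval, BoolExp.cost, NodeExp.cost, ← hu, ← hw,
    hx]
  refine ⟨fun e => ?_, fun e => ⟨fun e' => ?_, fun e' => ?_⟩⟩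
  · have i1 : anc g a ∩ anc g b = anc g b ∩ anc g c := by rw [← hsab, ← hsbc, e]
    refine ⟨ShortcutUpd.refl _ _ _, ?_, ?_, by omega, by omega⟩
    · refine har.of_merge hbw' ?_
      rw [Finset.inter_comm, i1]; exact Finset.inter_subset_right
    · refine hcl.of_merge hs.between ?_
      rw [← i1]; exact Finset.inter_subset_left
  · subst e'
    have hbca : anc g b ∩ anc g c ⊆ anc g a := by
      rw [← hsbc]; exact (anc_subset hwx).trans (anc_subset hum.1)
    have huc : u ∉ anc g c := fun k =>
      e (eq_of_mem_mem (hsbc ▸ Finset.mem_inter.2 ⟨hum.2, k⟩) hwx)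
    have hcard' := card_anc_sdiff hum.1
    refine (WP_extendAlong (by decide) hs.regA hx hum.1 hpa).mono ?_
    rintro t s' ⟨h1, h2, h3, h4, h5, h6, h7⟩
    have off : ∀ z, ¬ (z ∈ anc g a ∧ z ∉ anc g b) → z ∉ anc g a \ anc g u := by
      intro z hz k
      rw [Finset.mem_sdiff] at k
      refine k.2 ?_
      rw [hsab, Finset.mem_inter]
      exact ⟨k.1, by_contra fun k' => hz ⟨k.1, k'⟩⟩
    refine ⟨⟨?_, ?_, h4, h5, h3, ?_, ?_, ?_, ?_, ?_⟩, ?_, ?_, ?_, by omega⟩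
    · rw [h6, Function.update_of_ne (by decide)]
    · rw [h7, Function.update_of_ne (by decide)]
    · intro r hr; rw [h2, Function.update_of_ne hr]
    · intro z hz; rw [h6, Function.update_self, if_neg (off z hz)]
    · intro z hz; rw [h7, Function.update_self, if_neg (off z hz)]
    · intro z hz; rw [h6, Function.update_of_ne (by decide)]
    · intro z hz; rw [h7, Function.update_of_ne (by decide)]
    · refine har.merge hs.between hbr hsab hbca huc ?_ ?_
      · intro z; rw [h6, Function.update_self]
      · intro z; rw [h7, Function.update_self]
    -- The side of `c` already points to the higher sink; only its opposite side has a new name.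
    · rw [h6, h7, Function.update_of_ne (by decide), Function.update_of_ne (by decide)]
      exact hcl.of_merge hs.between hbca
    · rw [h2, Function.update_self]; omega
  -- The node `x` is shared with `a` or `c`, so it is one of the two sinks.
  · have hwx' : w = x := by
      rcases (memx x hxb).1 (self_mem_anc x) with k | k
      · exact absurd (eq_of_mem_mem hux (hsab ▸ Finset.mem_inter.2 ⟨k, hxb⟩)) e'
      · exact eq_of_mem_mem hwx (hsbc ▸ Finset.mem_inter.2 ⟨hxb, k⟩)
    clear e'
    subst hwx'
    have habc : anc g b ∩ anc g a ⊆ anc g c := by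
      rw [Finset.inter_comm, ← hsab]; exact (anc_subset hux).trans (anc_subset hwm.2)
    have hwa : w ∉ anc g a := fun k =>
      e (eq_of_mem_mem hux (hsab ▸ Finset.mem_inter.2 ⟨k, hwm.1⟩))
    have hcard' := card_anc_sdiff hwm.2
    refine (WP_extendAlong (by decide) hs.regC hx hwm.2 hpc).mono ?_
    rintro t s' ⟨h1, h2, h3, h4, h5, h6, h7⟩
    have off : ∀ z, ¬ (z ∈ anc g c ∧ z ∉ anc g b) → z ∉ anc g c \ anc g w := by
      intro z hz k
      rw [Finset.mem_sdiff] at k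
      refine k.2 ?_
      rw [hsbc, Finset.mem_inter]
      exact ⟨by_contra fun k' => hz ⟨k.1, k'⟩, k.1⟩
    refine ⟨⟨?_, ?_, h4, h5, h3, ?_, ?_, ?_, ?_, ?_⟩, ?_, ?_, ?_, by omega⟩
    · rw [h6, Function.update_of_ne (by decide)]
    · rw [h7, Function.update_of_ne (by decide)]
    · intro r hr; rw [h2, Function.update_of_ne hr]
    · intro z hz; rw [h6, Function.update_of_ne (by decide)]
    · intro z hz; rw [h7, Function.update_of_ne (by decide)]
    · intro z hz; rw [h6, Function.update_self, if_neg (off z hz)]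
    · intro z hz; rw [h7, Function.update_self, if_neg (off z hz)]
    · rw [h6, h7, Function.update_of_ne (by decide), Function.update_of_ne (by decide)]
      exact har.of_merge hbw' habc
    · refine hcl.merge hbw' hbl (by rw [hsbc, Finset.inter_comm]) habc hwa ?_ ?_
      · intro z; rw [h6, Function.update_self]
      · intro z; rw [h7, Function.update_self]
    · rw [h2, Function.update_self]; omega

/-- The shortcut of `a` after the face on its right has changed. -/
theorem WP_shortcutA {v a b c : Node} {s : Mem} (hs : Corner g v a b c s)
    (hm : par g a ≠ b → par g c ≠ b → par g v ≠ b →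
      HalfFace g (s.nodeField .rightSink) (s.realField .rightMax) a c)
    (har : par g a ≠ b → (par g c = b ∨ par g v = b) →
      HalfFace g (s.nodeField .rightSink) (s.realField .rightMax) a b)
    (hbr : par g c ≠ b → (par g a = b ∨ par g v = b) →
      HalfFace g (s.nodeField .rightSink) (s.realField .rightMax) b c) :
    WP I (.ite aBelowB (.ite (.or (.nodeEq (.reg .p) (.reg .b)) cBelowB)
        (shortcutToB .a .rightSink .rightMax) (shortcutVia .a .b .rightSink .rightMax)) .skip)
      (fun t s' => ShortcutUpd (fun z => z = a ∧ par g a = b) (fun _ => False) s s' ∧ t ≤ 30 ∧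
        (par g v = b → HalfFace g (s'.nodeField .rightSink) (s'.realField .rightMax) a b) ∧
        (par g v ≠ b → HalfFace g (s'.nodeField .rightSink) (s'.realField .rightMax) a c)) s := by
  simp only [WP_ite, WP_block_cons, WP_block_nil, WP_storeNode, WP_storeReal, WP_skip,
    aBelowB, cBelowB, shortcutToB, shortcutVia, BoolExp.eval, NodeExp.eval, RealExp.eval,
    BoolExp.cost, NodeExp.cost, RealExp.cost, Mem.storeNode_proj, Mem.storeReal_proj,
    hs.regA, hs.regB, hs.regC, hs.regP, hs.parentA, hs.parentC, hs.valueA]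
  have upd : ∀ q m, par g a = b → ShortcutUpd (fun z => z = a ∧ par g a = b) (fun _ => False) s
      ((s.storeNode .rightSink a q).storeReal .rightMax a m) := by
    intro q m hp
    refine ⟨by simp, by simp, rfl, rfl, fun _ _ => rfl, fun _ _ => rfl, ?_, ?_, by simp, by simp⟩
    · intro z hz
      have : z ≠ a := fun k => hz ⟨k, hp⟩
      simp [this]
    · intro z hz
      have : z ≠ a := fun k => hz ⟨k, hp⟩
      simp [this]
  refine ⟨fun h1 => ⟨fun h2 => ⟨upd _ _ h1, by omega, fun h3 => ?_, fun h3 => ?_⟩, fun h2 =>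
    ⟨upd _ _ h1, by omega, fun h3 => absurd (Or.inl h3) h2, fun h3 => ?_⟩⟩,
    fun h1 => ⟨ShortcutUpd.refl _ _ _, by omega, fun h3 => har h1 (Or.inr h3), fun h3 => ?_⟩⟩
  · exact HalfFace.to_parent hs.a0 hs.ab (h1 ▸ self_mem_anc _) (by simp [h1]) (by simp)
  · refine HalfFace.to_parent hs.a0 hs.ac ?_ (by simp [h1]) (by simp)
    rw [h1, ← h2.resolve_left h3]
    exact par_mem_anc hs.c0
  -- Among the three neighbours only `a` is a child of `b`. The face on the right of `b` becomes the
  -- one on the right of `a`, and the shortcut of `b` is passed on.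
  · rw [not_or] at h2
    refine HalfFace.via hs.a0 hs.ac ?_ (h1 ▸ hbr h2.2 (Or.inl h1)) ?_ ?_ (by simp [h1]) ?_
    · rw [h1]; exact fun k => h2.2 (hs.bc k)
    · intro z hz; simp [hz]
    · intro z hz; simp [hz]
    · simp [h1]
  · by_cases h2 : par g c = b
    · refine (har h1 (Or.inl h2)).of_merge (by rw [Finset.inter_comm]; exact hs.between) ?_
      exact Finset.inter_subset_left.trans (anc_subset (h2 ▸ par_mem_anc hs.c0))
    · exact hm h1 h2 h3

/-- The shortcut of `c` after the face on its left has changed. -/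
theorem WP_shortcutC {v a b c : Node} {s : Mem} (hs : Corner g v a b c s)
    (hm : par g a ≠ b → par g c ≠ b → par g v ≠ b →
      HalfFace g (s.nodeField .leftSink) (s.realField .leftMax) c a)
    (hcl : par g c ≠ b → (par g a = b ∨ par g v = b) →
      HalfFace g (s.nodeField .leftSink) (s.realField .leftMax) c b)
    (hbl : par g a ≠ b → (par g c = b ∨ par g v = b) →
      HalfFace g (s.nodeField .leftSink) (s.realField .leftMax) b a) :
    WP I (.ite cBelowB (.ite (.or (.nodeEq (.reg .p) (.reg .b)) aBelowB)
        (shortcutToB .c .leftSink .leftMax) (shortcutVia .c .b .leftSink .leftMax)) .skip)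
      (fun t s' => ShortcutUpd (fun _ => False) (fun z => z = c ∧ par g c = b) s s' ∧ t ≤ 30 ∧
        (par g v = b → HalfFace g (s'.nodeField .leftSink) (s'.realField .leftMax) c b) ∧
        (par g v ≠ b → HalfFace g (s'.nodeField .leftSink) (s'.realField .leftMax) c a)) s := by
  simp only [WP_ite, WP_block_cons, WP_block_nil, WP_storeNode, WP_storeReal, WP_skip,
    aBelowB, cBelowB, shortcutToB, shortcutVia, BoolExp.eval, NodeExp.eval, RealExp.eval,
    BoolExp.cost, NodeExp.cost, RealExp.cost, Mem.storeNode_proj, Mem.storeReal_proj,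
    hs.regA, hs.regB, hs.regC, hs.regP, hs.parentA, hs.parentC, hs.valueC]
  have upd : ∀ q m, par g c = b → ShortcutUpd (fun _ => False) (fun z => z = c ∧ par g c = b) s
      ((s.storeNode .leftSink c q).storeReal .leftMax c m) := by
    intro q m hp
    refine ⟨by simp, by simp, rfl, rfl, fun _ _ => rfl, fun _ _ => rfl, by simp, by simp, ?_, ?_⟩
    · intro z hz
      have : z ≠ c := fun k => hz ⟨k, hp⟩
      simp [this]
    · intro z hz
      have : z ≠ c := fun k => hz ⟨k, hp⟩
      simp [this]
  refine ⟨fun h1 => ⟨fun h2 => ⟨upd _ _ h1, by omega, fun h3 => ?_, fun h3 => ?_⟩, fun h2 =>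
    ⟨upd _ _ h1, by omega, fun h3 => absurd (Or.inl h3) h2, fun h3 => ?_⟩⟩,
    fun h1 => ⟨ShortcutUpd.refl _ _ _, by omega, fun h3 => hcl h1 (Or.inr h3), fun h3 => ?_⟩⟩
  · exact HalfFace.to_parent hs.c0 hs.cb (h1 ▸ self_mem_anc _) (by simp [h1]) (by simp)
  · refine HalfFace.to_parent hs.c0 hs.ca ?_ (by simp [h1]) (by simp)
    rw [h1, ← h2.resolve_left h3]
    exact par_mem_anc hs.a0
  -- The mirror image: the face on the left of `b` is passed on to `c`.
  · rw [not_or] at h2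
    refine HalfFace.via hs.c0 hs.ca ?_ (h1 ▸ hbl h2.2 (Or.inl h1)) ?_ ?_ (by simp [h1]) ?_
    · rw [h1]; exact fun k => h2.2 (hs.ba k)
    · intro z hz; simp [hz]
    · intro z hz; simp [hz]
    · simp [h1]
  · by_cases h2 : par g a = b
    · refine (hcl h1 (Or.inl h2)).of_merge hs.between ?_
      exact Finset.inter_subset_left.trans (anc_subset (h2 ▸ par_mem_anc hs.a0))
    · exact hm h2 h1 h3

/-- The shortcuts of the new node when its parent is `b`. -/
theorem WP_shortcutsBelowB {v a b c : Node} {s : Mem} (hs : Corner g v a b c s)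
    (hp : par g v = b)
    (hbl : par g a ≠ b → HalfFace g (s.nodeField .leftSink) (s.realField .leftMax) b a)
    (hbr : par g c ≠ b → HalfFace g (s.nodeField .rightSink) (s.realField .rightMax) b c) :
    WP I (block [
        .ite aBelowB (shortcutToB .g .leftSink .leftMax) (shortcutVia .g .b .leftSink .leftMax),
        .ite cBelowB (shortcutToB .g .rightSink .rightMax)
          (shortcutVia .g .b .rightSink .rightMax)])
      (fun t s' => ShortcutUpd (fun z => z = v) (fun z => z = v) s s' ∧ t ≤ 60 ∧
        HalfFace g (s'.nodeField .leftSink) (s'.realField .leftMax) v a ∧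
        HalfFace g (s'.nodeField .rightSink) (s'.realField .rightMax) v c) s := by
  have ha : par g a = b → b ∈ anc g a := fun k => k ▸ par_mem_anc hs.a0
  have hc : par g c = b → b ∈ anc g c := fun k => k ▸ par_mem_anc hs.c0
  simp only [WP_ite, WP_block_cons, WP_block_nil, WP_storeNode, WP_storeReal,
    aBelowB, cBelowB, shortcutToB, shortcutVia, BoolExp.eval, NodeExp.eval, RealExp.eval,
    BoolExp.cost, NodeExp.cost, RealExp.cost, Mem.storeNode_proj, Mem.storeReal_proj,
    hs.regG, hs.regA, hs.regB, hs.regC, hs.parentA, hs.parentC, hs.valueV, Function.update_of_ne,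
    ne_eq, reduceCtorEq, not_false_eq_true]
  have upd : ∀ q m q' m', ShortcutUpd (fun z => z = v) (fun z => z = v) s
      ((((s.storeNode .leftSink v q).storeReal .leftMax v m).storeNode .rightSink v q').storeReal
        .rightMax v m') := by
    intro q m q' m'
    refine ⟨by simp, by simp, rfl, rfl, fun _ _ => rfl, fun _ _ => rfl, ?_, ?_, ?_, ?_⟩ <;>
    · intro z hz; simp [hz]
  refine ⟨fun h1 => ⟨fun h2 => ⟨upd _ _ _ _, by omega, ?_, ?_⟩, fun h2 =>
    ⟨upd _ _ _ _, by omega, ?_, ?_⟩⟩, fun h1 => ⟨fun h2 => ⟨upd _ _ _ _, by omega, ?_, ?_⟩,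
    fun h2 => ⟨upd _ _ _ _, by omega, ?_, ?_⟩⟩⟩
  · exact HalfFace.to_parent hs.v0 hs.va (hp ▸ ha h1) (by simp [hp]) (by simp)
  · exact HalfFace.to_parent hs.v0 hs.vc (hp ▸ hc h2) (by simp [hp]) (by simp)
  · exact HalfFace.to_parent hs.v0 hs.va (hp ▸ ha h1) (by simp [hp]) (by simp)
  · refine HalfFace.via hs.v0 hs.vc (hp ▸ fun k => h2 (hs.bc k)) (hp ▸ hbr h2) ?_ ?_
      (by simp [hp]) (by simp [hp])
    · intro z hz; simp [hz]
    · intro z hz; simp [hz]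
  · refine HalfFace.via hs.v0 hs.va (hp ▸ fun k => h1 (hs.ba k)) (hp ▸ hbl h1) ?_ ?_
      (by simp [hp]) (by simp [hp])
    · intro z hz; simp [hz]
    · intro z hz; simp [hz]
  · exact HalfFace.to_parent hs.v0 hs.vc (hp ▸ hc h2) (by simp [hp]) (by simp)
  · refine HalfFace.via hs.v0 hs.va (hp ▸ fun k => h1 (hs.ba k)) (hp ▸ hbl h1) ?_ ?_
      (by simp [hp]) (by simp [hp])
    · intro z hz; simp [hz]
    · intro z hz; simp [hz]
  · refine HalfFace.via hs.v0 hs.vc (hp ▸ fun k => h2 (hs.bc k)) (hp ▸ hbr h2) ?_ ?_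
      (by simp [hp]) (by simp [hp])
    · intro z hz; simp [hz]
    · intro z hz; simp [hz]

/-- If the parent is `a` or `c`, the new node takes over its parent's side of the face between `a`
and `c`, and `HalfFace.right_child` adjusts the other side. If it is `b`, the new node separates a
face with `a` from a face with `c`. -/
theorem WP_makeShortcuts {v a b c : Node} {s : Mem} (hs : Corner g v a b c s)
    (hm : par g a ≠ b → par g c ≠ b → par g v ≠ b →
      HalfFace g (s.nodeField .rightSink) (s.realField .rightMax) a c ∧
      HalfFace g (s.nodeField .leftSink) (s.realField .leftMax) c a)
    (hab : par g a ≠ b → (par g c = b ∨ par g v = b) →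
      HalfFace g (s.nodeField .rightSink) (s.realField .rightMax) a b ∧
      HalfFace g (s.nodeField .leftSink) (s.realField .leftMax) b a)
    (hbc : par g c ≠ b → (par g a = b ∨ par g v = b) →
      HalfFace g (s.nodeField .rightSink) (s.realField .rightMax) b c ∧
      HalfFace g (s.nodeField .leftSink) (s.realField .leftMax) c b) :
    WP I makeShortcuts (fun t s' =>
      ShortcutUpd (fun z => (z = a ∧ par g a = b) ∨ z = v) (fun z => (z = c ∧ par g c = b) ∨ z = v)
        s s' ∧ t ≤ 150 ∧
      (par g v ≠ a → HalfFace g (s'.nodeField .rightSink) (s'.realField .rightMax) a v ∧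
        HalfFace g (s'.nodeField .leftSink) (s'.realField .leftMax) v a) ∧
      (par g v ≠ c → HalfFace g (s'.nodeField .rightSink) (s'.realField .rightMax) v c ∧
        HalfFace g (s'.nodeField .leftSink) (s'.realField .leftMax) c v)) s := by
  unfold makeShortcuts
  rw [WP_block_cons]
  refine (WP_shortcutA hs (fun h1 h2 h3 => (hm h1 h2 h3).1) (fun h1 h2 => (hab h1 h2).1)
    (fun h1 h2 => (hbc h1 h2).1)).mono ?_
  rintro t₁ s₁ ⟨u1, ht1, r1, r2⟩
  have hs1 := hs.upd u1
  rw [WP_block_cons]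
  refine (WP_shortcutC hs1
    (fun h1 h2 h3 => u1.halfFace_left (hm h1 h2 h3).2 fun _ _ _ k => k)
    (fun h1 h2 => u1.halfFace_left (hbc h1 h2).2 fun _ _ _ k => k)
    (fun h1 h2 => u1.halfFace_left (hab h1 h2).2 fun _ _ _ k => k)).mono ?_
  rintro t₂ s₂ ⟨u2, ht2, l1, l2⟩
  have hs2 := hs1.upd u2
  have u12 := u1.trans u2
  have r1' : par g v = b → HalfFace g (s₂.nodeField .rightSink) (s₂.realField .rightMax) a b :=
    fun h => u2.halfFace_right (r1 h) fun _ _ _ k => k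
  have r2' : par g v ≠ b → HalfFace g (s₂.nodeField .rightSink) (s₂.realField .rightMax) a c :=
    fun h => u2.halfFace_right (r2 h) fun _ _ _ k => k
  have fin : ∀ s', ShortcutUpd (fun z => z = v) (fun z => z = v) s₂ s' →
      ShortcutUpd (fun z => (z = a ∧ par g a = b) ∨ z = v) (fun z => (z = c ∧ par g c = b) ∨ z = v)
        s s' := fun s' h =>
    (u12.trans h).mono (fun z hz => hz.imp_left fun k => k.elim id False.elim)
      (fun z hz => hz.imp_left fun k => k.elim False.elim id)
  have nva : ∀ z ∈ anc g a, ¬ z = v := fun z hz k => hs.va (k ▸ hz)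
  have nvc : ∀ z ∈ anc g c, ¬ z = v := fun z hz k => hs.vc (k ▸ hz)
  rw [WP_block_cons]
  simp only [WP_block_nil, WP_ite (b := .nodeEq (.reg .p) (.reg .a)),
    WP_ite (b := .nodeEq (.reg .p) (.reg .c)), BoolExp.eval, NodeExp.eval, BoolExp.cost,
    NodeExp.cost, hs2.regP, hs2.regA, hs2.regC]
  refine ⟨fun hp => ?_, fun hp => ⟨fun hp' => ?_, fun hp' => ?_⟩⟩
  · have hpb : par g v ≠ b := by rw [hp]; exact hs.a_ne_b
    have hpc : par g v ≠ c := by rw [hp]; exact hs.a_ne_c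
    simp only [shortcutVia, WP_block_cons, WP_block_nil, WP_storeNode, WP_storeReal, NodeExp.eval,
      RealExp.eval, NodeExp.cost, RealExp.cost, Mem.storeNode_proj, Mem.storeReal_proj, hs2.regG,
      hs2.regA, hs2.valueV]
    have hu : ShortcutUpd (fun z => z = v) (fun z => z = v) s₂
        ((s₂.storeNode .rightSink v (s₂.nodeField .rightSink a)).storeReal .rightMax v
          (max (g v : ℝ) (s₂.realField .rightMax a))) := by
      refine ⟨by simp, by simp, rfl, rfl, fun _ _ => rfl, fun _ _ => rfl, ?_, ?_, ?_, ?_⟩ <;>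
      · intro z hz; simp [hz]
    refine ⟨fin _ hu, by omega, fun h => absurd hp h, fun _ => ⟨?_, ?_⟩⟩
    · refine HalfFace.via hs.v0 hs.vc (hp ▸ hs.ac) (hp ▸ r2' hpb) ?_ ?_ (by simp [hp])
        (by simp [hp])
      · intro z hz; simp [hz]
      · intro z hz; simp [hz]
    · exact HalfFace.right_child hs.v0 hs.vc (by
        rw [hp]; exact hu.halfFace_left (l2 hpb) fun z hz _ => nvc z hz)
  · have hpb : par g v ≠ b := by rw [hp']; exact hs.c_ne_b
    simp only [shortcutVia, WP_block_cons, WP_block_nil, WP_storeNode, WP_storeReal, NodeExp.eval,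
      RealExp.eval, NodeExp.cost, RealExp.cost, Mem.storeNode_proj, Mem.storeReal_proj, hs2.regG,
      hs2.regC, hs2.valueV]
    have hu : ShortcutUpd (fun z => z = v) (fun z => z = v) s₂
        ((s₂.storeNode .leftSink v (s₂.nodeField .leftSink c)).storeReal .leftMax v
          (max (g v : ℝ) (s₂.realField .leftMax c))) := by
      refine ⟨by simp, by simp, rfl, rfl, fun _ _ => rfl, fun _ _ => rfl, ?_, ?_, ?_, ?_⟩ <;>
      · intro z hz; simp [hz]
    refine ⟨fin _ hu, by omega, fun _ => ⟨?_, ?_⟩, fun h => absurd hp' h⟩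
    · exact HalfFace.right_child hs.v0 hs.va (by
        rw [hp']; exact hu.halfFace_right (r2' hpb) fun z hz _ => nva z hz)
    · refine HalfFace.via hs.v0 hs.va (hp' ▸ hs.ca) (hp' ▸ l2 hpb) ?_ ?_ (by simp [hp'])
        (by simp [hp'])
      · intro z hz; simp [hz]
      · intro z hz; simp [hz]
  · have hpb : par g v = b := by
      rcases hs.candidate with k | k | k
      · exact absurd k hp
      · exact k
      · exact absurd k hp'
    refine (WP_shortcutsBelowB hs2 hpb ?_ ?_).mono ?_
    · intro h
      refine u12.halfFace_left (hab h (Or.inr hpb)).2 ?_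
      rintro z hz _ (k | k)
      · exact k
      · exact hs.cb (k.1 ▸ hz)
    · intro h
      refine u12.halfFace_right (hbc h (Or.inr hpb)).1 ?_
      rintro z hz _ (k | k)
      · exact hs.ab (k.1 ▸ hz)
      · exact k
    · rintro t s' ⟨hu, ht, f1, f2⟩
      refine ⟨fin _ hu, by omega, fun _ => ⟨?_, f1⟩, fun _ => ⟨f2, ?_⟩⟩
      · exact HalfFace.right_child hs.v0 hs.va (by
          rw [hpb]; exact hu.halfFace_right (r1' hpb) fun z hz _ => nva z hz)
      · exact HalfFace.right_child hs.v0 hs.vc (by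
          rw [hpb]; exact hu.halfFace_left (l1 hpb) fun z hz _ => nvc z hz)

end Shortcuts

/-! ### Live nodes and the boundary of the growing tree -/

section Live

variable {g : Node → ℝ≥0} {m n : ℕ}

/-- The nodes that have been added when `(i, j)` has just been added. -/
noncomputable def added (m n i j : ℕ) : Finset Node :=
  open Classical in (Finset.range (m + 1) ×ˢ Finset.range (n + 1)).filter (Present m n i j)

/-- The added nodes that lead to a growth node, to the highest row or to the rightmost column. -/
noncomputable def live (g : Node → ℝ≥0) (m n i j : ℕ) : Finset Node :=
  open Classical in (added m n i j).filter fun v =>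
    ∃ w, Present m n i j w ∧ v ∈ anc g w ∧ ¬ Present m n i j (w.1 + 1, w.2 + 1)

theorem mem_added {i j : ℕ} {v : Node} : v ∈ added m n i j ↔ Present m n i j v := by
  unfold added
  simp only [Finset.mem_filter, Finset.mem_product, Finset.mem_range, and_iff_right_iff_imp]
  exact fun h => ⟨Nat.lt_succ_of_le h.1, Nat.lt_succ_of_le h.2.1⟩

theorem present_of_le {i j : ℕ} {u v : Node} (hv : Present m n i j v) (h1 : u.1 ≤ v.1)
    (h2 : u.2 ≤ v.2) : Present m n i j u := by
  unfold Present at *; omega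

theorem mem_live {i j : ℕ} {v : Node} : v ∈ live g m n i j ↔
    ∃ w, Present m n i j w ∧ v ∈ anc g w ∧ ¬ Present m n i j (w.1 + 1, w.2 + 1) := by
  unfold live
  simp only [Finset.mem_filter, mem_added, and_iff_right_iff_imp]
  rintro ⟨w, h1, h2, _⟩
  have := le_of_mem_anc h2
  exact present_of_le h1 this.1 this.2

theorem present_of_live {i j : ℕ} {v : Node} (h : v ∈ live g m n i j) : Present m n i j v := by
  obtain ⟨w, h1, h2, _⟩ := mem_live.1 h
  have := le_of_mem_anc h2
  exact present_of_le h1 this.1 this.2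

theorem anc_subset_live {i j : ℕ} {v : Node} (h : v ∈ live g m n i j) :
    anc g v ⊆ live g m n i j := by
  intro u hu
  obtain ⟨w, h1, h2, h3⟩ := mem_live.1 h
  exact mem_live.2 ⟨w, h1, anc_subset h2 hu, h3⟩

theorem mem_live_of_not_present {i j : ℕ} {v : Node} (h : Present m n i j v)
    (h' : ¬ Present m n i j (v.1 + 1, v.2 + 1)) : v ∈ live g m n i j :=
  mem_live.2 ⟨v, h, self_mem_anc v, h'⟩

/-- Presence is inherited towards the lower left, so if any neighbour is missing, the diagonal one
is. As nodes outside the box are never present, this one test covers growth nodes, the highest row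
and the rightmost column. -/
theorem growth_or_iff {i j : ℕ} {w : Node} (h : Present m n i j w) :
    ¬ (¬ Growth m n i j w ∧ w.1 ≠ m ∧ w.2 ≠ n) ↔ ¬ Present m n i j (w.1 + 1, w.2 + 1) := by
  constructor
  · intro h1 h2
    refine h1 ⟨?_, ?_, ?_⟩
    · rintro ⟨_, u, hu, h3, h4, h5⟩
      have := hu.cases'
      refine h5 (present_of_le h2 ?_ ?_) <;> simp only <;> omega
    · have := h2.1; simp only at this; omega
    · have := h2.2.1; simp only at this; omega
  · rintro h1 ⟨h2, h3, h4⟩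
    refine h2 ⟨h, (w.1 + 1, w.2 + 1), Or.inr (Or.inr rfl), ?_, ?_, h1⟩
    · have := h.1; simp only; omega
    · have := h.2.1; simp only; omega

theorem removable_iff {i j : ℕ} {v : Node} : Removable m n (treeOf m n (par g)) i j v ↔
    Present m n i j v ∧ v ∉ live g m n i j := by
  unfold Removable
  refine and_congr_right fun hv => ?_
  rw [mem_live]
  push Not
  refine forall_congr' fun w => forall_congr' fun hw => ?_
  rw [Anc_iff hw.1 hw.2.1]
  refine forall_congr' fun _ => ?_
  rw [← not_iff_not, growth_or_iff hw]

theorem present_succ {i j : ℕ} (hi : i < m) (hj : j < n) {u : Node} :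
    Present m n (i + 1) (j + 1) u ↔ Present m n (i + 1) j u ∨ u = (i + 1, j + 1) := by
  unfold Present
  rw [Prod.ext_iff]
  simp only
  omega

theorem added_succ {i j : ℕ} (hi : i < m) (hj : j < n) :
    added m n (i + 1) (j + 1) = insert (i + 1, j + 1) (added m n (i + 1) j) := by
  ext u
  rw [mem_added, present_succ hi hj, Finset.mem_insert, mem_added, or_comm]

theorem present_next {i : ℕ} {u : Node} :
    Present m n (i + 1) n u ↔ Present m n (i + 2) 0 u := by
  unfold Present; omega

theorem added_next {i : ℕ} : added m n (i + 2) 0 = added m n (i + 1) n := by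
  ext u; rw [mem_added, mem_added, present_next]

theorem live_next {i : ℕ} : live g m n (i + 2) 0 = live g m n (i + 1) n := by
  ext u; simp only [mem_live, present_next]

/-- Position of the boundary of the tree with respect to the three candidate parents. -/
theorem boundary_cases {i j : ℕ} (hi : i < m) (hj : j < n) {w : Node}
    (h : Present m n (i + 1) j w) (h' : ¬ Present m n (i + 1) j (w.1 + 1, w.2 + 1)) :
    w = (i, j) ∨ (w.1 ≤ i ∧ j + 1 ≤ w.2) ∨ (i + 1 ≤ w.1 ∧ w.2 ≤ j) := by
  rw [Prod.ext_iff]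
  unfold Present at *
  simp only at *
  omega

/-- The boundary changes by a single exchange: `(i, j)` leaves and the new node enters. All changes
of liveness come from this. -/
theorem not_present_shift {i j : ℕ} (hi : i < m) (hj : j < n) {w : Node} :
    ¬ Present m n (i + 1) (j + 1) (w.1 + 1, w.2 + 1) ↔ w = (i + 1, j + 1) ∨
      (¬ Present m n (i + 1) j (w.1 + 1, w.2 + 1) ∧ w ≠ (i, j)) := by
  rw [ne_eq, Prod.ext_iff, Prod.ext_iff]
  unfold Present at *
  simp only at *
  omega

theorem left_live {i j : ℕ} (hi : i < m) (hj : j < n) : (i, j + 1) ∈ live g m n (i + 1) j := by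
  apply mem_live_of_not_present <;> unfold Present <;> dsimp only <;> omega

theorem below_live {i j : ℕ} (hi : i < m) (hj : j < n) : (i, j) ∈ live g m n (i + 1) j := by
  apply mem_live_of_not_present <;> unfold Present <;> dsimp only <;> omega

theorem right_live {i j : ℕ} (hi : i < m) (hj : j < n) : (i + 1, j) ∈ live g m n (i + 1) j := by
  apply mem_live_of_not_present <;> unfold Present <;> dsimp only <;> omega

theorem mem_live_succ {i j : ℕ} (hi : i < m) (hj : j < n) {v : Node} :
    v ∈ live g m n (i + 1) (j + 1) ↔ v ∈ anc g (i + 1, j + 1) ∨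
      ∃ w, Present m n (i + 1) j w ∧ v ∈ anc g w ∧ ¬ Present m n (i + 1) j (w.1 + 1, w.2 + 1) ∧
        w ≠ (i, j) := by
  rw [mem_live]
  constructor
  · rintro ⟨w, h1, h2, h3⟩
    rcases (not_present_shift hi hj).1 h3 with h | h
    · exact Or.inl (h ▸ h2)
    · rcases (present_succ hi hj).1 h1 with h4 | h4
      · exact Or.inr ⟨w, h4, h2, h⟩
      · exact Or.inl (h4 ▸ h2)
  · rintro (h | ⟨w, h1, h2, h3⟩)
    · have hp : Present m n (i + 1) (j + 1) (i + 1, j + 1) :=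
        (present_succ hi hj).2 (Or.inr rfl)
      exact ⟨_, hp, h, (not_present_shift hi hj).2 (Or.inl rfl)⟩
    · have hp := (present_succ hi hj).2 (Or.inl h1)
      exact ⟨w, hp, h2, (not_present_shift hi hj).2 (Or.inr h3)⟩

theorem candidate_live {i j : ℕ} (hi : i < m) (hj : j < n) {c : Node} (h : IsCandidate i j c) :
    c ∈ live g m n (i + 1) j := by
  rcases h with rfl | rfl | rfl
  exacts [left_live hi hj, below_live hi hj, right_live hi hj]

/-- The set of live nodes grows by the new node if `(i, j)` still has a child. -/
theorem live_succ_of_child {i j : ℕ} (hi : i < m) (hj : j < n)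
    (h : par g (i, j + 1) = (i, j) ∨ par g (i + 1, j) = (i, j) ∨ par g (i + 1, j + 1) = (i, j)) :
    live g m n (i + 1) (j + 1) = insert (i + 1, j + 1) (live g m n (i + 1) j) := by
  have hv0 : (i + 1, j + 1) ≠ ((0, 0) : Node) := by simp
  ext v
  rw [mem_live_succ hi hj, Finset.mem_insert, mem_anc_iff hv0]
  constructor
  · rintro ((h1 | h1) | ⟨w, h1, h2, h3, _⟩)
    · exact Or.inl h1
    · exact Or.inr (anc_subset_live (candidate_live hi hj (par_candidate i j)) h1)
    · exact Or.inr (mem_live.2 ⟨w, h1, h2, h3⟩)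
  · rintro (h1 | h1)
    · exact Or.inl (Or.inl h1)
    · obtain ⟨w, h2, h3, h4⟩ := mem_live.1 h1
      by_cases hw : w = (i, j)
      -- Whatever was kept alive by `(i, j)` is now kept alive by its child.
      · subst hw
        rcases h with h | h | h
        · refine Or.inr ⟨(i, j + 1), ?_, anc_subset (h ▸ par_mem_anc (by simp)) h3, ?_, by simp⟩ <;>
            unfold Present <;> dsimp only <;> omega
        · refine Or.inr ⟨(i + 1, j), ?_, anc_subset (h ▸ par_mem_anc (by simp)) h3, ?_, by simp⟩ <;>
            unfold Present <;> dsimp only <;> omega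
        · exact Or.inl (Or.inr (h ▸ h3))
      · exact Or.inr ⟨w, h2, h3, h4, hw⟩

/-- An ancestor of `(i, j)` that leads to another boundary node is an ancestor of a neighbour. -/
theorem mem_anc_neighbour {i j : ℕ} (hi : i < m) (hj : j < n) {w x : Node}
    (h : Present m n (i + 1) j w) (h' : ¬ Present m n (i + 1) j (w.1 + 1, w.2 + 1))
    (hw : w ≠ (i, j)) (hx : x ∈ anc g (i, j)) (hxw : x ∈ anc g w) :
    x ∈ anc g (i, j + 1) ∨ x ∈ anc g (i + 1, j) := by
  rcases boundary_cases hi hj h h' with h1 | h1 | h1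
  · exact absurd h1 hw
  · exact Or.inl (mem_anc_of_between (f := w) (b := (i, j)) h1.1 h1.2 le_rfl (by simp) hxw hx)
  · exact Or.inr (mem_anc_of_between (f := (i, j)) (b := w) (by simp) le_rfl h1.1 h1.2 hx hxw)

/-- The nodes of the dead path that ends at `(i, j)` are no longer live. -/
theorem live_succ_of_childless {i j : ℕ} (hi : i < m) (hj : j < n)
    (hp : par g (i + 1, j + 1) ≠ (i, j)) :
    live g m n (i + 1) (j + 1) = insert (i + 1, j + 1) (live g m n (i + 1) j) \
      ((anc g (i, j) \ anc g (i, j + 1)) \ anc g (i + 1, j)) := by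
  have hv0 : (i + 1, j + 1) ≠ ((0, 0) : Node) := by simp
  have pa : Present m n (i + 1) j (i, j + 1) ∧ ¬ Present m n (i + 1) j (i + 1, j + 2) := by
    unfold Present; dsimp only; omega
  have pc : Present m n (i + 1) j (i + 1, j) ∧ ¬ Present m n (i + 1) j (i + 2, j + 1) := by
    unfold Present; dsimp only; omega
  have hcand : par g (i + 1, j + 1) = (i, j + 1) ∨ par g (i + 1, j + 1) = (i + 1, j) := by
    rcases par_candidate (g := g) i j with h | h | h
    exacts [Or.inl h, absurd h hp, Or.inr h]
  ext v
  rw [mem_live_succ hi hj, Finset.mem_sdiff, Finset.mem_insert, mem_anc_iff hv0,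
    Finset.mem_sdiff, Finset.mem_sdiff]
  constructor
  · rintro ((h1 | h1) | ⟨w, h1, h2, h3, h4⟩)
    · refine ⟨Or.inl h1, fun k => ?_⟩
      have := le_of_mem_anc k.1.1
      rw [h1] at this
      simp at this
    · refine ⟨Or.inr (anc_subset_live (candidate_live hi hj (par_candidate i j)) h1), fun k => ?_⟩
      rcases hcand with h | h
      · exact k.1.2 (h ▸ h1)
      · exact k.2 (h ▸ h1)
    · refine ⟨Or.inr (mem_live.2 ⟨w, h1, h2, h3⟩), fun k => ?_⟩
      rcases mem_anc_neighbour hi hj h1 h3 h4 k.1.1 h2 with h | h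
      · exact k.1.2 h
      · exact k.2 h
  · rintro ⟨h1 | h1, h2⟩
    · exact Or.inl (Or.inl h1)
    · right
      obtain ⟨w, h3, h4, h5⟩ := mem_live.1 h1
      by_cases hw : w = (i, j)
      · subst hw
        by_cases h6 : v ∈ anc g (i, j + 1)
        · exact ⟨_, pa.1, h6, pa.2, by simp⟩
        · by_cases h7 : v ∈ anc g (i + 1, j)
          · exact ⟨_, pc.1, h7, pc.2, by simp⟩
          · exact absurd ⟨⟨h4, h6⟩, h7⟩ h2
      · exact ⟨w, h3, h4, h5, hw⟩

/-- The children of the ancestors that only `(i, j)` keeps alive are on the same path. -/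
theorem child_mem_anc {i j : ℕ} (hi : i < m) (hj : j < n)
    (hp : par g (i + 1, j + 1) ≠ (i, j)) {x w : Node} (hx : x ∈ anc g (i, j))
    (hxa : x ∉ anc g (i, j + 1)) (hxc : x ∉ anc g (i + 1, j))
    (hw : w ∈ insert (i + 1, j + 1) (live g m n (i + 1) j)) (hw0 : w ≠ (0, 0))
    (hwx : par g w = x) : w ∈ anc g (i, j) := by
  rcases Finset.mem_insert.1 hw with h | h
  · subst h
    exfalso
    rcases par_candidate (g := g) i j with h | h | h
    · exact hxa (by rw [← hwx, h]; exact self_mem_anc _)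
    · exact hp h
    · exact hxc (by rw [← hwx, h]; exact self_mem_anc _)
  · obtain ⟨u, h1, h2, h3⟩ := mem_live.1 h
    by_cases hu : u = (i, j)
    · exact hu ▸ h2
    · have hxu : x ∈ anc g u := hwx ▸ par_mem_of_mem h2 hw0
      rcases mem_anc_neighbour hi hj h1 h3 hu hx hxu with k | k
      · exact absurd k hxa
      · exact absurd k hxc

end Live

/-! ### The invariant of the main loop -/

section Invariant

variable {d : ℕ} {I : Input d} {g : Node → ℝ≥0} {m n : ℕ}

/-- The shortcuts differ only to the right at nodes in `R` and to the left at nodes in `L`. -/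
structure SideUpd (R L : Node → Prop) (s s' : Mem) : Prop where
  rightSink : ∀ z, ¬ R z → s'.nodeField .rightSink z = s.nodeField .rightSink z
  rightMax : ∀ z, ¬ R z → s'.realField .rightMax z = s.realField .rightMax z
  leftSink : ∀ z, ¬ L z → s'.nodeField .leftSink z = s.nodeField .leftSink z
  leftMax : ∀ z, ¬ L z → s'.realField .leftMax z = s.realField .leftMax z

theorem ShortcutUpd.sideUpd {R L : Node → Prop} {s s' : Mem} (h : ShortcutUpd R L s s') :
    SideUpd R L s s' := ⟨h.rightSink, h.rightMax, h.leftSink, h.leftMax⟩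

theorem SideUpd.of_eq {R L : Node → Prop} {s s' : Mem}
    (h1 : s'.nodeField .rightSink = s.nodeField .rightSink)
    (h2 : s'.realField .rightMax = s.realField .rightMax)
    (h3 : s'.nodeField .leftSink = s.nodeField .leftSink)
    (h4 : s'.realField .leftMax = s.realField .leftMax) : SideUpd R L s s' :=
  ⟨fun _ _ => by rw [h1], fun _ _ => by rw [h2], fun _ _ => by rw [h3], fun _ _ => by rw [h4]⟩

theorem SideUpd.trans {R L R' L' : Node → Prop} {s s' s'' : Mem} (h : SideUpd R L s s')
    (h' : SideUpd R' L' s' s'') : SideUpd (fun z => R z ∨ R' z) (fun z => L z ∨ L' z) s s'' where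
  rightSink z hz := (h'.rightSink z fun k => hz (Or.inr k)).trans
    (h.rightSink z fun k => hz (Or.inl k))
  rightMax z hz := (h'.rightMax z fun k => hz (Or.inr k)).trans
    (h.rightMax z fun k => hz (Or.inl k))
  leftSink z hz := (h'.leftSink z fun k => hz (Or.inr k)).trans
    (h.leftSink z fun k => hz (Or.inl k))
  leftMax z hz := (h'.leftMax z fun k => hz (Or.inr k)).trans
    (h.leftMax z fun k => hz (Or.inl k))

theorem SideUpd.halfFace_right {R L : Node → Prop} {s s' : Mem} (h : SideUpd R L s s')
    {f f' : Node} (hf : HalfFace g (s.nodeField .rightSink) (s.realField .rightMax) f f')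
    (hR : ∀ z ∈ anc g f, z ∉ anc g f' → ¬ R z) :
    HalfFace g (s'.nodeField .rightSink) (s'.realField .rightMax) f f' :=
  hf.congr (fun z h1 h2 => h.rightSink z (hR z h1 h2)) fun z h1 h2 => h.rightMax z (hR z h1 h2)

theorem SideUpd.halfFace_left {R L : Node → Prop} {s s' : Mem} (h : SideUpd R L s s')
    {f f' : Node} (hf : HalfFace g (s.nodeField .leftSink) (s.realField .leftMax) f f')
    (hL : ∀ z ∈ anc g f, z ∉ anc g f' → ¬ L z) :
    HalfFace g (s'.nodeField .leftSink) (s'.realField .leftMax) f f' :=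
  hf.congr (fun z h1 h2 => h.leftSink z (hL z h1 h2)) fun z h1 h2 => h.leftMax z (hL z h1 h2)

theorem Corner.congr {v a b c : Node} {s s' : Mem} (h : Corner g v a b c s)
    (h1 : s'.nodeField .parent = s.nodeField .parent)
    (h2 : s'.realField .value = s.realField .value)
    (h3 : ∀ r, r ≠ .x → r ≠ .y → s'.nodeReg r = s.nodeReg r) : Corner g v a b c s' :=
  { h with
    regG := by rw [h3 _ (by decide) (by decide)]; exact h.regG
    regA := by rw [h3 _ (by decide) (by decide)]; exact h.regA
    regB := by rw [h3 _ (by decide) (by decide)]; exact h.regB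
    regC := by rw [h3 _ (by decide) (by decide)]; exact h.regC
    regP := by rw [h3 _ (by decide) (by decide)]; exact h.regP
    parentA := by rw [h1]; exact h.parentA
    parentC := by rw [h1]; exact h.parentC
    valueA := by rw [h2]; exact h.valueA
    valueC := by rw [h2]; exact h.valueC
    valueV := by rw [h2]; exact h.valueV }

theorem WP_removal {v a b c : Node} {A S : Finset Node} {s : Mem} (hs : Corner g v a b c s)
    (ha : anc g a ⊆ S) (hc : anc g c ⊆ S) (hbS : anc g b ⊆ S)
    (hkids : ∀ x ∈ anc g b, x ∉ anc g a → x ∉ anc g c → ∀ w ∈ S, w ≠ (0, 0) → par g w = x →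
      w ∈ anc g b)
    (hT : TreeMem g A S s)
    (hsab : anc g (s.nodeReg .sab) = anc g a ∩ anc g b)
    (hsbc : anc g (s.nodeReg .sbc) = anc g b ∩ anc g c)
    (hda : a.1 + a.2 ≤ b.1 + b.2 + 1) (hdc : c.1 + c.2 ≤ b.1 + b.2 + 1)
    (hpar : ∀ z ∈ S, z ≠ (0, 0) → s.nodeField .parent z = par g z)
    (har : HalfFace g (s.nodeField .rightSink) (s.realField .rightMax) a b)
    (hbl : HalfFace g (s.nodeField .leftSink) (s.realField .leftMax) b a)
    (hcl : HalfFace g (s.nodeField .leftSink) (s.realField .leftMax) c b)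
    (hbr : HalfFace g (s.nodeField .rightSink) (s.realField .rightMax) b c) :
    WP I (block [removeDeadPath, extendShortcuts]) (fun t s' => Corner g v a b c s' ∧
      s'.nodeField .parent = s.nodeField .parent ∧ s'.realField .value = s.realField .value ∧
      s'.out = s.out ∧ s'.natReg .i = s.natReg .i ∧ s'.natReg .j = s.natReg .j ∧
      (∀ f, f ≠ .children → f ≠ .inTree → s'.natField f = s.natField f) ∧
      TreeMem g A (S \ ((anc g b \ anc g a) \ anc g c)) s' ∧
      s'.natReg .dead = ((anc g b \ anc g a) \ anc g c).card + 1 ∧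
      s'.natReg .ext ≤ s.natReg .ext + (2 * ((anc g b \ anc g a) \ anc g c).card + 1) ∧
      SideUpd (fun z => z ∈ anc g a ∧ z ∉ anc g b) (fun z => z ∈ anc g c ∧ z ∉ anc g b) s s' ∧
      HalfFace g (s'.nodeField .rightSink) (s'.realField .rightMax) a c ∧
      HalfFace g (s'.nodeField .leftSink) (s'.realField .leftMax) c a ∧
      t ≤ 300 * (((anc g b \ anc g a) \ anc g c).card + 1)) s := by
  rw [WP_block_cons]
  refine (WP_removeDeadPath hs.regB ha hc hbS hs.ab hs.cb hkids
    (fun z hz => hpar z (hbS hz)) hT).mono ?_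
  rintro t₁ s₁ ⟨x, e1, e2, e3, e4, e5, e6, e7, e8, e9, ht⟩
  have hreg : ∀ r, r ≠ .x → s₁.nodeReg r = s.nodeReg r := fun r hr => by
    rw [e1, Function.update_of_ne hr]
  have hs1 : Corner g v a b c s₁ := hs.congr (by rw [e6]) (by rw [e7]) fun r hr _ => hreg r hr
  rw [← e6, ← e7] at har hbl hcl hbr
  rw [WP_block_cons]
  refine (WP_extendShortcuts hs1 (by rw [e1, Function.update_self]) e2 e3
    (by rw [hreg _ (by decide)]; exact hsab) (by rw [hreg _ (by decide)]; exact hsbc) hda hdc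
    (fun z hz h => by rw [e6]; exact hpar z (ha hz) h)
    (fun z hz h => by rw [e6]; exact hpar z (hc hz) h) har hbl hcl hbr).mono ?_
  rintro t₂ s₂ ⟨hu, f1, f2, f3, f4⟩
  rw [WP_block_nil]
  rw [e3] at f3 f4
  have hu' := hu.sideUpd
  refine ⟨hs1.upd hu, hu.parent.trans (by rw [e6]), hu.value.trans (by rw [e7]),
    hu.out.trans e8, ?_, ?_, ?_, ?_, ?_, ?_, ?_, f1, f2, ?_⟩
  · rw [hu.natReg _ (by decide), e5, Function.update_of_ne (by decide)]
  · rw [hu.natReg _ (by decide), e5, Function.update_of_ne (by decide)]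
  · intro f h1 h2
    rw [hu.natField, e9 f h1 h2]
  · exact ⟨by rw [hu.natField]; exact e4.children, by rw [hu.natField]; exact e4.inTree⟩
  · rw [hu.natReg _ (by decide), e5, Function.update_self]
  · rw [e5, Function.update_of_ne (by decide)] at f3
    exact f3
  · refine ⟨?_, ?_, ?_, ?_⟩
    · rw [← e6]; exact hu'.rightSink
    · rw [← e7]; exact hu'.rightMax
    · rw [← e6]; exact hu'.leftSink
    · rw [← e7]; exact hu'.leftMax
  · omega

/-- A single horizontal or vertical step leaves no room for a tree node in between. -/
theorem par_eq_of_mem {i j : ℕ} {a : Node} (ha : a = (i, j + 1) ∨ a = (i + 1, j))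
    (h : (i, j) ∈ anc g a) : par g a = (i, j) := by
  have hne : (i, j) ≠ a := by rcases ha with rfl | rfl <;> simp
  have h1 := le_of_mem_anc (mem_par_of_ne h hne)
  have h2 := par_cases (g := g) (ne_zero_of_mem h hne)
  rcases ha with rfl | rfl <;> exact Prod.ext (by simp only at *; omega) (by simp only at *; omega)

theorem corner_mk {i j : ℕ} {s : Mem} (h1 : s.nodeReg .g = (i + 1, j + 1))
    (h2 : s.nodeReg .a = (i, j + 1)) (h3 : s.nodeReg .b = (i, j)) (h4 : s.nodeReg .c = (i + 1, j))
    (h5 : s.nodeReg .p = par g (i + 1, j + 1))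
    (h6 : s.nodeField .parent (i, j + 1) = par g (i, j + 1))
    (h7 : s.nodeField .parent (i + 1, j) = par g (i + 1, j))
    (h8 : s.realField .value (i, j + 1) = g (i, j + 1))
    (h9 : s.realField .value (i + 1, j) = g (i + 1, j))
    (h10 : s.realField .value (i + 1, j + 1) = g (i + 1, j + 1)) :
    Corner g (i + 1, j + 1) (i, j + 1) (i, j) (i + 1, j) s := by
  refine ⟨h1, h2, h3, h4, h5, h6, h7, h8, h9, h10, by simp, by simp, by simp, ?_, ?_, ?_, ?_, ?_,
    ?_, ?_, ?_, par_eq_of_mem (Or.inl rfl), par_eq_of_mem (Or.inr rfl), par_candidate i j⟩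
  any_goals
    intro h
    have := le_of_mem_anc h
    simp at this
  intro z hz
  rw [Finset.mem_inter] at hz
  exact mem_anc_of_between (f := (i, j + 1)) (b := (i + 1, j)) le_rfl (by simp) (by simp)
    le_rfl hz.1 hz.2

/-- What is recorded about the dead path that is removed when `(i + 1, j + 1)` is added. -/
def Record (g : Node → ℝ≥0) (m n i j dead ext : ℕ) : Prop :=
  (¬ Removable m n (treeOf m n (par g)) (i + 1) (j + 1) (i, j) → ext = 0) ∧
  (Removable m n (treeOf m n (par g)) (i + 1) (j + 1) (i, j) →
    ∃ l, IsDeadPath m n (treeOf m n (par g)) (i + 1) (j + 1) l (i, j) ∧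
      dead = l.length ∧ ext ≤ 2 * l.length - 1)

/-- The child keeps `(i, j)` alive, so the clause about removal is void and `dead` is arbitrary. -/
theorem record_of_child {i j dead : ℕ} (hi : i < m) (hj : j < n)
    (h : par g (i, j + 1) = (i, j) ∨ par g (i + 1, j) = (i, j) ∨ par g (i + 1, j + 1) = (i, j)) :
    Record g m n i j dead 0 := by
  refine ⟨fun _ => rfl, fun hr => ?_⟩
  rw [removable_iff, live_succ_of_child hi hj h] at hr
  exact absurd (Finset.mem_insert_of_mem (below_live hi hj)) hr.2

/-- The dead path has one node more than are removed, its first node, so twice the number of removed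
nodes plus one is twice its length minus one. -/
theorem record_of_childless {i j ext : ℕ} (hi : i < m) (hj : j < n)
    (h1 : par g (i, j + 1) ≠ (i, j)) (h2 : par g (i + 1, j) ≠ (i, j))
    (h3 : par g (i + 1, j + 1) ≠ (i, j))
    (he : ext ≤ 2 * ((anc g (i, j) \ anc g (i, j + 1)) \ anc g (i + 1, j)).card + 1) :
    Record g m n i j (((anc g (i, j) \ anc g (i, j + 1)) \ anc g (i + 1, j)).card + 1) ext := by
  have hlive := live_succ_of_childless (g := g) hi hj h3
  set R := (anc g (i, j) \ anc g (i, j + 1)) \ anc g (i + 1, j) with hR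
  have memR : ∀ z, z ∈ R ↔ z ∈ anc g (i, j) ∧ z ∉ anc g (i, j + 1) ∧ z ∉ anc g (i + 1, j) := by
    intro z; simp only [hR, Finset.mem_sdiff, and_assoc]
  have hbR : (i, j) ∈ R := (memR _).2 ⟨self_mem_anc _,
    fun k => h1 (par_eq_of_mem (Or.inl rfl) k), fun k => h2 (par_eq_of_mem (Or.inr rfl) k)⟩
  have pres : ∀ z ∈ anc g (i, j), Present m n (i + 1) (j + 1) z := fun z hz => by
    have := le_of_mem_anc hz
    unfold Present; simp only at this ⊢; omega
  have hrem : ∀ z ∈ R, Removable m n (treeOf m n (par g)) (i + 1) (j + 1) z := fun z hz =>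
    removable_iff.2 ⟨pres z ((memR z).1 hz).1, fun k => by
      rw [hlive] at k; exact (Finset.mem_sdiff.1 k).2 hz⟩
  refine ⟨fun h => absurd (hrem _ hbR) h, fun _ => ?_⟩
  -- The first node of the path is the lower one of the two nearest common ancestors.
  have hx : ∃ x ∈ anc g (i, j), anc g (i, j) \ anc g x = R := by
    obtain ⟨u, hu⟩ := exists_inter_anc (g := g) (i, j + 1) (i, j)
    obtain ⟨w, hw⟩ := exists_inter_anc (g := g) (i + 1, j) (i, j)
    have hum := hu ▸ self_mem_anc (g := g) u
    have hwm := hw ▸ self_mem_anc (g := g) w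
    rw [Finset.mem_inter] at hum hwm
    have key : ∀ x, x ∈ anc g (i, j) → u ∈ anc g x → w ∈ anc g x → (x ∈ anc g (i, j + 1) ∨
        x ∈ anc g (i + 1, j)) → anc g (i, j) \ anc g x = R := by
      intro x hx hux hwx hxac
      ext z
      rw [memR, Finset.mem_sdiff]
      refine and_congr_right fun hz => ⟨fun k => ⟨fun k' => k ?_, fun k' => k ?_⟩, ?_⟩
      · exact anc_subset hux (hu ▸ Finset.mem_inter.2 ⟨hz, k'⟩)
      · exact anc_subset hwx (hw ▸ Finset.mem_inter.2 ⟨hz, k'⟩)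
      · rintro ⟨k1, k2⟩ k
        exact hxac.elim (fun q => k1 (anc_subset q k)) fun q => k2 (anc_subset q k)
    rcases mem_anc_total hum.1 hwm.1 with h | h
    · exact ⟨w, hwm.1, key w hwm.1 h (self_mem_anc w) (Or.inr hwm.2)⟩
    · exact ⟨u, hum.1, key u hum.1 (self_mem_anc u) h (Or.inl hum.2)⟩
  obtain ⟨x, hxb, hxR⟩ := hx
  obtain ⟨l, hl⟩ := exists_treePath (m := m) (n := n) (g := g) (v := (i, j)) hi.le hj.le hxb
  have hlen := length_of_treePath _ hl
  have htail := (toFinset_tail_of_treePath _ hl).2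
  rw [hxR] at hlen htail
  refine ⟨x :: l, ⟨x, hl, ?_, ?_⟩, hlen.symm, by omega⟩
  · rw [removable_iff]
    rintro ⟨_, k⟩
    refine k ?_
    rw [hlive]
    refine Finset.mem_sdiff.2 ⟨Finset.mem_insert_of_mem (anc_subset_live (below_live hi hj) hxb),
      fun q => ?_⟩
    rw [← hxR] at q
    exact (Finset.mem_sdiff.1 q).2 (self_mem_anc x)
  · intro z hz
    exact hrem z (htail ▸ List.mem_toFinset.2 hz)

/-- The pairs of neighbouring nodes on the boundary of the tree after `(i + 1, j)` has been
added. -/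
def Neighbours (n i j : ℕ) (f f' : Node) : Prop :=
  (∃ r, j ≤ r ∧ r + 1 ≤ n ∧ f = (i, r + 1) ∧ f' = (i, r)) ∨ (f = (i, j) ∧ f' = (i + 1, j)) ∨
    (∃ r, r + 1 ≤ j ∧ f = (i + 1, r + 1) ∧ f' = (i + 1, r))

/-- The memory after `(i + 1, j)` has been added. -/
structure Inv (g : Node → ℝ≥0) (m n i j : ℕ) (s : Mem) : Prop where
  value : ∀ v : Node, v.1 ≤ m → v.2 ≤ n → s.realField .value v = g v
  parent : ∀ v : Node, Present m n (i + 1) j v → v ≠ (0, 0) → s.nodeField .parent v = par g v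
  tree : TreeMem g (added m n (i + 1) j) (live g m n (i + 1) j) s
  face : ∀ f f', Neighbours n i j f f' → f' ∉ anc g f → f ∉ anc g f' →
    HalfFace g (s.nodeField .rightSink) (s.realField .rightMax) f f' ∧
    HalfFace g (s.nodeField .leftSink) (s.realField .leftMax) f' f
  out : s.out = []
  record : ∀ i' j', i' < m → j' < n → Present m n (i + 1) j (i' + 1, j' + 1) →
    Record g m n i' j' (s.natField .deadNodes (i' + 1, j' + 1))
      (s.natField .extensions (i' + 1, j' + 1))

/-- The number of nodes that have been removed after `(i, j)` has been added. -/
noncomputable def removed (g : Node → ℝ≥0) (m n i j : ℕ) : ℕ :=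
  (added m n i j \ live g m n i j).card

theorem removed_succ_of_child {i j : ℕ} (hi : i < m) (hj : j < n)
    (h : par g (i, j + 1) = (i, j) ∨ par g (i + 1, j) = (i, j) ∨ par g (i + 1, j + 1) = (i, j)) :
    removed g m n (i + 1) j ≤ removed g m n (i + 1) (j + 1) := by
  unfold removed
  rw [live_succ_of_child hi hj h, added_succ hi hj]
  refine Finset.card_le_card fun z hz => ?_
  rw [Finset.mem_sdiff] at *
  refine ⟨Finset.mem_insert_of_mem hz.1, fun k => hz.2 ?_⟩
  refine (Finset.mem_insert.1 k).resolve_left fun e => ?_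
  have := mem_added.1 hz.1
  rw [e] at this
  unfold Present at this; simp only at this; omega

/-- The nodes that die now were live until now, hence are disjoint from those that died earlier; no
node is charged twice. -/
theorem removed_succ_of_childless {i j : ℕ} (hi : i < m) (hj : j < n)
    (h3 : par g (i + 1, j + 1) ≠ (i, j)) :
    removed g m n (i + 1) j + ((anc g (i, j) \ anc g (i, j + 1)) \ anc g (i + 1, j)).card ≤
      removed g m n (i + 1) (j + 1) := by
  unfold removed
  rw [live_succ_of_childless hi hj h3, added_succ hi hj, ← Finset.card_union_of_disjoint]
  · refine Finset.card_le_card fun z hz => ?_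
    rw [Finset.mem_union] at hz
    rw [Finset.mem_sdiff]
    rcases hz with hz | hz
    · rw [Finset.mem_sdiff] at hz
      refine ⟨Finset.mem_insert_of_mem hz.1, fun k => hz.2 ?_⟩
      rw [Finset.mem_sdiff] at k
      refine (Finset.mem_insert.1 k.1).resolve_left fun e => ?_
      have := mem_added.1 hz.1
      rw [e] at this
      unfold Present at this; simp only at this; omega
    · refine ⟨Finset.mem_insert_of_mem ?_, fun k => (Finset.mem_sdiff.1 k).2 hz⟩
      rw [Finset.mem_sdiff, Finset.mem_sdiff] at hz
      exact mem_added.2 (present_of_live (anc_subset_live (below_live hi hj) hz.1.1))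
  · rw [Finset.disjoint_left]
    intro z hz hz'
    rw [Finset.mem_sdiff] at hz hz'
    rw [Finset.mem_sdiff] at hz'
    exact hz.2 (anc_subset_live (below_live hi hj) hz'.1.1)

/-- The shortcuts of the other faces do not change when `(i + 1, j + 1)` is added. -/
theorem face_of_sideUpd {i j : ℕ} {s s' : Mem} (hI : Inv g m n i j s)
    (hu : SideUpd (fun z => (z ∈ anc g (i, j + 1) ∧ z ∉ anc g (i, j)) ∨ z = (i + 1, j + 1))
      (fun z => (z ∈ anc g (i + 1, j) ∧ z ∉ anc g (i, j)) ∨ z = (i + 1, j + 1)) s s')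
    (h1 : (i + 1, j + 1) ∉ anc g (i, j + 1) → (i, j + 1) ∉ anc g (i + 1, j + 1) →
      HalfFace g (s'.nodeField .rightSink) (s'.realField .rightMax) (i, j + 1) (i + 1, j + 1) ∧
      HalfFace g (s'.nodeField .leftSink) (s'.realField .leftMax) (i + 1, j + 1) (i, j + 1))
    (h2 : (i + 1, j) ∉ anc g (i + 1, j + 1) → (i + 1, j + 1) ∉ anc g (i + 1, j) →
      HalfFace g (s'.nodeField .rightSink) (s'.realField .rightMax) (i + 1, j + 1) (i + 1, j) ∧
      HalfFace g (s'.nodeField .leftSink) (s'.realField .leftMax) (i + 1, j) (i + 1, j + 1))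
    (f f' : Node) (hN : Neighbours n i (j + 1) f f') (hf : f' ∉ anc g f) (hf' : f ∉ anc g f') :
    HalfFace g (s'.nodeField .rightSink) (s'.realField .rightMax) f f' ∧
    HalfFace g (s'.nodeField .leftSink) (s'.realField .leftMax) f' f := by
  rcases hN with ⟨r, hr, hrn, rfl, rfl⟩ | ⟨rfl, rfl⟩ | ⟨r, hr, rfl, rfl⟩
  · obtain ⟨k1, k2⟩ := hI.face _ _ (Or.inl ⟨r, by omega, hrn, rfl, rfl⟩) hf hf'
    refine ⟨hu.halfFace_right k1 ?_, hu.halfFace_left k2 ?_⟩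
    -- A changed node on this side would be an ancestor of `(i, r + 1)` and `(i, j + 1)`, hence of
    -- `(i, r)` between them, and so would not belong to this face. The other three cases use
    -- planarity in the same way.
    · rintro z hz hz' (⟨h3, h4⟩ | h3)
      · exact hz' (mem_anc_of_between (f := (i, r + 1)) (b := (i, j + 1)) (by simp) (by simp)
          (by simp) (by simpa using hr) hz h3)
      · have := le_of_mem_anc hz; rw [h3] at this; simp at this
    · rintro z hz hz' (⟨h3, h4⟩ | h3)
      · exact h4 (mem_anc_of_between (f := (i, r)) (b := (i + 1, j)) (by simp)
          (by simp; omega) (by simp) (by simp) hz h3)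
      · have := le_of_mem_anc hz; rw [h3] at this; simp at this
  · exact h1 hf hf'
  · by_cases e : r = j
    · subst e; exact h2 hf hf'
    obtain ⟨k1, k2⟩ := hI.face _ _ (Or.inr (Or.inr ⟨r, by omega, rfl, rfl⟩)) hf hf'
    refine ⟨hu.halfFace_right k1 ?_, hu.halfFace_left k2 ?_⟩
    · rintro z hz hz' (⟨h3, h4⟩ | h3)
      · exact h4 (mem_anc_of_between (f := (i, j + 1)) (b := (i + 1, r + 1)) (by simp)
          (by simp) (by simp) (by simp; omega) h3 hz)
      · have := le_of_mem_anc hz; rw [h3] at this; simp at this; omega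
    · rintro z hz hz' (⟨h3, h4⟩ | h3)
      · exact hz' (mem_anc_of_between (f := (i + 1, j)) (b := (i + 1, r)) (by simp)
          (by simp; omega) (by simp) (by simp) h3 hz)
      · have := le_of_mem_anc hz; rw [h3] at this; simp at this; omega

end Invariant

/-! ### Adding one node, with amortized cost -/

section AddToTree

variable {d : ℕ} {I : Input d} {g : Node → ℝ≥0} {m n : ℕ}

/-- The memory `s'` results from `s` by making `v` a child of `p`. -/
structure Linked (v p : Node) (s s' : Mem) : Prop where
  nodeReg : s'.nodeReg = s.nodeReg
  natReg : s'.natReg = s.natReg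
  realField : s'.realField = s.realField
  out : s'.out = s.out
  parent : s'.nodeField .parent = Function.update (s.nodeField .parent) v p
  nodeField : ∀ f, f ≠ .parent → s'.nodeField f = s.nodeField f
  childrenV : s'.natField .children v = 0
  childrenP : s'.natField .children p = s.natField .children p + 1
  children : ∀ w, w ≠ v → w ≠ p → s'.natField .children w = s.natField .children w
  inTreeV : s'.natField .inTree v = 1
  inTree : ∀ w, w ≠ v → s'.natField .inTree w = s.natField .inTree w
  natField : ∀ f, f ≠ .children → f ≠ .inTree → s'.natField f = s.natField f

theorem WP_link {v p : Node} {s : Mem} (hv : s.nodeReg .g = v) (hp : s.nodeReg .p = p)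
    (hne : p ≠ v) : WP I link (fun t s' => t ≤ 12 ∧ Linked v p s s') s := by
  simp only [link, WP_block_cons, WP_block_nil, WP_storeNode, WP_storeNat, NodeExp.eval,
    NatExp.eval, NodeExp.cost, NatExp.cost, Mem.storeNode_proj, Mem.storeNat_proj, hv, hp]
  refine ⟨by omega, rfl, rfl, rfl, rfl, ?_, ?_, ?_, ?_, ?_, ?_, ?_, ?_⟩
  · simp
  · intro f hf; simp [hf]
  · simp [hne.symm]
  · simp [hne]
  · intro w h1 h2; simp [h1, h2]
  · simp
  · intro w h1; simp [h1]
  · intro f h1 h2; simp [h1, h2]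

/-- Without a removal the cost is constant. Removal and extension cost a constant plus an amount
proportional to the number of removed nodes, which the potential `1000 * removed` covers. -/
theorem WP_addToTree {i j : ℕ} {s : Mem} (hi : i < m) (hj : j < n) (hI : Inv g m n i j s)
    (ri : s.natReg .i = i + 1) (rj : s.natReg .j = j + 1) :
    WP I addToTree (fun t s' => Inv g m n i (j + 1) s' ∧ s'.natReg .i = i + 1 ∧
      s'.natReg .j = j + 1 ∧
      t + 1000 * removed g m n (i + 1) j ≤ 1000 + 1000 * removed g m n (i + 1) (j + 1)) s := by
  have hv0 : ((i + 1, j + 1) : Node) ≠ (0, 0) := by simp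
  have npres : ¬ Present m n (i + 1) j (i + 1, j + 1) := by unfold Present; dsimp only; omega
  have pres : ∀ {w}, Present m n (i + 1) (j + 1) w → w ≠ (i + 1, j + 1) →
      Present m n (i + 1) j w := fun h1 h2 => ((present_succ hi hj).1 h1).resolve_right h2
  have la := left_live (g := g) hi hj
  have lb := below_live (g := g) hi hj
  have lc := right_live (g := g) hi hj
  have hnl : (i + 1, j + 1) ∉ live g m n (i + 1) j := fun k => npres (present_of_live k)
  have fab := hI.face _ _ (Or.inl ⟨j, le_rfl, hj, rfl, rfl⟩)
  have fbc := hI.face _ _ (Or.inr (Or.inl ⟨rfl, rfl⟩))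
  -- The registers of this memory are made up: the geometric part of `Corner` is needed before the
  -- program has filled them.
  have geo : Corner g (i + 1, j + 1) (i, j + 1) (i, j) (i + 1, j)
      ⟨s.natReg, fun r => match r with
        | .g => (i + 1, j + 1) | .a => (i, j + 1) | .b => (i, j) | .c => (i + 1, j)
        | _ => par g (i + 1, j + 1), s.realReg, s.natField, s.nodeField, s.realField, s.out⟩ :=
    corner_mk rfl rfl rfl rfl rfl (hI.parent _ (present_of_live la) (by simp))
      (hI.parent _ (present_of_live lc) (by simp)) (hI.value _ hi.le hj) (hI.value _ hi hj.le)
      (hI.value _ hi hj)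
  have fab' : par g (i, j + 1) ≠ (i, j) → _ := fun h => fab (fun k => h (geo.ba k)) geo.ab
  have fbc' : par g (i + 1, j) ≠ (i, j) → _ := fun h => fbc geo.cb (fun k => h (geo.bc k))
  clear fab fbc
  simp only [addToTree, WP_block_cons, WP_block_nil, WP_setNode, WP_setNat, WP_storeNat,
    NodeExp.eval, NatExp.eval, NodeExp.cost, NatExp.cost, Mem.setNode_proj, ri, rj,
    Nat.add_sub_cancel]
  set s₁ := ((((s.setNode .g (i + 1, j + 1)).setNode .a (i, j + 1)).setNode .b (i, j)).setNode .c
    (i + 1, j)) with hs₁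
  refine (WP_chooseParent (g := g) (i := i) (j := j) (s := s₁) (by simp [hs₁]) (by simp [hs₁])
    (by simp [hs₁]) geo.parentA geo.parentC geo.valueA geo.valueC geo.ab geo.cb geo.ba geo.bc
    geo.between (fun h => (fab' h).1) (fun h => (fab' h).2) (fun h => (fbc' h).2)
    (fun h => (fbc' h).1)).mono ?_
  rintro t₂ s₂ ⟨ht₂, same, hsab, hsbc, hp⟩
  have hg2 : s₂.nodeReg .g = (i + 1, j + 1) := by
    rw [same.nodeReg _ (by decide) (by decide) (by decide)]; simp [hs₁]
  have hpne : par g (i + 1, j + 1) ≠ (i + 1, j + 1) := fun k =>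
    not_mem_anc_par (g := g) hv0 (by rw [k]; exact self_mem_anc _)
  refine (WP_link hg2 hp hpne).mono ?_
  rintro t₃ s₃ ⟨ht₃, lk⟩
  set s₄ := (s₃.setNat .dead 0).setNat .ext 0 with hs₄
  -- The memory when the dead path is about to be removed.
  have nr : ∀ r, r ≠ .dead → r ≠ .ext → s₄.natReg r = s.natReg r := fun r h1 h2 => by
    simp only [hs₄, Mem.setNat_proj, Function.update_of_ne h2, Function.update_of_ne h1]
    rw [lk.natReg, same.natReg]; rfl
  have par4 : s₄.nodeField .parent = Function.update (s.nodeField .parent) (i + 1, j + 1)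
      (par g (i + 1, j + 1)) := by
    have : s₄.nodeField = s₃.nodeField := rfl
    rw [this, lk.parent, same.nodeField]; rfl
  have nf4 : ∀ f, f ≠ .parent → s₄.nodeField f = s.nodeField f := fun f hf => by
    have : s₄.nodeField = s₃.nodeField := rfl
    rw [this, lk.nodeField f hf, same.nodeField]; rfl
  have rf4 : s₄.realField = s.realField := by
    have : s₄.realField = s₃.realField := rfl
    rw [this, lk.realField, same.realField]; rfl
  have out4 : s₄.out = [] := by
    have : s₄.out = s₃.out := rfl
    rw [this, lk.out, same.out]; exact hI.out
  have ntf4 : ∀ f, f ≠ .children → f ≠ .inTree → s₄.natField f = s.natField f := fun f h1 h2 => by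
    have : s₄.natField = s₃.natField := rfl
    rw [this, lk.natField f h1 h2, same.natField]; rfl
  have pa4 : ∀ z, Present m n (i + 1) (j + 1) z → z ≠ (0, 0) →
      s₄.nodeField .parent z = par g z := fun z hz h0 => by
    rw [par4]
    by_cases e : z = (i + 1, j + 1)
    · rw [e, Function.update_self]
    · rw [Function.update_of_ne e]; exact hI.parent z (pres hz e) h0
  have reg4 : ∀ r, s₄.nodeReg r = s₂.nodeReg r := fun r => by
    have : s₄.nodeReg = s₃.nodeReg := rfl
    rw [this, lk.nodeReg]
  have c4 : Corner g (i + 1, j + 1) (i, j + 1) (i, j) (i + 1, j) s₄ := by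
    have hr : ∀ r, r ≠ .sab → r ≠ .sbc → r ≠ .p → s₄.nodeReg r = s₁.nodeReg r :=
      fun r h1 h2 h3 => (reg4 r).trans (same.nodeReg r h1 h2 h3)
    refine corner_mk ?_ ?_ ?_ ?_ ((reg4 _).trans hp) ?_ ?_ ?_ ?_ ?_
    · rw [hr _ (by decide) (by decide) (by decide)]; simp [hs₁]
    · rw [hr _ (by decide) (by decide) (by decide)]; simp [hs₁]
    · rw [hr _ (by decide) (by decide) (by decide)]; simp [hs₁]
    · rw [hr _ (by decide) (by decide) (by decide)]; simp [hs₁]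
    · exact pa4 _ ((present_succ hi hj).2 (Or.inl (present_of_live la))) (by simp)
    · exact pa4 _ ((present_succ hi hj).2 (Or.inl (present_of_live lc))) (by simp)
    · rw [rf4]; exact geo.valueA
    · rw [rf4]; exact geo.valueC
    · rw [rf4]; exact geo.valueV
  have hpl : par g (i + 1, j + 1) ∈ live g m n (i + 1) j :=
    candidate_live hi hj (par_candidate i j)
  have tree4 : TreeMem g (added m n (i + 1) (j + 1))
      (insert (i + 1, j + 1) (live g m n (i + 1) j)) s₄ := by
    rw [added_succ hi hj]
    have e1 : s₄.natField = s₃.natField := rfl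
    have e2 : s₂.natField = s.natField := by rw [same.natField]; rfl
    refine hI.tree.insert hv0 hnl hpl ?_ ?_ ?_ ?_ ?_ ?_
    · intro w hw hw0 k
      exact hnl (anc_subset_live hw (k ▸ par_mem_anc hw0))
    · rw [e1, lk.childrenV]
    · rw [e1, lk.childrenP, e2]
    · intro w h1 h2; rw [e1, lk.children w h1 h2, e2]
    · rw [e1, lk.inTreeV]
    · intro w h1; rw [e1, lk.inTree w h1, e2]
  have f4ab : par g (i, j + 1) ≠ (i, j) →
      HalfFace g (s₄.nodeField .rightSink) (s₄.realField .rightMax) (i, j + 1) (i, j) ∧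
      HalfFace g (s₄.nodeField .leftSink) (s₄.realField .leftMax) (i, j) (i, j + 1) := by
    rw [nf4 _ (by decide), nf4 _ (by decide), rf4]; exact fab'
  have f4bc : par g (i + 1, j) ≠ (i, j) →
      HalfFace g (s₄.nodeField .rightSink) (s₄.realField .rightMax) (i, j) (i + 1, j) ∧
      HalfFace g (s₄.nodeField .leftSink) (s₄.realField .leftMax) (i + 1, j) (i, j) := by
    rw [nf4 _ (by decide), nf4 _ (by decide), rf4]; exact fbc'
  have ext4 : s₄.natReg .ext = 0 := by simp [hs₄]
  have su4 : ∀ R L : Node → Prop, SideUpd R L s s₄ := fun R L =>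
    .of_eq (nf4 _ (by decide)) (by rw [rf4]) (nf4 _ (by decide)) (by rw [rf4])
  -- The last part of the program, after the dead path has been removed.
  have finish : ∀ t₅ s₅, Corner g (i + 1, j + 1) (i, j + 1) (i, j) (i + 1, j) s₅ →
      s₅.nodeField .parent = s₄.nodeField .parent → s₅.realField .value = s₄.realField .value →
      s₅.out = s₄.out → s₅.natReg .i = s₄.natReg .i → s₅.natReg .j = s₄.natReg .j →
      (∀ f, f ≠ .children → f ≠ .inTree → s₅.natField f = s₄.natField f) →
      TreeMem g (added m n (i + 1) (j + 1)) (live g m n (i + 1) (j + 1)) s₅ →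
      Record g m n i j (s₅.natReg .dead) (s₅.natReg .ext) →
      SideUpd (fun z => z ∈ anc g (i, j + 1) ∧ z ∉ anc g (i, j))
        (fun z => z ∈ anc g (i + 1, j) ∧ z ∉ anc g (i, j)) s₄ s₅ →
      (par g (i, j + 1) ≠ (i, j) → par g (i + 1, j) ≠ (i, j) → par g (i + 1, j + 1) ≠ (i, j) →
        HalfFace g (s₅.nodeField .rightSink) (s₅.realField .rightMax) (i, j + 1) (i + 1, j) ∧
        HalfFace g (s₅.nodeField .leftSink) (s₅.realField .leftMax) (i + 1, j) (i, j + 1)) →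
      (par g (i, j + 1) ≠ (i, j) → (par g (i + 1, j) = (i, j) ∨ par g (i + 1, j + 1) = (i, j)) →
        HalfFace g (s₅.nodeField .rightSink) (s₅.realField .rightMax) (i, j + 1) (i, j) ∧
        HalfFace g (s₅.nodeField .leftSink) (s₅.realField .leftMax) (i, j) (i, j + 1)) →
      (par g (i + 1, j) ≠ (i, j) → (par g (i, j + 1) = (i, j) ∨ par g (i + 1, j + 1) = (i, j)) →
        HalfFace g (s₅.nodeField .rightSink) (s₅.realField .rightMax) (i, j) (i + 1, j) ∧
        HalfFace g (s₅.nodeField .leftSink) (s₅.realField .leftMax) (i + 1, j) (i, j)) →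
      t₅ + 1000 * removed g m n (i + 1) j ≤ 500 + 1000 * removed g m n (i + 1) (j + 1) →
      WP I makeShortcuts (fun t s' => Inv g m n i (j + 1) s' ∧ s'.natReg .i = i + 1 ∧
        s'.natReg .j = j + 1 ∧ t₅ + (t + 300) + 1000 * removed g m n (i + 1) j ≤
          1000 + 1000 * removed g m n (i + 1) (j + 1))
        ((s₅.storeNat .deadNodes (i + 1, j + 1) (s₅.natReg .dead)).storeNat .extensions
          (i + 1, j + 1) (s₅.natReg .ext)) := by
    intro t₅ s₅ c5 e1 e2 e3 e4 e5 e6 tr rec su h1 h2 h3 ht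
    set s₆ := (s₅.storeNat .deadNodes (i + 1, j + 1) (s₅.natReg .dead)).storeNat .extensions
          (i + 1, j + 1) (s₅.natReg .ext) with hs₆
    have c6 : Corner g (i + 1, j + 1) (i, j + 1) (i, j) (i + 1, j) s₆ :=
      c5.congr rfl rfl fun _ _ _ => rfl
    refine (WP_makeShortcuts c6 h1 h2 h3).mono ?_
    rintro t₇ s₇ ⟨hu, ht₇, k1, k2⟩
    have su56 : SideUpd (fun _ => False) (fun _ => False) s₅ s₆ := .of_eq rfl rfl rfl rfl
    have su7 : SideUpd (fun z => (z ∈ anc g (i, j + 1) ∧ z ∉ anc g (i, j)) ∨ z = (i + 1, j + 1))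
        (fun z => (z ∈ anc g (i + 1, j) ∧ z ∉ anc g (i, j)) ∨ z = (i + 1, j + 1)) s s₇ := by
      have hR : ∀ z, ¬ ((z ∈ anc g (i, j + 1) ∧ z ∉ anc g (i, j)) ∨ z = (i + 1, j + 1)) →
          ¬ ((((False ∨ (z ∈ anc g (i, j + 1) ∧ z ∉ anc g (i, j))) ∨ False) ∨
            ((z = (i, j + 1) ∧ par g (i, j + 1) = (i, j)) ∨ z = (i + 1, j + 1)))) := by
        intro z hz k
        rcases k with ((k | k) | k) | k | k
        · exact k
        · exact hz (Or.inl k)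
        · exact k
        · exact hz (Or.inl ⟨by rw [k.1]; exact self_mem_anc _, by rw [k.1]; exact c5.ab⟩)
        · exact hz (Or.inr k)
      have hL : ∀ z, ¬ ((z ∈ anc g (i + 1, j) ∧ z ∉ anc g (i, j)) ∨ z = (i + 1, j + 1)) →
          ¬ ((((False ∨ (z ∈ anc g (i + 1, j) ∧ z ∉ anc g (i, j))) ∨ False) ∨
            ((z = (i + 1, j) ∧ par g (i + 1, j) = (i, j)) ∨ z = (i + 1, j + 1)))) := by
        intro z hz k
        rcases k with ((k | k) | k) | k | k
        · exact k
        · exact hz (Or.inl k)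
        · exact k
        · exact hz (Or.inl ⟨by rw [k.1]; exact self_mem_anc _, by rw [k.1]; exact c5.cb⟩)
        · exact hz (Or.inr k)
      have su' := (((su4 (fun _ => False) (fun _ => False)).trans su).trans su56).trans hu.sideUpd
      exact ⟨fun z hz => su'.rightSink z (hR z hz), fun z hz => su'.rightMax z (hR z hz),
        fun z hz => su'.leftSink z (hL z hz), fun z hz => su'.leftMax z (hL z hz)⟩
    refine ⟨⟨?_, ?_, ?_, ?_, ?_, ?_⟩, ?_, ?_, by omega⟩
    · intro v h4 h5
      rw [hu.value]
      have : s₆.realField .value = s₅.realField .value := rfl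
      rw [this, e2, rf4]
      exact hI.value v h4 h5
    · intro v h4 h5
      rw [hu.parent]
      have : s₆.nodeField .parent = s₅.nodeField .parent := rfl
      rw [this, e1]
      exact pa4 v h4 h5
    · refine ⟨?_, ?_⟩
      · rw [hu.natField]; simpa [hs₆] using tr.children
      · rw [hu.natField]; simpa [hs₆] using tr.inTree
    · refine face_of_sideUpd hI su7 (fun _ h4 => k1 fun k => h4 ?_) (fun h4 _ => k2 fun k => h4 ?_)
      · have := par_mem_anc (g := g) hv0; rwa [k] at this
      · have := par_mem_anc (g := g) hv0; rwa [k] at this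
    · rw [hu.out]
      have : s₆.out = s₅.out := rfl
      rw [this, e3, out4]
    · intro i' j' hi' hj' hP
      rw [hu.natField]
      by_cases e : ((i' + 1, j' + 1) : Node) = (i + 1, j + 1)
      · rw [Prod.ext_iff] at e
        simp only [Nat.add_right_cancel_iff] at e
        obtain ⟨rfl, rfl⟩ := e
        simpa [hs₆] using rec
      · have := hI.record i' j' hi' hj' (pres hP e)
        simp only [hs₆, Mem.storeNat_proj, Function.update_self, Function.update_of_ne e, ne_eq,
          reduceCtorEq, not_false_eq_true, Function.update_of_ne]
        rwa [e6 _ (by decide) (by decide), e6 _ (by decide) (by decide),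
          ntf4 _ (by decide) (by decide), ntf4 _ (by decide) (by decide)]
    · rw [hu.natReg _ (by decide)]
      have : s₆.natReg = s₅.natReg := rfl
      rw [this, e4, nr _ (by decide) (by decide), ri]
    · rw [hu.natReg _ (by decide)]
      have : s₆.natReg = s₅.natReg := rfl
      rw [this, e5, nr _ (by decide) (by decide), rj]
  -- Only the three upper and right neighbours can be children of `(i, j)`, and all of them are in
  -- the tree by now.
  have test : s₄.natField .children (i, j) = 0 ↔ par g (i, j + 1) ≠ (i, j) ∧
      par g (i + 1, j) ≠ (i, j) ∧ par g (i + 1, j + 1) ≠ (i, j) := by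
    rw [tree4.children _ (Finset.mem_insert_of_mem lb), Finset.card_eq_zero,
      Finset.filter_eq_empty_iff]
    constructor
    · intro h
      exact ⟨fun k => h (Finset.mem_insert_of_mem la) ⟨by simp, k⟩,
        fun k => h (Finset.mem_insert_of_mem lc) ⟨by simp, k⟩,
        fun k => h (Finset.mem_insert_self _ _) ⟨by simp, k⟩⟩
    · rintro ⟨h1, h2, h3⟩ w _ ⟨hw0, hwp⟩
      have := step_par (g := g) hw0
      rw [hwp] at this
      rcases this with rfl | rfl | rfl
      · exact h2 hwp
      · exact h1 hwp
      · exact h3 hwp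
  simp only [WP_ite, WP_skip, BoolExp.eval, NatExp.eval, BoolExp.cost, NatExp.cost, c4.regB]
  constructor
  · intro h
    obtain ⟨h1, h2, h3⟩ := test.1 h
    refine (WP_removal (A := added m n (i + 1) (j + 1)) c4
      ((anc_subset_live la).trans (Finset.subset_insert _ _))
      ((anc_subset_live lc).trans (Finset.subset_insert _ _))
      ((anc_subset_live lb).trans (Finset.subset_insert _ _))
      (fun x hx hxa hxc w hw hw0 hwx => child_mem_anc hi hj h3 hx hxa hxc hw hw0 hwx) tree4
      (by rw [reg4]; exact hsab) (by rw [reg4]; exact hsbc) (by simp only; omega)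
      (by simp only; omega) ?_ (f4ab h1).1 (f4ab h1).2 (f4bc h2).2 (f4bc h2).1).mono ?_
    · intro z hz h0
      refine pa4 z ?_ h0
      rcases Finset.mem_insert.1 hz with k | k
      · exact (present_succ hi hj).2 (Or.inr k)
      · exact (present_succ hi hj).2 (Or.inl (present_of_live k))
    · rintro t₅ s₅ ⟨c5, e1, e2, e3, e4, e5, e6, tr, hd, he, su, f1, f2, ht⟩
      rw [← live_succ_of_childless hi hj h3] at tr
      rw [ext4, zero_add] at he
      have hrec := record_of_childless hi hj h1 h2 h3 he
      rw [← hd] at hrec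
      have hrm := removed_succ_of_childless hi hj h3
      simp only [Mem.storeNat_proj, c5.regG]
      refine (finish t₅ s₅ c5 e1 e2 e3 e4 e5 e6 tr hrec su (fun _ _ _ => ⟨f1, f2⟩)
        (fun _ k => (k.elim h2 h3).elim) (fun _ k => (k.elim h1 h3).elim) (by omega)).mono ?_
      rintro t s' ⟨q1, q2, q3, q4⟩
      exact ⟨q1, q2, q3, by omega⟩
  · intro h
    have h' : par g (i, j + 1) = (i, j) ∨ par g (i + 1, j) = (i, j) ∨
        par g (i + 1, j + 1) = (i, j) := by
      by_contra k
      rw [not_or, not_or] at k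
      exact h (test.2 k)
    have hrm := removed_succ_of_child hi hj h'
    have tr := tree4
    rw [← live_succ_of_child hi hj h'] at tr
    have hrec : Record g m n i j (s₄.natReg .dead) (s₄.natReg .ext) := by
      rw [ext4]; exact record_of_child hi hj h'
    simp only [Mem.storeNat_proj, c4.regG]
    -- With a child of `(i, j)` left, no faces merge: that hypothesis is void, and the old faces
    -- serve unchanged.
    refine (finish 0 s₄ c4 rfl rfl rfl rfl rfl (fun _ _ _ => rfl) tr hrec
      (.of_eq rfl rfl rfl rfl) (fun k1 k2 k3 => (h'.elim k1 fun q => q.elim k2 k3).elim)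
      (fun k _ => f4ab k) (fun k _ => f4bc k) (by omega)).mono ?_
    rintro t s' ⟨q1, q2, q3, q4⟩
    exact ⟨q1, q2, q3, by omega⟩

end AddToTree

/-! ### The phases of the program and the total time -/

section Program

variable {d : ℕ} {I : Input d} {g : Node → ℝ≥0} {m n : ℕ}

theorem WP_constructGrid (hm : I.m = m) (hn : I.n = n) (hg : ∀ v, I.grid v = g v) {s : Mem}
    (hout : s.out = []) :
    WP I constructGrid (fun t s' => t ≤ (d + 50) * ((m + 1) * (n + 1)) ∧
      (∀ v : Node, v.1 ≤ m → v.2 ≤ n → s'.realField .value v = g v) ∧ s'.out = []) s := by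
  unfold constructGrid
  refine (WP_forLoop (lo := .lit 0) (hi := .m) 0 m (fun _ => rfl) (fun _ => hm) rfl rfl (by omega)
    (fun k s => (∀ v : Node, v.1 < k → v.2 ≤ n → s.realField .value v = g v) ∧ s.out = [])
    -- An inner round costs `d + 9`, with 9 more for the loop; 7 is the fixed cost of the inner
    -- loop.
    (fun k => k * ((d + 18) * (n + 1) + 7)) (fun k s x h => h) ?_ s
    ⟨fun v h => by omega, hout⟩).mono ?_
  · rintro k s - - ⟨hv, ho⟩ hk
    refine (WP_forLoop (lo := .lit 0) (hi := .n) 0 n (fun _ => rfl) (fun _ => hn) rfl rfl (by omega)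
      (fun l s => (∀ v : Node, v.1 < k ∨ (v.1 = k ∧ v.2 < l) → v.2 ≤ n →
        s.realField .value v = g v) ∧ s.out = [] ∧ s.natReg .i = k)
      (fun l => l * (d + 9)) ?_ ?_ s ⟨fun v h => hv v (by omega), ho, hk⟩).mono ?_
    · rintro l s x ⟨h1, h2, h3⟩
      exact ⟨h1, h2, by simpa using h3⟩
    · rintro l s - - ⟨h1, h2, h3⟩ h4
      simp only [WP_block_cons, WP_block_nil, WP_setNode, WP_storeReal, NodeExp.eval, NatExp.eval,
        RealExp.eval, NodeExp.cost, NatExp.cost, RealExp.cost, Mem.setNode_proj,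
        Mem.storeReal_proj, Function.update_self, h3, h4, hg]
      refine ⟨⟨fun v h5 h6 => ?_, h2, trivial⟩, trivial, ?_⟩
      · by_cases e : v = (k, l)
        · subst e; simp
        · rw [Function.update_of_ne e]
          refine h1 v ?_ h6
          rw [Prod.ext_iff] at e
          simp only at e
          omega
      · rw [add_mul]; omega
    · rintro t s' ⟨⟨h1, h2, h3⟩, ht⟩
      refine ⟨⟨fun v h5 h6 => h1 v (by omega) h6, h2⟩, h3, ?_⟩
      rw [add_mul k 1]
      have : (d + 18) * (n + 1) = (n + 1) * (d + 9) + 9 * (n + 1) := by ring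
      simp only [zero_mul, Nat.sub_zero] at ht
      omega
  · rintro t s' ⟨⟨h1, h2⟩, ht⟩
    refine ⟨?_, fun v h5 h6 => h1 v (by omega) h6, h2⟩
    simp only [zero_mul, Nat.sub_zero] at ht
    nlinarith [Nat.zero_le (m * n), Nat.zero_le m, Nat.zero_le n]

/-- The first nodes of the bottom row and of the leftmost column. -/
def border (k l : ℕ) : Finset Node :=
  (Finset.range k).image (fun x => (x, 0)) ∪ (Finset.range l).image (fun y => (0, y))

theorem mem_border {k l : ℕ} {v : Node} :
    v ∈ border k l ↔ (v.1 < k ∧ v.2 = 0) ∨ (v.2 < l ∧ v.1 = 0) := by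
  unfold border
  simp only [Finset.mem_union, Finset.mem_image, Finset.mem_range, Prod.ext_iff]
  constructor
  · rintro (⟨x, h1, h2, h3⟩ | ⟨x, h1, h2, h3⟩)
    · exact Or.inl ⟨by omega, by omega⟩
    · exact Or.inr ⟨by omega, by omega⟩
  · rintro (⟨h1, h2⟩ | ⟨h1, h2⟩)
    · exact Or.inl ⟨v.1, h1, rfl, h2.symm⟩
    · exact Or.inr ⟨v.2, h1, h2.symm, rfl⟩

theorem mem_anc_row {x : ℕ} : ∀ {y : ℕ}, x ≤ y → (x, 0) ∈ anc g (y, 0) := by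
  intro y h
  induction y with
  | zero => rw [Nat.le_zero.1 h]; exact self_mem_anc _
  | succ y ih =>
    by_cases e : x = y + 1
    · rw [e]; exact self_mem_anc _
    · rw [mem_anc_iff (by simp), par]
      exact Or.inr (ih (by omega))

theorem mem_anc_column {x : ℕ} : ∀ {y : ℕ}, x ≤ y → (0, x) ∈ anc g (0, y) := by
  intro y h
  induction y with
  | zero => rw [Nat.le_zero.1 h]; exact self_mem_anc _
  | succ y ih =>
    by_cases e : x = y + 1
    · rw [e]; exact self_mem_anc _
    · rw [mem_anc_iff (by simp), par]
      exact Or.inr (ih (by omega))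

theorem border_eq_added : border (m + 1) (n + 1) = added m n 1 0 := by
  ext v
  rw [mem_border, mem_added]
  unfold Present
  omega

/-- The bottom row leads to `(m, 0)` and the left column to `(0, n)`, and the diagonal neighbours of
these two are outside the box. -/
theorem border_eq_live : border (m + 1) (n + 1) = live g m n 1 0 := by
  refine Finset.Subset.antisymm (fun v hv => ?_) fun v hv => ?_
  · rw [mem_border] at hv
    rw [mem_live]
    rcases hv with ⟨h1, h2⟩ | ⟨h1, h2⟩
    · refine ⟨(m, 0), ?_, ?_, ?_⟩
      · unfold Present; dsimp only; omega
      · have e : v = (v.1, 0) := Prod.ext rfl h2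
        rw [e]; exact mem_anc_row (by omega)
      · unfold Present; dsimp only; omega
    · refine ⟨(0, n), ?_, ?_, ?_⟩
      · unfold Present; dsimp only; omega
      · have e : v = (0, v.2) := Prod.ext h2 rfl
        rw [e]; exact mem_anc_column (by omega)
      · unfold Present; dsimp only; omega
  · rw [border_eq_added, mem_added]; exact present_of_live hv

/-- The memory while the bottom row and the leftmost column are added. -/
structure BorderMem (g : Node → ℝ≥0) (m n k l : ℕ) (s : Mem) : Prop where
  value : ∀ v : Node, v.1 ≤ m → v.2 ≤ n → s.realField .value v = g v
  parent : ∀ v ∈ border k l, v ≠ (0, 0) → s.nodeField .parent v = par g v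
  tree : TreeMem g (border k l) (border k l) s
  out : s.out = []

theorem BorderMem.congr {k l : ℕ} {s s' : Mem} (h : BorderMem g m n k l s)
    (h1 : s'.natField = s.natField) (h2 : s'.nodeField = s.nodeField)
    (h3 : s'.realField = s.realField) (h4 : s'.out = s.out) : BorderMem g m n k l s' := by
  refine ⟨?_, ?_, ⟨?_, ?_⟩, h4.trans h.out⟩
  · rw [h3]; exact h.value
  · rw [h2]; exact h.parent
  · rw [h1]; exact h.tree.children
  · rw [h1]; exact h.tree.inTree

theorem BorderMem.linked {k l k' l' : ℕ} {s s' : Mem} {v p : Node} (h : BorderMem g m n k l s)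
    (hb : border k' l' = insert v (border k l)) (hv : v ≠ (0, 0)) (hvn : v ∉ border k l)
    (hpar : par g v = p) (hp : p ∈ border k l)
    (hl : Linked v p s s') : BorderMem g m n k' l' s' := by
  subst hpar
  refine ⟨?_, ?_, ?_, hl.out.trans h.out⟩
  · rw [hl.realField]; exact h.value
  · intro w hw hw0
    rw [hl.parent]
    by_cases e : w = v
    · rw [e, Function.update_self]
    · rw [Function.update_of_ne e]
      rw [hb] at hw
      exact h.parent w ((Finset.mem_insert.1 hw).resolve_left e) hw0
  · rw [hb]
    refine h.tree.insert hv hvn hp (fun w hw hw0 e => hvn ?_) hl.childrenV hl.childrenP hl.children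
      hl.inTreeV hl.inTree
    rw [mem_border] at hw ⊢
    have := par_le (g := g) w
    rw [e] at this
    omega

theorem WP_initTree (hm : I.m = m) (hn : I.n = n) {s : Mem} (hout : s.out = [])
    (hval : ∀ v : Node, v.1 ≤ m → v.2 ≤ n → s.realField .value v = g v) :
    WP I initTree (fun t s' => t ≤ 200 * ((m + 1) * (n + 1)) ∧ Inv g m n 0 0 s') s := by
  simp only [initTree, WP_block_cons, WP_block_nil, WP_setNode, WP_storeNat, NodeExp.eval,
    NatExp.eval, NodeExp.cost, NatExp.cost, Mem.setNode_proj, Mem.storeNat_proj,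
    Function.update_self]
  have b1 : border 1 1 = {(0, 0)} := by
    ext v; rw [mem_border, Finset.mem_singleton, Prod.ext_iff]; simp only; omega
  have row : ∀ k, par g (k + 1, 0) = (k, 0) := fun k => by rw [par]
  have column : ∀ k, par g (0, k + 1) = (0, k) := fun k => by rw [par]
  refine (WP_forLoop (lo := .lit 1) (hi := .m) 1 m (fun _ => rfl) (fun _ => hm) rfl rfl (by omega)
    (fun k s => BorderMem g m n k 1 s) (fun k => k * 30)
    (fun k s x h => h.congr rfl rfl rfl rfl) ?_ _ ?_).mono ?_
  · rintro k s h1 h2 hk hr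
    obtain ⟨k, rfl⟩ : ∃ k', k = k' + 1 := ⟨k - 1, by omega⟩
    simp only [WP_block_cons, WP_block_nil, WP_setNode, NodeExp.eval, NatExp.eval, NodeExp.cost,
      NatExp.cost, Mem.setNode_proj, hr, Nat.add_sub_cancel]
    refine (WP_link (v := (k + 1, 0)) (p := (k, 0)) (by simp) (by simp) (by simp)).mono ?_
    rintro t s' ⟨ht, hl⟩
    have hk' : BorderMem g m n (k + 1) 1
      ((s.setNode .g (k + 1, 0)).setNode .p (k, 0)) := hk.congr rfl rfl rfl rfl
    refine ⟨hk'.linked ?_ (by simp) ?_ (row k) ?_ hl, ?_, by omega⟩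
    · ext v
      rw [Finset.mem_insert, mem_border, mem_border, Prod.ext_iff]; simp only; omega
    · rw [mem_border]; simp
    · rw [mem_border]; simp
    · rw [hl.natReg]; exact hr
  · refine ⟨hval, ?_, ⟨?_, ?_⟩, hout⟩
    · intro v hv hv0
      rw [b1, Finset.mem_singleton] at hv
      exact absurd hv hv0
    · intro v hv
      rw [b1, Finset.mem_singleton] at hv
      subst hv
      simp [b1, Finset.filter_singleton]
    · intro v hv
      rw [b1, Finset.mem_singleton] at hv
      subst hv
      simp [b1]
  rintro t₁ s₁ ⟨h₁, ht₁⟩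
  refine (WP_forLoop (lo := .lit 1) (hi := .n) 1 n (fun _ => rfl) (fun _ => hn) rfl rfl (by omega)
    (fun k s => BorderMem g m n (m + 1) k s) (fun k => k * 30)
    (fun k s x h => h.congr rfl rfl rfl rfl) ?_ _ h₁).mono ?_
  · rintro k s h1 h2 hk hr
    obtain ⟨k, rfl⟩ : ∃ k', k = k' + 1 := ⟨k - 1, by omega⟩
    simp only [WP_block_cons, WP_block_nil, WP_setNode, NodeExp.eval, NatExp.eval, NodeExp.cost,
      NatExp.cost, Mem.setNode_proj, hr, Nat.add_sub_cancel]
    refine (WP_link (v := (0, k + 1)) (p := (0, k)) (by simp) (by simp) (by simp)).mono ?_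
    rintro t s' ⟨ht, hl⟩
    have hk' : BorderMem g m n (m + 1) (k + 1)
      ((s.setNode .g (0, k + 1)).setNode .p (0, k)) := hk.congr rfl rfl rfl rfl
    refine ⟨hk'.linked ?_ (by simp) ?_ (column k) ?_ hl, ?_, by omega⟩
    · ext v
      rw [Finset.mem_insert, mem_border, mem_border, Prod.ext_iff]; simp only; omega
    · rw [mem_border]; simp
    · rw [mem_border]; simp
    · rw [hl.natReg]; exact hr
  rintro t₂ s₂ ⟨h₂, ht₂⟩
  refine ⟨?_, h₂.value, ?_, ?_, ?_, h₂.out, ?_⟩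
  · have : (m + 1) * (n + 1) = m * n + m + n + 1 := by ring
    omega
  · intro v hv hv0
    rw [← mem_added, ← border_eq_added] at hv
    exact h₂.parent v hv hv0
  · rw [← border_eq_added, ← border_eq_live]; exact h₂.tree
  -- All neighbouring pairs on the border consist of a parent and a child, so there is no face yet.
  · rintro f f' (⟨r, -, -, rfl, rfl⟩ | ⟨rfl, rfl⟩ | ⟨r, h, -⟩) hf hf'
    · exact absurd (mem_anc_column (by omega)) hf
    · exact absurd (mem_anc_row (by omega)) hf'
    · omega
  · intro i' j' _ _ h
    unfold Present at h; simp only at h; omega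

theorem Inv.congr {i j : ℕ} {s s' : Mem} (h : Inv g m n i j s)
    (h1 : s'.natField = s.natField) (h2 : s'.nodeField = s.nodeField)
    (h3 : s'.realField = s.realField) (h4 : s'.out = s.out) : Inv g m n i j s' := by
  refine ⟨?_, ?_, ⟨?_, ?_⟩, ?_, h4.trans h.out, ?_⟩
  · rw [h3]; exact h.value
  · rw [h2]; exact h.parent
  · rw [h1]; exact h.tree.children
  · rw [h1]; exact h.tree.inTree
  · rw [h2, h3]; exact h.face
  · rw [h1]; exact h.record

/-- Only the description changes: the pairs in the finished column become the old column, and the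
pair in the bottom row is a parent and its child. -/
theorem Inv.next {i : ℕ} {s : Mem} (h : Inv g m n i n s) : Inv g m n (i + 1) 0 s := by
  refine ⟨h.value, fun v hv => h.parent v (present_next.2 hv), ?_, ?_, h.out,
    fun i' j' hi hj hp => h.record i' j' hi hj (present_next.2 hp)⟩
  · rw [added_next, live_next]; exact h.tree
  · rintro f f' (⟨r, -, hr, rfl, rfl⟩ | ⟨rfl, rfl⟩ | ⟨r, hr, -⟩) hf hf'
    · exact h.face _ _ (Or.inr (Or.inr ⟨r, hr, rfl, rfl⟩)) hf hf'
    · exact absurd (mem_anc_row (by omega)) hf'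
    · omega

theorem removed_next {i : ℕ} : removed g m n (i + 2) 0 = removed g m n (i + 1) n := by
  unfold removed; rw [added_next, live_next]

theorem removed_le {i j : ℕ} : removed g m n i j ≤ (m + 1) * (n + 1) := by
  classical
  refine (Finset.card_le_card (t := Finset.range (m + 1) ×ˢ Finset.range (n + 1))
    (Finset.sdiff_subset.trans (Finset.filter_subset _ _))).trans ?_
  rw [Finset.card_product, Finset.card_range, Finset.card_range]

theorem WP_growTree (hm : I.m = m) (hn : I.n = n) {s : Mem} (hI : Inv g m n 0 0 s) :
    WP I (forLoop .i (.lit 1) .m (forLoop .j (.lit 1) .n addToTree))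
      (fun t s' => t ≤ 3000 * ((m + 1) * (n + 1)) ∧ Inv g m n m 0 s') s := by
  refine (WP_forLoop (lo := .lit 1) (hi := .m) 1 m (fun _ => rfl) (fun _ => hm) rfl rfl (by omega)
    -- `Inv` with index `i` concerns column `i + 1`, hence `k - 1`. In the time bound, 1009 is the
    -- amortized cost of a node plus the loop overhead 9, and 7 is the fixed cost of the inner loop.
    (fun k s => Inv g m n (k - 1) 0 s)
    (fun k => k * (1009 * n + 7) + 1000 * removed g m n k 0)
    (fun k s x h => h.congr rfl rfl rfl rfl) ?_ s hI).mono ?_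
  · rintro k s h1 hk hI hr
    obtain ⟨i, rfl⟩ : ∃ i, k = i + 1 := ⟨k - 1, by omega⟩
    refine (WP_forLoop (lo := .lit 1) (hi := .n) 1 n (fun _ => rfl) (fun _ => hn) rfl rfl
      (by omega) (fun l s => Inv g m n i (l - 1) s ∧ s.natReg .i = i + 1)
      (fun l => 1000 * l + 1000 * removed g m n (i + 1) (l - 1)) ?_ ?_ s ⟨hI, hr⟩).mono ?_
    · rintro l s x ⟨h1, h2⟩
      exact ⟨h1.congr rfl rfl rfl rfl, by simpa using h2⟩
    · rintro l s h1 hl ⟨hI, hi⟩ hj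
      obtain ⟨j, rfl⟩ : ∃ j, l = j + 1 := ⟨l - 1, by omega⟩
      simp only [Nat.add_sub_cancel] at hI ⊢
      refine (WP_addToTree (by omega) (by omega) hI hi hj).mono ?_
      rintro t s' ⟨h3, h4, h5, h6⟩
      exact ⟨⟨h3, h4⟩, h5, by omega⟩
    · rintro t s' ⟨⟨h3, h4⟩, h5⟩
      simp only [Nat.add_sub_cancel, Nat.sub_self] at h3 h5 ⊢
      refine ⟨h3.next, h4, ?_⟩
      rw [removed_next, add_mul (i + 1) 1]
      omega
  · rintro t s' ⟨h3, h4⟩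
    simp only [Nat.add_sub_cancel] at h3 h4
    refine ⟨?_, h3⟩
    have h5 := removed_le (g := g) (m := m) (n := n) (i := m + 1) (j := 0)
    have h6 : (m + 1) * (1009 * n + 7) = 1009 * (m * n) + 7 * m + 1009 * n + 7 := by ring
    have h7 : (m + 1) * (n + 1) = m * n + m + n + 1 := by ring
    omega

/-- Nodes are put in front of the output, so it is always a tree path from register `x` to `(m, n)`;
the coordinate sum of `x` bounds the number of rounds. -/
theorem WP_outputPath (hm : I.m = m) (hn : I.n = n) {s : Mem} (hout : s.out = [])
    (hpar : ∀ v : Node, v.1 ≤ m → v.2 ≤ n → v ≠ (0, 0) → s.nodeField .parent v = par g v) :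
    WP I outputPath (fun t s' => t ≤ 30 * ((m + 1) * (n + 1)) ∧ s'.natField = s.natField ∧
      s'.nodeField = s.nodeField ∧ IsPathIn (treeOf m n (par g)) s'.out (0, 0) (m, n)) s := by
  simp only [outputPath, WP_block_cons, WP_block_nil, WP_setNode, WP_emit, NodeExp.eval,
    NatExp.eval, NodeExp.cost, NatExp.cost, Mem.setNode_proj, Function.update_self, hm, hn]
  refine (WP_while (fun s' => s'.natField = s.natField ∧ s'.nodeField = s.nodeField ∧
    IsPathIn (treeOf m n (par g)) s'.out (s'.nodeReg .x) (m, n)) (fun s' => (s'.nodeReg .x).1 +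
      (s'.nodeReg .x).2) 5 ?_ _ ?_).mono ?_
  · rintro s' ⟨h1, h2, h3⟩ hb
    simp only [BoolExp.eval, NodeExp.eval, NatExp.eval] at hb
    set x := s'.nodeReg .x with hx
    have hle := le_of_mem_anc (toFinset_tail_of_treePath _ h3).1
    have hp := hpar x hle.1 hle.2 hb
    simp only [WP_block_cons, WP_block_nil, WP_setNode, WP_emit, NodeExp.eval, NodeExp.cost,
      Mem.setNode_proj, Function.update_self, ← hx, h1, h2, hp]
    refine ⟨⟨trivial, trivial, ?_, rfl, ?_⟩, ?_, le_rfl⟩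
    · rw [List.isChain_cons]
      refine ⟨fun y hy => ?_, h3.1⟩
      rw [h3.2.1, Option.mem_some_iff] at hy
      subst hy
      exact ⟨hle.1, hle.2, hb, rfl⟩
    · obtain ⟨l, hl⟩ : ∃ l, s'.out = x :: l := by
        cases h : s'.out with
        | nil => rw [h] at h3; simp [IsPathIn] at h3
        | cons y l =>
          have := h3.2.1
          rw [h, List.head?_cons, Option.some.injEq] at this
          exact ⟨l, by rw [this]⟩
      have := h3.2.2
      rw [hl] at this ⊢
      rw [List.getLast?_cons_cons]; exact this
    · have := par_cases (g := g) hb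
      omega
  · simp only [Function.update_self, hout]
    exact ⟨trivial, trivial, List.isChain_singleton _, rfl, rfl⟩
  · rintro t s' ⟨⟨h1, h2, h3⟩, hb, ht⟩
    simp only [BoolExp.eval, NodeExp.eval, NatExp.eval, not_not] at hb
    rw [hb] at h3
    simp only [Function.update_self, BoolExp.cost, NodeExp.cost, NatExp.cost] at ht
    refine ⟨?_, h1, h2, h3⟩
    have h7 : (m + 1) * (n + 1) = m * n + m + n + 1 := by ring
    omega

theorem WP_computeDiscreteLCFM (hm : I.m = m) (hn : I.n = n) (hg : ∀ v, I.grid v = g v) {s : Mem}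
    (hout : s.out = []) :
    WP I computeDiscreteLCFM (fun t s' => t ≤ (d + 4000) * ((m + 1) * (n + 1)) ∧
      IsPathIn (treeOf m n (par g)) s'.out (0, 0) (m, n) ∧
      ∃ s₁, Inv g m n m 0 s₁ ∧ s'.natField = s₁.natField ∧ s'.nodeField = s₁.nodeField) s := by
  simp only [computeDiscreteLCFM, WP_block_cons, WP_block_nil]
  refine (WP_constructGrid hm hn hg hout).mono ?_
  rintro t₁ s₁ ⟨ht₁, hval, hout₁⟩
  refine (WP_initTree hm hn hout₁ hval).mono ?_
  rintro t₂ s₂ ⟨ht₂, hI₂⟩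
  refine (WP_growTree hm hn hI₂).mono ?_
  rintro t₃ s₃ ⟨ht₃, hI₃⟩
  refine (WP_outputPath hm hn hI₃.out fun v h1 h2 h3 => hI₃.parent v ?_ h3).mono ?_
  · unfold Present; omega
  rintro t₄ s₄ ⟨ht₄, h1, h2, h3⟩
  refine ⟨?_, h3, s₃, hI₃, h1, h2⟩
  have h4 : 1 ≤ (m + 1) * (n + 1) := Nat.mul_pos (Nat.succ_pos _) (Nat.succ_pos _)
  rw [add_mul] at ht₁ ⊢
  omega

theorem present_all {v : Node} : Present m n (m + 1) 0 v ↔ v.1 ≤ m ∧ v.2 ≤ n := by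
  unfold Present; omega

/-- Nodes that are removed at some time do not come back. -/
theorem mem_live_of_mem_live_all {i j : ℕ} {v : Node} (hv : Present m n i j v)
    (h : v ∈ live g m n (m + 1) 0) : v ∈ live g m n i j := by
  -- On the path from `v` to an absent descendant, the parent of the first absent node is present,
  -- while its diagonal neighbour, which dominates that absent node, is not.
  have key : ∀ w, v ∈ anc g w → ¬ Present m n i j w → v ∈ live g m n i j := by
    refine par_induction (g := g) ?_ ?_
    · intro h1 h2
      have := le_of_mem_anc h1
      exact absurd hv fun k => h2 ⟨Nat.zero_le _, Nat.zero_le _, Or.inl rfl⟩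
    · intro w hw ih h1 h2
      have h3 := mem_par_of_ne h1 fun e => h2 (e ▸ hv)
      by_cases h4 : Present m n i j (par g w)
      · refine mem_live.2 ⟨_, h4, h3, fun k => h2 (present_of_le k ?_ ?_)⟩ <;>
          · have := par_cases (g := g) hw
            simp only; omega
      · exact ih h3 h4
  obtain ⟨w, h1, h2, h3⟩ := mem_live.1 h
  rw [present_all] at h1 h3
  by_cases h4 : Present m n i j w
  · refine mem_live.2 ⟨w, h4, h2, fun k => h3 ⟨k.1, k.2.1⟩⟩
  · exact key w h2 h4

end Program

end DiscreteFrechet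

/-! ### The main theorem -/

theorem theorem3 (d : ℕ) :
    ∃ C : ℕ, ∀ (m n : ℕ) (P : Fin (m + 1) → EuclideanSpace ℝ (Fin d))
      (Q : Fin (n + 1) → EuclideanSpace ℝ (Fin d)) (s₀ : Mem), s₀.out = [] →
      ∃ (t : ℕ) (s : Mem),
        -- the run of the algorithm, in O(mn) steps
        Exec (Input.mk m n P Q) computeDiscreteLCFM s₀ t s ∧
        t ≤ C * (max m 1 * max n 1) ∧
        ∃ (G : Node → ℝ) (T : Node → Node → Prop),
          G = (Input.mk m n P Q).grid ∧ T = treeOf m n (s.nodeField .parent) ∧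
          -- the output is a locally correct discrete Fréchet matching, and a path of the tree
          IsFrechetMatching G m n s.out ∧
          LocallyCorrect G s.out ∧
          IsPathIn T s.out (0, 0) (m, n) ∧
          (∀ v ∈ s.out, s.natField .inTree v = 1) ∧
          -- every path of the tree is a strongly locally correct monotonous path
          (∀ l u v, IsPathIn T l u v → IsPath l u v ∧ StronglyLocallyCorrect G l) ∧
          -- choice of the parents
          (∀ i < m, s.nodeField .parent (i + 1, 0) = (i, 0)) ∧
          (∀ j < n, s.nodeField .parent (0, j + 1) = (0, j)) ∧
          (∀ i < m, ∀ j < n,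
            IsParentChoice T G i j (s.nodeField .parent (i + 1, j + 1))) ∧
          -- dead paths: extensions of shortcuts while `(i + 1, j + 1)` is added
          (∀ i < m, ∀ j < n,
            (¬ Removable m n T (i + 1) (j + 1) (i, j) →
              s.natField .extensions (i + 1, j + 1) = 0) ∧
            (Removable m n T (i + 1) (j + 1) (i, j) →
              ∃ l, IsDeadPath m n T (i + 1) (j + 1) l (i, j) ∧
                (∀ v ∈ l.tail, s.natField .inTree v = 0) ∧
                s.natField .deadNodes (i + 1, j + 1) = l.length ∧
                s.natField .extensions (i + 1, j + 1) ≤ 2 * l.length - 1)) := by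
  -- The factor 4 passes from `(m + 1) * (n + 1)` to `max m 1 * max n 1`.
  refine ⟨4 * (d + 4000), fun m n P Q s₀ h₀ => ?_⟩
  -- Indices out of range are reduced as in `Input.grid`, so the infinite grid has values everywhere
  -- and agrees with the input by definition.
  let g : Node → NNReal := fun v =>
    nndist (P (Fin.ofNat (m + 1) v.1)) (Q (Fin.ofNat (n + 1) v.2))
  have hgrid : (Input.mk m n P Q).grid = fun v => (g v : ℝ) := funext fun v => rfl
  obtain ⟨t, s, hex, ht, hout, s₁, hI, e1, e2⟩ := WP_computeDiscreteLCFM (I := Input.mk m n P Q)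
    (g := g) (m := m) (n := n) rfl rfl (fun v => rfl) h₀
  have hpar : ∀ v : Node, v.1 ≤ m → v.2 ≤ n → v ≠ (0, 0) → s.nodeField .parent v = par g v :=
    fun v h1 h2 => by rw [e2]; exact hI.parent v (present_all.2 ⟨h1, h2⟩)
  -- Parent fields of the root and of nodes outside the box are arbitrary, but `treeOf` ignores
  -- them.
  have hT : treeOf m n (s.nodeField .parent) = treeOf m n (par g) := by
    funext u v
    refine propext (and_congr_right fun h1 => and_congr_right fun h2 =>
      and_congr_right fun h3 => ?_)
    rw [hpar v h1 h2 h3]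
  have hin : ∀ v ∈ added m n (m + 1) 0, s.natField .inTree v =
      if v ∈ live g m n (m + 1) 0 then 1 else 0 := by
    rw [e1]; exact hI.tree.inTree
  refine ⟨t, s, hex, ?_, _, _, rfl, rfl, ?_⟩
  · calc t ≤ (d + 4000) * ((m + 1) * (n + 1)) := ht
      _ ≤ (d + 4000) * ((2 * max m 1) * (2 * max n 1)) := by
        gcongr <;> omega
      _ = _ := by ring
  rw [hT, hgrid]
  refine ⟨⟨isPath_of_treePath hout, isOptimal_of_treePath hout⟩, locallyCorrect_of_treePath hout,
    hout, ?_, fun l u v h => ⟨isPath_of_treePath h, stronglyLocallyCorrect_of_treePath h⟩, ?_, ?_,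
    ?_, ?_⟩
  · intro v hv
    have hl : (m, n) ∈ live g m n (m + 1) 0 := by
      apply mem_live_of_not_present
      · exact present_all.2 ⟨le_rfl, le_rfl⟩
      · rw [present_all]; simp
    have h1 : v ∈ anc g (m, n) := by
      obtain ⟨h2, h3⟩ := toFinset_tail_of_treePath _ hout
      cases h : s.out with
      | nil => rw [h] at hv; simp at hv
      | cons x l =>
        rw [h] at hv h3
        have h4 := hout.2.1
        rw [h, List.head?_cons, Option.some.injEq] at h4
        rcases List.mem_cons.1 hv with rfl | hv
        · rw [h4]; exact h2
        · exact (Finset.mem_sdiff.1 (h3 ▸ List.mem_toFinset.2 hv)).1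
    have h2 := anc_subset_live hl h1
    rw [hin v (mem_added.2 (present_of_live h2)), if_pos h2]
  · intro i hi
    rw [hpar (i + 1, 0) hi (Nat.zero_le _) (by simp), par]
  · intro j hj
    rw [hpar (0, j + 1) (Nat.zero_le _) hj (by simp), par]
  · intro i hi j hj
    rw [hpar (i + 1, j + 1) hi hj (by simp)]
    exact isParentChoice_par hi hj
  · intro i hi j hj
    obtain ⟨h1, h2⟩ := hI.record i j hi hj (present_all.2 ⟨hi, hj⟩)
    rw [← e1] at h1 h2
    refine ⟨h1, fun hr => ?_⟩
    obtain ⟨l, hl, h3, h4⟩ := h2 hr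
    refine ⟨l, hl, fun v hv => ?_, h3, h4⟩
    obtain ⟨u, -, -, h5⟩ := hl
    obtain ⟨h6, h7⟩ := removable_iff.1 (h5 v hv)
    rw [hin v (mem_added.2 (present_all.2 ⟨h6.1, h6.2.1⟩)),
      if_neg fun k => h7 (mem_live_of_mem_live_all h6 k)]
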